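/- Let $\Gamma_0,\dots,\Gamma_{10}$ be the real $32\times 32$ Clifford generators of the Majorana representation $\mathbf{32}$ of $\mathrm{Pin}^+(1,10)$, $\Gamma_a\Gamma_b+\Gamma_b\Gamma_a=2\eta_{ab}$ with $\eta=\mathrm{diag}(-1,1,\dots,1)$ and $\Gamma_0\Gamma_1\cdots\Gamma_{10}=1$, equipped with a non-degenerate skew-symmetric bilinear form $(\overline{\phi}\,\psi)$ for which all $\Gamma_a$ are skew-self-adjoint. Put $\Gamma^B_a:=\Gamma_a$ for $a<9$, $\Gamma^B_9:=\Gamma_9\Gamma_{10}$, and let $\Gamma^B_{a_1\cdots a_p}$ be the product of $\Gamma^B_{a_1},\dots,\Gamma^B_{a_p}$ taken in increasing order of the indices, times the sign of the ordering permutation, if the indices are distinct, and $0$ otherwise. Vector indices are raised with $\eta$ and repeated ones are summed over $0,\dots,9$. A super-$L_\infty$ algebra $\mathfrak g$ (of finite type) is given by its Chevalley-Eilenberg algebra $\mathrm{CE}(\mathfrak g)$: the $\mathbb Z\times\mathbb Z_2$-graded-commutative polynomial algebra on generators of bidegrees $(n_i,\sigma_i)$ with sign rule $xy=(-1)^{n_xn_y+\sigma_x\sigma_y}yx$,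 with a differential of bidegree $(1,\mathrm{even})$; homomorphisms $\mathfrak g\to\mathfrak h$ are homomorphisms $\mathrm{CE}(\mathfrak h)\to\mathrm{CE}(\mathfrak g)$ of such differential algebras. The type IIB super-Minkowski algebra $\mathbb R^{1,9|\mathbf{16}\oplus\mathbf{16}}$ has generators $\psi^\alpha$ ($\alpha=1,\dots,32$) of bidegree $(1,\mathrm{odd})$ and $e^a$ ($a=0,\dots,9$) of bidegree $(1,\mathrm{even})$ with $\mathrm d\psi^\alpha=0$, $\mathrm de^a=(\overline\psi\,\Gamma_B^a\,\psi)$; the type IIA algebra $\mathbb R^{1,9|\mathbf{16}\oplus\overline{\mathbf{16}}}$ is the same with $\mathrm de^a=(\overline\psi\,\Gamma^a\,\psi)$, and the 9-dimensional algebra $\mathbb R^{1,8|\mathbf{16}\oplus\mathbf{16}}$ is obtained by omitting $e^9$. For $m\in\{0,1\}$, $\mathfrak l(\Sigma^m\mathrm{KU}/\!\!/B\mathrm U(1))$ has generators $h_3$ and $f_{2k+m}$ ($k\in\mathbb Z$), of even super-degree and of the indicated degrees, with $\mathrm dh_3=0$ and $\mathrm df_{2k+m}=h_3f_{2k+m-2}$;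 it is fibered over $\mathfrak lB^2\mathrm U(1)$ (one closed generator $\omega_3$ of degree 3) by $\omega_3\mapsto h_3$. In the CE-algebra of the type IIB algebra, set $$H_3^B=(\overline\psi\,\Gamma^B_a\Gamma_{10}\,\psi)e^a,\quad F_3=(\overline\psi\,\Gamma^B_a\Gamma_9\,\psi)e^a,\quad F_5=\tfrac1{3!}(\overline\psi\,\Gamma^B_{a_1a_2a_3}\Gamma_9\Gamma_{10}\,\psi)e^{a_1}e^{a_2}e^{a_3},$$ $$F_7=\tfrac1{5!}(\overline\psi\,\Gamma^B_{a_1\cdots a_5}\Gamma_9\,\psi)e^{a_1}\cdots e^{a_5},\quad F_9=\tfrac1{7!}(\overline\psi\,\Gamma^B_{a_1\cdots a_7}\Gamma_9\Gamma_{10}\,\psi)e^{a_1}\cdots e^{a_7},$$ $$F_{11}=\tfrac1{9!}(\overline\psi\,\Gamma^B_{a_1\cdots a_9}\Gamma_9\,\psi)e^{a_1}\cdots e^{a_9},\qquad F_{2k+1}=0\ \text{ for all other } k\in\mathbb Z .$$ Then: 1. $\deg H_3^B=(3,\mathrm{even})$, $\deg F_{2k+1}=(2k+1,\mathrm{even})$,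 $\mathrm dH_3^B=0$ and $\mathrm dF_{2k+1}=H_3^BF_{2k-1}$ for all $k\in\mathbb Z$. 2. Equivalently, $h_3\mapsto H_3^B$, $f_{2k+1}\mapsto F_{2k+1}$ is a super-$L_\infty$ homomorphism $\mathbb R^{1,9|\mathbf{16}\oplus\mathbf{16}}\to\mathfrak l(\Sigma^1\mathrm{KU}/\!\!/B\mathrm U(1))$ over $\mathfrak lB^2\mathrm U(1)$: systems $(H,(F_{2k+1})_{k\in\mathbb Z})$ of elements of these degrees with $\mathrm dH=0$, $\mathrm dF_{2k+1}=H F_{2k-1}$ are in bijection with such homomorphisms. 3. This homomorphism is the T-dual of the type IIA one. Let $H_3^A=(\overline\psi\,\Gamma_a\Gamma_{10}\,\psi)e^a$, $F_2=(\overline\psi\,\Gamma_{10}\,\psi)$, $F_{2j+2}=\frac1{(2j)!}(\overline\psi\,\Gamma_{10}^{\,j+1}\Gamma_{a_1\cdots a_{2j}}\,\psi)e^{a_1}\cdots e^{a_{2j}}$ for $1\le j\le5$ (with $\Gamma_{a_1\cdots a_p}$ the skew-symmetrized product of Clifford generators) and $F_{2k}=0$ for all other $k\in\mathbb Z$; these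 constitute a homomorphism $\mathbb R^{1,9|\mathbf{16}\oplus\overline{\mathbf{16}}}\to\mathfrak l(\Sigma^0\mathrm{KU}/\!\!/B\mathrm U(1))$. The IIA and IIB algebras are, with new generator $e^9$, the central extensions of the 9-dimensional algebra by the 2-cocycles $c_1^A=(\overline\psi\,\Gamma_9\,\psi)$ and $c_1^B=(\overline\psi\,\Gamma_9\Gamma_{10}\,\psi)$. For a super-$L_\infty$ algebra $\mathfrak h$ with generators $e^i$, the cyclification $\mathrm{cyc}\,\mathfrak h$ has generators $\omega_2$, $e^i$, $\mathrm se^i$ with $\mathrm d\omega_2=0$, $\mathrm de^i=\mathrm d_{\mathfrak h}e^i+\omega_2\,\mathrm se^i$, $\mathrm d\,\mathrm se^i=-\mathrm s(\mathrm d_{\mathfrak h}e^i)$, where $\mathrm s$ is the graded derivation of degree $-1$ with $e^i\mapsto\mathrm se^i$, $\mathrm se^i\mapsto0$, $\omega_2\mapsto0$. A map $\tilde f:\mathfrak g\to\mathrm{cyc}\,\mathfrak h$ is the reduction of $f:\hat{\mathfrak g}\to\mathfrak h$ (and $f$ the oxidation of $\tilde f$), for $\hat{\mathfrak g}$ the central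 extension of $\mathfrak g$ by $c$ with new generator $e'$, $\mathrm de'=c$, if $\tilde f^*\omega_2=c$ and $f^*e^i=\tilde f^*e^i-e'\,\tilde f^*(\mathrm se^i)$. Then the type IIA homomorphism has a reduction to 9 dimensions along $c_1^A$, and the oxidation along $c_1^B$ of its composite with the isomorphism $T:\mathrm{cyc}\,\mathfrak l(\Sigma^0\mathrm{KU}/\!\!/B\mathrm U(1))\to\mathrm{cyc}\,\mathfrak l(\Sigma^1\mathrm{KU}/\!\!/B\mathrm U(1))$, $$T^*:\ \omega_2\mapsto-\mathrm sh_3,\quad \mathrm sh_3\mapsto-\omega_2,\quad h_3\mapsto h_3,\quad f_{2k+1}\mapsto\mathrm sf_{2k+2},\quad \mathrm sf_{2k+1}\mapsto f_{2k},$$ is the homomorphism of part 2. -/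

import Mathlib

noncomputable section

namespace SuperL

/-! ### Bigraded-commutative algebras -/

/-- Bidegrees: homological degree in `ℤ`, super-degree in `ℤ/2` (`0` even, `1` odd). -/
abbrev BiDeg : Type := ℤ × ZMod 2

/-- The sign `(-1) ^ (n₁ n₂ + σ₁ σ₂)` of the bigraded sign rule. -/
def koszul (p q : BiDeg) : ℝ := (-1 : ℝ) ^ (p.1 * q.1) * (-1 : ℝ) ^ (p.2 * q.2).val

theorem negOne_pow_val_add (a b : ZMod 2) :
    (-1 : ℝ) ^ (a + b).val = (-1 : ℝ) ^ a.val * (-1 : ℝ) ^ b.val := by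
  have h : ∀ a b : ZMod 2, (a + b).val % 2 = (a.val + b.val) % 2 := by decide
  rw [← pow_add, neg_one_pow_eq_pow_mod_two (a + b).val, h a b, ← neg_one_pow_eq_pow_mod_two]

theorem koszul_add_left (p p' q : BiDeg) : koszul (p + p') q = koszul p q * koszul p' q := by
  simp only [koszul, Prod.fst_add, Prod.snd_add, add_mul, negOne_pow_val_add,
    zpow_add₀ (show (-1 : ℝ) ≠ 0 by norm_num)]
  ring

theorem koszul_comm (p q : BiDeg) : koszul p q = koszul q p := by
  simp only [koszul, mul_comm]

theorem koszul_add_right (p q q' : BiDeg) : koszul p (q + q') = koszul p q * koszul p q' := by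
  rw [koszul_comm, koszul_add_left, koszul_comm q, koszul_comm q']

theorem koszul_mul_self (p q : BiDeg) : koszul p q * koszul p q = 1 := by
  rw [koszul]
  have h1 : (-1 : ℝ) ^ (p.1 * q.1) * (-1 : ℝ) ^ (p.1 * q.1) = 1 := by
    rw [← mul_zpow]; norm_num
  have h2 : (-1 : ℝ) ^ (p.2 * q.2).val * (-1 : ℝ) ^ (p.2 * q.2).val = 1 := by
    rw [← mul_pow]; norm_num
  calc _ = ((-1 : ℝ) ^ (p.1 * q.1) * (-1 : ℝ) ^ (p.1 * q.1)) *
        ((-1 : ℝ) ^ (p.2 * q.2).val * (-1 : ℝ) ^ (p.2 * q.2).val) := by ring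
    _ = 1 := by rw [h1, h2, one_mul]

theorem koszul_zero_right (p : BiDeg) : koszul p 0 = 1 := by simp [koszul]

/-- The sign rule `vᵢ vⱼ = sgn(deg vᵢ, deg vⱼ) vⱼ vᵢ` on generators. -/
inductive SignRel {I : Type*} (deg : I → BiDeg) : FreeAlgebra ℝ I → FreeAlgebra ℝ I → Prop
  | swap (i j : I) : SignRel deg (FreeAlgebra.ι ℝ i * FreeAlgebra.ι ℝ j)
      (koszul (deg i) (deg j) • (FreeAlgebra.ι ℝ j * FreeAlgebra.ι ℝ i))

/-- The graded-commutative polynomial algebra `ℝ[(vᵢ)]`: the tensor algebra on the generators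
modulo the sign rule. -/
def GCAlg {I : Type*} (deg : I → BiDeg) : Type _ := RingQuot (SignRel deg)

instance {I : Type*} (deg : I → BiDeg) : Ring (GCAlg deg) :=
  inferInstanceAs (Ring (RingQuot (SignRel deg)))

instance {I : Type*} (deg : I → BiDeg) : Algebra ℝ (GCAlg deg) :=
  inferInstanceAs (Algebra ℝ (RingQuot (SignRel deg)))

namespace GCAlg

variable {I : Type*} {deg : I → BiDeg}

/-- The quotient map from the tensor algebra. -/
def mk (deg : I → BiDeg) : FreeAlgebra ℝ I →ₐ[ℝ] GCAlg deg := RingQuot.mkAlgHom ℝ (SignRel deg)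

/-- The generators. -/
def gen (deg : I → BiDeg) (i : I) : GCAlg deg := mk deg (FreeAlgebra.ι ℝ i)

theorem gen_mul_gen (i j : I) :
    gen deg i * gen deg j = koszul (deg i) (deg j) • (gen deg j * gen deg i) := by
  have h := RingQuot.mkAlgHom_rel ℝ (SignRel.swap (deg := deg) i j)
  rw [map_mul, map_smul, map_mul] at h
  exact h

/-- The universal property of the graded-commutative polynomial algebra. -/
def lift {A : Type*} [Ring A] [Algebra ℝ A] (φ : I → A)
    (h : ∀ i j, φ i * φ j = koszul (deg i) (deg j) • (φ j * φ i)) : GCAlg deg →ₐ[ℝ] A :=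
  RingQuot.liftAlgHom ℝ ⟨FreeAlgebra.lift ℝ φ, by
    rintro _ _ ⟨i, j⟩
    simpa using h i j⟩

@[simp]
theorem lift_gen {A : Type*} [Ring A] [Algebra ℝ A] (φ : I → A)
    (h : ∀ i j, φ i * φ j = koszul (deg i) (deg j) • (φ j * φ i)) (i : I) :
    lift φ h (gen deg i) = φ i := by
  have := RingQuot.liftAlgHom_mkAlgHom_apply ℝ (s := SignRel deg) (FreeAlgebra.lift ℝ φ) (by
    rintro _ _ ⟨i, j⟩
    simpa using h i j) (FreeAlgebra.ι ℝ i)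
  rw [FreeAlgebra.lift_ι_apply] at this
  exact this

/-- The elements of bidegree `n`: linear combinations of words of total bidegree `n`. -/
def homog (deg : I → BiDeg) (n : BiDeg) : Submodule ℝ (GCAlg deg) :=
  Submodule.span ℝ {x | ∃ l : List I, (l.map deg).sum = n ∧ x = (l.map (gen deg)).prod}

theorem word_mem (l : List I) : (l.map (gen deg)).prod ∈ homog deg (l.map deg).sum :=
  Submodule.subset_span ⟨l, rfl, rfl⟩

theorem gen_mem (i : I) : gen deg i ∈ homog deg (deg i) := by
  simpa using word_mem (deg := deg) [i]

theorem one_mem : (1 : GCAlg deg) ∈ homog deg 0 := by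
  simpa using word_mem (deg := deg) []

theorem mul_mem {m n : BiDeg} {x y : GCAlg deg} (hx : x ∈ homog deg m) (hy : y ∈ homog deg n) :
    x * y ∈ homog deg (m + n) := by
  induction hx using Submodule.span_induction with
  | mem x hx =>
    obtain ⟨l, rfl, rfl⟩ := hx
    induction hy using Submodule.span_induction with
    | mem y hy =>
      obtain ⟨l', rfl, rfl⟩ := hy
      have := word_mem (deg := deg) (l ++ l')
      simpa using this
    | zero => simp
    | add y z _ _ h1 h2 => rw [mul_add]; exact add_mem h1 h2
    | smul c y _ h => rw [mul_smul_comm]; exact Submodule.smul_mem _ _ h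
  | zero => simp
  | add y z _ _ h1 h2 => rw [add_mul]; exact add_mem h1 h2
  | smul c y _ h => rw [smul_mul_assoc]; exact Submodule.smul_mem _ _ h

/-- The words span. -/
theorem span_words :
    Submodule.span ℝ (Set.range fun l : List I => (l.map (gen deg)).prod) = ⊤ := by
  set W := Submodule.span ℝ (Set.range fun l : List I => (l.map (gen deg)).prod) with hW
  have hg : ∀ (i : I) (x : GCAlg deg), x ∈ W → gen deg i * x ∈ W := by
    intro i x hx
    induction hx using Submodule.span_induction with
    | mem x hx =>
      obtain ⟨l, rfl⟩ := hx
      exact Submodule.subset_span ⟨i :: l, by simp⟩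
    | zero => simp
    | add y z _ _ h1 h2 => rw [mul_add]; exact add_mem h1 h2
    | smul c y _ h => rw [mul_smul_comm]; exact Submodule.smul_mem _ _ h
  have key : ∀ (a : FreeAlgebra ℝ I) (x : GCAlg deg), x ∈ W →
      mk deg a * x ∈ W := by
    intro a
    induction a using FreeAlgebra.induction with
    | grade0 r =>
      intro x hx
      have : mk deg (algebraMap ℝ (FreeAlgebra ℝ I) r) * x = r • x := by
        rw [AlgHom.commutes, ← Algebra.smul_def]
      exact this ▸ Submodule.smul_mem _ _ hx
    | grade1 i => intro x hx; exact hg i x hx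
    | mul a b ha hb =>
      intro x hx
      have : mk deg (a * b) * x =
          mk deg a * (mk deg b * x) := by
        rw [map_mul, mul_assoc]
      exact this ▸ ha _ (hb _ hx)
    | add a b ha hb =>
      intro x hx
      have : mk deg (a + b) * x =
          mk deg a * x +
            mk deg b * x := by
        rw [map_add, add_mul]
      exact this ▸ add_mem (ha _ hx) (hb _ hx)
  rw [eq_top_iff]
  intro x _
  obtain ⟨a, rfl⟩ := RingQuot.mkAlgHom_surjective ℝ (SignRel deg) x
  have h1 : (1 : GCAlg deg) ∈ W := Submodule.subset_span ⟨[], by simp⟩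
  have := key a 1 h1
  rwa [mul_one] at this

/-- Two linear maps agree if they agree on words. -/
theorem linearMap_ext {M : Type*} [AddCommGroup M] [Module ℝ M] {f g : GCAlg deg →ₗ[ℝ] M}
    (h : ∀ l : List I, f (l.map (gen deg)).prod = g (l.map (gen deg)).prod) : f = g :=
  LinearMap.ext_on_range span_words h

theorem algHom_ext {A : Type*} [Ring A] [Algebra ℝ A] {f g : GCAlg deg →ₐ[ℝ] A}
    (h : ∀ i, f (gen deg i) = g (gen deg i)) : f = g := by
  apply AlgHom.toLinearMap_injective
  apply linearMap_ext
  intro l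
  simp only [AlgHom.toLinearMap_apply, map_list_prod, List.map_map]
  congr 1
  exact List.map_congr_left fun i _ => h i

theorem eq_zero_of_eq_neg {x : GCAlg deg} (h : x = -x) : x = 0 := by
  have h2 : (2 : ℝ) • x = 0 := by
    rw [two_smul]
    nth_rewrite 1 [h]
    exact neg_add_cancel x
  have := congrArg (fun y => (2 : ℝ)⁻¹ • y) h2
  simpa [smul_smul] using this

/-- Homogeneous elements commute with generators up to the sign rule. -/
theorem homog_mul_gen {n : BiDeg} {x : GCAlg deg} (hx : x ∈ homog deg n) (j : I) :
    x * gen deg j = koszul n (deg j) • (gen deg j * x) := by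
  induction hx using Submodule.span_induction with
  | mem x hx =>
    obtain ⟨l, rfl, rfl⟩ := hx
    induction l with
    | nil => simp [koszul]
    | cons i l ih =>
      simp only [List.map_cons, List.prod_cons, List.sum_cons, koszul_add_left]
      rw [mul_assoc, ih, mul_smul_comm, ← mul_assoc, gen_mul_gen i j, smul_mul_assoc, smul_smul,
        mul_assoc, mul_comm]
  | zero => simp
  | add y z _ _ h1 h2 => rw [add_mul, mul_add, smul_add, h1, h2]
  | smul c y _ h => rw [smul_mul_assoc, h, mul_smul_comm, smul_comm]

/-- Homogeneous elements commute up to the sign rule. -/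
theorem homog_mul_homog {m n : BiDeg} {x y : GCAlg deg} (hx : x ∈ homog deg m)
    (hy : y ∈ homog deg n) : x * y = koszul m n • (y * x) := by
  induction hy using Submodule.span_induction with
  | mem y hy =>
    obtain ⟨l, rfl, rfl⟩ := hy
    induction l with
    | nil => simp [koszul]
    | cons i l ih =>
      simp only [List.map_cons, List.prod_cons, List.sum_cons, koszul_add_right]
      rw [← mul_assoc, homog_mul_gen hx i, smul_mul_assoc, mul_assoc, ih, mul_smul_comm, smul_smul,
        mul_assoc]
  | zero => simp
  | add y z _ _ h1 h2 => rw [add_mul, mul_add, smul_add, h1, h2]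
  | smul c y _ h => rw [smul_mul_assoc, mul_smul_comm, h, smul_comm]

/-- An assignment of generators to homogeneous elements of the same degrees extends. -/
def homogLift {J : Type*} {deg' : J → BiDeg} (φ : I → GCAlg deg')
    (hφ : ∀ i, φ i ∈ homog deg' (deg i)) : GCAlg deg →ₐ[ℝ] GCAlg deg' :=
  lift φ fun i j => homog_mul_homog (hφ i) (hφ j)

@[simp]
theorem homogLift_gen {J : Type*} {deg' : J → BiDeg} (φ : I → GCAlg deg')
    (hφ : ∀ i, φ i ∈ homog deg' (deg i)) (i : I) : homogLift φ hφ (gen deg i) = φ i :=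
  lift_gen _ _ i

/-- An algebra map preserves bidegrees as soon as it does so on generators. -/
theorem map_mem {J : Type*} {deg' : J → BiDeg} (f : GCAlg deg →ₐ[ℝ] GCAlg deg')
    (hf : ∀ i, f (gen deg i) ∈ homog deg' (deg i)) {n : BiDeg} {x : GCAlg deg}
    (hx : x ∈ homog deg n) : f x ∈ homog deg' n := by
  induction hx using Submodule.span_induction with
  | mem x hx =>
    obtain ⟨l, rfl, rfl⟩ := hx
    induction l with
    | nil => simpa using one_mem (deg := deg')
    | cons i l ih =>
      simp only [List.map_cons, List.prod_cons, List.sum_cons, map_mul]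
      exact mul_mem (hf i) ih
  | zero => simp
  | add y z _ _ h1 h2 => rw [map_add]; exact add_mem h1 h2
  | smul c y _ h => rw [map_smul]; exact Submodule.smul_mem _ _ h

/-! ### Graded derivations -/

/-- The algebra map `x ↦ (± x, D x; 0, x)` whose off-diagonal entry is the graded derivation `D`
of bidegree `p` with values `P i` on the generators. -/
def derMatrix (p : BiDeg) (P : I → GCAlg deg) (hP : ∀ i, P i ∈ homog deg (deg i + p)) :
    GCAlg deg →ₐ[ℝ] Matrix (Fin 2) (Fin 2) (GCAlg deg) :=
  lift (fun i => !![koszul p (deg i) • gen deg i, P i; 0, gen deg i]) (by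
    intro i j
    have h1 := homog_mul_gen (hP i) j
    have h2 := homog_mul_gen (hP j) i
    have h3 := koszul_mul_self p (deg i)
    have h4 := koszul_mul_self (deg i) (deg j)
    have e : gen deg i * P j = (koszul (deg i) (deg j) * koszul p (deg i)) • (P j * gen deg i) := by
      rw [h2, smul_smul, koszul_add_left, koszul_comm (deg j) (deg i)]
      rw [show koszul (deg i) (deg j) * koszul p (deg i) *
        (koszul (deg i) (deg j) * koszul p (deg i)) =
        (koszul (deg i) (deg j) * koszul (deg i) (deg j)) *
          (koszul p (deg i) * koszul p (deg i)) by ring, h3, h4]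
      simp
    ext a b
    fin_cases a <;> fin_cases b
    · simp [Matrix.mul_apply, Fin.sum_univ_two, gen_mul_gen i j, smul_smul]
      congr 1; ring
    · simp [Matrix.mul_apply, Fin.sum_univ_two, e, h1, smul_smul, koszul_add_left]
      rw [show koszul p (deg i) * (koszul (deg i) (deg j) * koszul p (deg i)) =
        koszul (deg i) (deg j) * (koszul p (deg i) * koszul p (deg i)) by ring, h3, mul_one,
        add_comm]
    · simp [Matrix.mul_apply, Fin.sum_univ_two]
    · simp [Matrix.mul_apply, Fin.sum_univ_two, gen_mul_gen i j])

/-- The graded derivation of bidegree `p` with the given values on the generators. -/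
def gradedDer (p : BiDeg) (P : I → GCAlg deg) (hP : ∀ i, P i ∈ homog deg (deg i + p)) :
    GCAlg deg →ₗ[ℝ] GCAlg deg :=
  Matrix.entryLinearMap ℝ (GCAlg deg) (0 : Fin 2) (1 : Fin 2) ∘ₗ (derMatrix p P hP).toLinearMap

section

variable (p : BiDeg) (P : I → GCAlg deg) (hP : ∀ i, P i ∈ homog deg (deg i + p))

@[simp]
theorem gradedDer_gen (i : I) : gradedDer p P hP (gen deg i) = P i := by
  simp [gradedDer, derMatrix]

@[simp]
theorem gradedDer_one : gradedDer p P hP 1 = 0 := by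
  simp [gradedDer]

theorem gradedDer_gen_mul (i : I) (x : GCAlg deg) :
    gradedDer p P hP (gen deg i * x) =
      P i * x + koszul p (deg i) • (gen deg i * gradedDer p P hP x) := by
  have h11 : ∀ l : List I,
      derMatrix p P hP (l.map (gen deg)).prod 1 1 = (l.map (gen deg)).prod := by
    intro l
    induction l with
    | nil => simp
    | cons i l ih =>
      simp only [List.map_cons, List.prod_cons, map_mul, Matrix.mul_apply, Fin.sum_univ_two, ih]
      simp [derMatrix]
  have h11' : Matrix.entryLinearMap ℝ (GCAlg deg) (1 : Fin 2) (1 : Fin 2) ∘ₗ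
      (derMatrix p P hP).toLinearMap = LinearMap.id := linearMap_ext h11
  have hx : derMatrix p P hP x 1 1 = x := LinearMap.congr_fun h11' x
  have hm : gradedDer p P hP (gen deg i * x) = derMatrix p P hP (gen deg i * x) 0 1 := rfl
  rw [hm, map_mul, Matrix.mul_apply, Fin.sum_univ_two, hx, add_comm]
  have h0 : derMatrix p P hP (gen deg i) 0 1 = P i := by simp [derMatrix]
  have h1 : derMatrix p P hP (gen deg i) 0 0 = koszul p (deg i) • gen deg i := by simp [derMatrix]
  rw [h0, h1, smul_mul_assoc]
  rfl

/-- The graded Leibniz rule. -/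
theorem gradedDer_mul {n : BiDeg} {x : GCAlg deg} (hx : x ∈ homog deg n) (y : GCAlg deg) :
    gradedDer p P hP (x * y) =
      gradedDer p P hP x * y + koszul p n • (x * gradedDer p P hP y) := by
  induction hx using Submodule.span_induction with
  | mem x hx =>
    obtain ⟨l, rfl, rfl⟩ := hx
    induction l with
    | nil => simp [koszul_zero_right]
    | cons i l ih =>
      simp only [List.map_cons, List.prod_cons, List.sum_cons, mul_assoc, gradedDer_gen_mul, ih,
        koszul_add_right, mul_add, add_mul, smul_add, mul_smul_comm, smul_mul_assoc, smul_smul]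
      abel
  | zero => simp
  | add y z _ _ h1 h2 => simp only [add_mul, map_add, h1, h2, smul_add]; abel
  | smul c y _ h =>
    simp only [smul_mul_assoc, map_smul, h, smul_add]
    rw [smul_comm c]

theorem gradedDer_mem {n : BiDeg} {x : GCAlg deg} (hx : x ∈ homog deg n) :
    gradedDer p P hP x ∈ homog deg (n + p) := by
  induction hx using Submodule.span_induction with
  | mem x hx =>
    obtain ⟨l, rfl, rfl⟩ := hx
    induction l with
    | nil => simp
    | cons i l ih =>
      simp only [List.map_cons, List.prod_cons, List.sum_cons, gradedDer_gen_mul]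
      refine add_mem ?_ (Submodule.smul_mem _ _ ?_)
      · have := mul_mem (hP i) (word_mem (deg := deg) l)
        rwa [add_right_comm] at this
      · have := mul_mem (gen_mem (deg := deg) i) ih
        rwa [← add_assoc] at this
  | zero => simp
  | add y z _ _ h1 h2 => rw [map_add]; exact add_mem h1 h2
  | smul c y _ h => rw [map_smul]; exact Submodule.smul_mem _ _ h

/-- A linear map that obeys the graded Leibniz rule along an algebra map is determined by its
values on generators. -/
theorem leibniz_ext {A : Type*} [Ring A] [Algebra ℝ A] (φ : GCAlg deg →ₐ[ℝ] A)
    {L L' : GCAlg deg →ₗ[ℝ] A} (h1 : L 1 = L' 1)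
    (hL : ∀ i x, L (gen deg i * x) =
      L (gen deg i) * φ x + koszul p (deg i) • (φ (gen deg i) * L x))
    (hL' : ∀ i x, L' (gen deg i * x) =
      L' (gen deg i) * φ x + koszul p (deg i) • (φ (gen deg i) * L' x))
    (hg : ∀ i, L (gen deg i) = L' (gen deg i)) : L = L' := by
  apply linearMap_ext
  intro l
  induction l with
  | nil => simpa using h1
  | cons i l ih => simp only [List.map_cons, List.prod_cons, hL, hL', hg, ih]

end

end GCAlg

open GCAlg

/-! ### Super-`L∞` algebras of finite type -/

/-- A super-`L∞` algebra of finite type, presented dually by its Chevalley-Eilenberg algebra: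
generators with bidegrees (finitely many in each bidegree), and polynomials `dgen i` prescribing
the differential of the generators, whose extension to a graded derivation of bidegree `(1, even)`
squares to zero. -/
structure SuperLInf : Type 1 where
  Gen : Type
  deg : Gen → BiDeg
  finiteType : ∀ n, {i | deg i = n}.Finite
  dgen : Gen → GCAlg deg
  dgen_mem : ∀ i, dgen i ∈ homog deg (deg i + (1, 0))
  d_dgen : ∀ i, gradedDer (1, 0) dgen dgen_mem (dgen i) = 0

namespace SuperLInf

/-- The Chevalley-Eilenberg algebra. -/
abbrev CE (g : SuperLInf) : Type := GCAlg g.deg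

/-- The generators of the Chevalley-Eilenberg algebra. -/
abbrev gen (g : SuperLInf) (i : g.Gen) : g.CE := GCAlg.gen g.deg i

/-- The elements of given bidegree in the Chevalley-Eilenberg algebra. -/
abbrev homog (g : SuperLInf) (n : BiDeg) : Submodule ℝ g.CE := GCAlg.homog g.deg n

/-- The differential of the Chevalley-Eilenberg algebra. -/
def d (g : SuperLInf) : g.CE →ₗ[ℝ] g.CE := gradedDer (1, 0) g.dgen g.dgen_mem

theorem d_gen (g : SuperLInf) (i : g.Gen) : g.d (g.gen i) = g.dgen i := gradedDer_gen _ _ _ i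

theorem d_one (g : SuperLInf) : g.d 1 = 0 := gradedDer_one _ _ _

theorem d_mul (g : SuperLInf) {n : BiDeg} {x : g.CE} (hx : x ∈ g.homog n) (y : g.CE) :
    g.d (x * y) = g.d x * y + koszul (1, 0) n • (x * g.d y) := gradedDer_mul _ _ _ hx y

/-- A homomorphism `g ⟶ h` of super-`L∞` algebras: dually, a homomorphism
`CE h → CE g` of differential bigraded algebras. -/
@[ext]
structure Hom (g h : SuperLInf) where
  pull : h.CE →ₐ[ℝ] g.CE
  pull_mem : ∀ n x, x ∈ h.homog n → pull x ∈ g.homog n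
  pull_d : ∀ x, pull (h.d x) = g.d (pull x)

/-- Composition `g ⟶ h ⟶ k`. -/
def Hom.comp {g h k : SuperLInf} (f : Hom g h) (f' : Hom h k) : Hom g k where
  pull := f.pull.comp f'.pull
  pull_mem n x hx := f.pull_mem n _ (f'.pull_mem n x hx)
  pull_d x := by simp [f'.pull_d, f.pull_d]

/-- Isomorphisms of super-`L∞` algebras. -/
def Hom.IsIso {g h : SuperLInf} (f : Hom g h) : Prop := Function.Bijective f.pull

/-- A homomorphism is given by images of the generators that respect bidegree and differential. -/
def Hom.ofGens {g h : SuperLInf} (φ : h.Gen → g.CE) (hφ : ∀ i, φ i ∈ g.homog (h.deg i))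
    (hd : ∀ i, homogLift φ hφ (h.dgen i) = g.d (φ i)) : Hom g h where
  pull := homogLift φ hφ
  pull_mem n x hx := map_mem _ (by simpa using hφ) hx
  pull_d x := by
    have key : (homogLift φ hφ).toLinearMap ∘ₗ h.d = g.d ∘ₗ (homogLift φ hφ).toLinearMap := by
      apply leibniz_ext (1, 0) (homogLift φ hφ)
      · simp [d_one]
      · intro i x
        simp only [LinearMap.comp_apply, AlgHom.toLinearMap_apply]
        rw [h.d_mul (gen_mem i)]
        simp
      · intro i x
        simp only [LinearMap.comp_apply, AlgHom.toLinearMap_apply]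
        rw [map_mul, homogLift_gen, g.d_mul (hφ i)]
      · intro i
        simp only [LinearMap.comp_apply, AlgHom.toLinearMap_apply]
        rw [h.d_gen, homogLift_gen, hd]
    exact LinearMap.congr_fun key x

/-! ### Central extensions -/

section

variable (g : SuperLInf) (c : g.CE) (hc : c ∈ g.homog (2, 0)) (hdc : g.d c = 0)

/-- Bidegrees of the generators of a central extension; `none` is the new generator `e'`. -/
def extDeg : Option g.Gen → BiDeg
  | none => (1, 0)
  | some i => g.deg i

/-- The inclusion of basic forms (the underlying algebra map of the pullback `p^*`). -/
def basicIncl : g.CE →ₐ[ℝ] GCAlg g.extDeg :=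
  homogLift (fun i => GCAlg.gen g.extDeg (some i)) fun i => gen_mem (deg := g.extDeg) (some i)

@[simp]
theorem basicIncl_gen (i : g.Gen) :
    g.basicIncl (GCAlg.gen g.deg i) = GCAlg.gen g.extDeg (some i) :=
  homogLift_gen _ _ i

theorem basicIncl_mem {n : BiDeg} {x : g.CE} (hx : x ∈ g.homog n) :
    g.basicIncl x ∈ GCAlg.homog g.extDeg n :=
  map_mem _ (fun i => by
    rw [basicIncl_gen]; exact gen_mem (deg := g.extDeg) (some i)) hx

/-- The differentials of the generators of the central extension: `d e' = c`. -/
def extDgen : Option g.Gen → GCAlg g.extDeg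
  | none => g.basicIncl c
  | some i => g.basicIncl (g.dgen i)

theorem extDgen_mem (g : SuperLInf) (c : g.CE) (hc : c ∈ g.homog (2, 0)) (o : Option g.Gen) :
    g.extDgen c o ∈ GCAlg.homog g.extDeg (g.extDeg o + (1, 0)) := by
  cases o with
  | none => exact g.basicIncl_mem hc
  | some i => exact g.basicIncl_mem (g.dgen_mem i)

theorem ext_d_basicIncl (x : g.CE) :
    gradedDer (1, 0) (g.extDgen c) (g.extDgen_mem c hc) (g.basicIncl x) = g.basicIncl (g.d x) := by
  have key : gradedDer (1, 0) (g.extDgen c) (g.extDgen_mem c hc) ∘ₗ g.basicIncl.toLinearMap =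
      g.basicIncl.toLinearMap ∘ₗ g.d := by
    apply leibniz_ext (1, 0) g.basicIncl
    · simp [d_one]
    · intro i x
      simp only [LinearMap.comp_apply, AlgHom.toLinearMap_apply]
      rw [map_mul, gradedDer_mul _ _ _ (g.basicIncl_mem (gen_mem i))]
    · intro i x
      simp only [LinearMap.comp_apply, AlgHom.toLinearMap_apply]
      rw [g.d_mul (gen_mem i)]
      simp
    · intro i
      simp only [LinearMap.comp_apply, AlgHom.toLinearMap_apply, d_gen]
      rw [basicIncl_gen, gradedDer_gen]; rfl
  exact LinearMap.congr_fun key x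

/-- The central extension of `g` by the 2-cocycle `c`. -/
abbrev centralExt (g : SuperLInf) (c : g.CE) (hc : c ∈ g.homog (2, 0)) (hdc : g.d c = 0) :
    SuperLInf where
  Gen := Option g.Gen
  deg := g.extDeg
  finiteType n := by
    refine ((g.finiteType n).image some |>.insert none).subset ?_
    rintro (_ | i) hi
    · exact Set.mem_insert _ _
    · exact Set.mem_insert_of_mem _ ⟨i, hi, rfl⟩
  dgen := g.extDgen c
  dgen_mem := g.extDgen_mem c hc
  d_dgen o := by
    cases o with
    | none => simp only [extDgen]; rw [ext_d_basicIncl _ _ hc, hdc, map_zero]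
    | some i =>
      simp only [extDgen]
      rw [ext_d_basicIncl _ _ hc, show g.d (g.dgen i) = 0 from g.d_dgen i, map_zero]

end

/-! ### Cyclification -/

/-- Generators of the cyclification: `ω₂`, the original generators `eⁱ`, and the shifted
generators `s eⁱ`. -/
inductive CycGen (I : Type) : Type
  | omega : CycGen I
  | base : I → CycGen I
  | shift : I → CycGen I

section

variable (h : SuperLInf)

/-- Bidegrees of the generators of the cyclification. -/
def cycDeg : CycGen h.Gen → BiDeg
  | .omega => (2, 0)
  | .base i => h.deg i
  | .shift i => h.deg i + (-1, 0)

/-- The inclusion `CE h → CE (cyc h)` of underlying algebras, `eⁱ ↦ eⁱ`. -/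
def cycIncl : h.CE →ₐ[ℝ] GCAlg h.cycDeg :=
  homogLift (fun i => GCAlg.gen h.cycDeg (.base i)) fun i => gen_mem (deg := h.cycDeg) (.base i)

@[simp]
theorem cycIncl_gen (i : h.Gen) : h.cycIncl (GCAlg.gen h.deg i) = GCAlg.gen h.cycDeg (.base i) :=
  homogLift_gen _ _ i

theorem cycIncl_mem {n : BiDeg} {x : h.CE} (hx : x ∈ h.homog n) :
    h.cycIncl x ∈ GCAlg.homog h.cycDeg n :=
  map_mem _ (fun i => by
    rw [cycIncl_gen]; exact gen_mem (deg := h.cycDeg) (.base i)) hx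

/-- Values of the shift `s` on generators. -/
def shiftGen : CycGen h.Gen → GCAlg h.cycDeg
  | .omega => 0
  | .base i => GCAlg.gen h.cycDeg (.shift i)
  | .shift _ => 0

theorem shiftGen_mem (j : CycGen h.Gen) :
    h.shiftGen j ∈ GCAlg.homog h.cycDeg (h.cycDeg j + (-1, 0)) := by
  cases j with
  | omega => exact zero_mem _
  | base i => exact gen_mem (deg := h.cycDeg) (.shift i)
  | shift i => exact zero_mem _

/-- The shift `s`, a graded derivation of bidegree `(-1, even)`. -/
def shift : GCAlg h.cycDeg →ₗ[ℝ] GCAlg h.cycDeg :=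
  gradedDer (-1, 0) h.shiftGen h.shiftGen_mem

/-- Differentials of the generators of the cyclification. -/
def cycDgen : CycGen h.Gen → GCAlg h.cycDeg
  | .omega => 0
  | .base i => h.cycIncl (h.dgen i) +
      GCAlg.gen h.cycDeg .omega * GCAlg.gen h.cycDeg (.shift i)
  | .shift i => -h.shift (h.cycIncl (h.dgen i))

theorem cycDgen_mem (j : CycGen h.Gen) :
    h.cycDgen j ∈ GCAlg.homog h.cycDeg (h.cycDeg j + (1, 0)) := by
  cases j with
  | omega => exact zero_mem _
  | base i =>
    refine add_mem (h.cycIncl_mem (h.dgen_mem i)) ?_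
    have := GCAlg.mul_mem (gen_mem (deg := h.cycDeg) .omega) (gen_mem (deg := h.cycDeg) (.shift i))
    have e : h.cycDeg .omega + h.cycDeg (.shift i) = h.cycDeg (.base i) + (1, 0) := by
      simp only [cycDeg]
      ext <;> simp
      ring
    rwa [e] at this
  | shift i =>
    refine neg_mem ?_
    have := gradedDer_mem (-1, 0) h.shiftGen h.shiftGen_mem (h.cycIncl_mem (h.dgen_mem i))
    rwa [add_right_comm] at this

/-- The differential of the cyclification (as a linear map). -/
def cycD : GCAlg h.cycDeg →ₗ[ℝ] GCAlg h.cycDeg :=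
  gradedDer (1, 0) h.cycDgen h.cycDgen_mem

theorem koszul_two (p : BiDeg) : koszul p (2, 0) = 1 := by
  simp only [koszul]
  rw [mul_comm p.1 2, zpow_mul]
  simp

theorem cycD_cycIncl (x : h.CE) : h.cycD (h.cycIncl x) =
    h.cycIncl (h.d x) + GCAlg.gen h.cycDeg .omega * h.shift (h.cycIncl x) := by
  have hk : ∀ n : BiDeg, koszul (-1, 0) n = koszul (1, 0) n := by
    intro n
    have : koszul (1, 0) n * koszul (-1, 0) n = 1 := by
      rw [← koszul_add_left, koszul_comm]
      exact koszul_zero_right n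
    have h2 := koszul_mul_self (1, 0) n
    have h0 : koszul (1, 0) n ≠ 0 := by
      intro h0; rw [h0] at h2; simp at h2
    exact mul_left_cancel₀ h0 (this.trans h2.symm)
  have key : h.cycD ∘ₗ h.cycIncl.toLinearMap = h.cycIncl.toLinearMap ∘ₗ h.d +
      LinearMap.mulLeft ℝ (GCAlg.gen h.cycDeg .omega) ∘ₗ h.shift ∘ₗ h.cycIncl.toLinearMap := by
    apply leibniz_ext (1, 0) h.cycIncl
    · simp [d_one, shift, cycD]
    · intro i x
      simp only [LinearMap.comp_apply, AlgHom.toLinearMap_apply]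
      rw [map_mul, cycD, gradedDer_mul _ _ _ (h.cycIncl_mem (gen_mem i))]
    · intro i x
      simp only [LinearMap.comp_apply, AlgHom.toLinearMap_apply, LinearMap.add_apply,
        LinearMap.mulLeft_apply]
      rw [h.d_mul (gen_mem i), map_mul h.cycIncl, shift,
        gradedDer_mul _ _ _ (h.cycIncl_mem (gen_mem i)), hk]
      have hw := homog_mul_gen (h.cycIncl_mem (gen_mem (deg := h.deg) i)) CycGen.omega
      have hw' : koszul (h.deg i) (h.cycDeg .omega) = 1 := koszul_two _
      rw [hw', one_smul] at hw
      simp only [map_add, map_mul, map_smul, mul_add, add_mul, smul_add, mul_smul_comm,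
        ← mul_assoc]
      rw [hw]
      abel
    · intro i
      simp only [LinearMap.comp_apply, AlgHom.toLinearMap_apply, LinearMap.add_apply,
        LinearMap.mulLeft_apply, d_gen, cycIncl_gen]
      simp [cycD, cycDgen, shift, shiftGen]
  exact LinearMap.congr_fun key x

end

end SuperLInf

namespace GCAlg

/-- The graded commutator of two odd derivations is determined on generators. -/
theorem anticomm_eq_zero {I : Type*} {deg : I → BiDeg} (p q : BiDeg) (P Q : I → GCAlg deg)
    (hP : ∀ i, P i ∈ homog deg (deg i + p)) (hQ : ∀ i, Q i ∈ homog deg (deg i + q))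
    (hpq : koszul p q = -1)
    (hg : ∀ i, gradedDer p P hP (Q i) + gradedDer q Q hQ (P i) = 0) (x : GCAlg deg) :
    gradedDer p P hP (gradedDer q Q hQ x) + gradedDer q Q hQ (gradedDer p P hP x) = 0 := by
  have key : gradedDer p P hP ∘ₗ gradedDer q Q hQ + gradedDer q Q hQ ∘ₗ gradedDer p P hP = 0 := by
    apply leibniz_ext (p + q) (AlgHom.id ℝ _)
    · simp
    · intro i x
      simp only [LinearMap.comp_apply, LinearMap.add_apply, AlgHom.id_apply, gradedDer_gen_mul,
        gradedDer_gen, map_add, map_smul]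
      rw [gradedDer_mul p P hP (hQ i), gradedDer_mul q Q hQ (hP i)]
      simp only [koszul_add_right, koszul_add_left, hpq, koszul_comm q p, mul_add, add_mul,
        smul_add, smul_smul]
      rw [mul_comm (koszul q (deg i)) (koszul p (deg i))]
      simp only [mul_neg, mul_one, neg_smul]
      abel
    · intro i x; simp
    · intro i
      simpa using hg i
  exact LinearMap.congr_fun key x

end GCAlg

namespace SuperLInf

section

variable (h : SuperLInf)

theorem shift_shift (x : GCAlg h.cycDeg) : h.shift (h.shift x) = 0 := by
  have := anticomm_eq_zero (-1, 0) (-1, 0) h.shiftGen h.shiftGen h.shiftGen_mem h.shiftGen_mem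
    (by norm_num [koszul]) (by rintro (_ | i | i) <;> simp [shiftGen]) x
  exact eq_zero_of_eq_neg (eq_neg_of_add_eq_zero_left this)

theorem shift_cycD (x : GCAlg h.cycDeg) : h.shift (h.cycD x) + h.cycD (h.shift x) = 0 := by
  refine anticomm_eq_zero (-1, 0) (1, 0) h.shiftGen h.cycDgen h.shiftGen_mem h.cycDgen_mem
    (by norm_num [koszul]) ?_ x
  rintro (_ | i | i)
  · simp [shiftGen, cycDgen]
  · simp only [shiftGen, cycDgen, map_add, gradedDer_gen_mul, gradedDer_gen]
    simp [shift]
  · simp only [shiftGen, cycDgen, map_neg, map_zero, add_zero]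
    have := h.shift_shift (h.cycIncl (h.dgen i))
    simp only [shift] at this ⊢
    rw [this, neg_zero]

theorem cycD_base (i : h.Gen) : h.cycD (h.cycIncl (h.dgen i)) =
    GCAlg.gen h.cycDeg .omega * h.shift (h.cycIncl (h.dgen i)) := by
  rw [cycD_cycIncl, show h.d (h.dgen i) = 0 from h.d_dgen i, map_zero, zero_add]

/-- The cyclification of a super-`L∞` algebra:
`d ω₂ = 0`, `d eⁱ = d_h eⁱ + ω₂ s eⁱ`, `d s eⁱ = - s (d_h eⁱ)`. -/
abbrev cyc : SuperLInf where
  Gen := CycGen h.Gen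
  deg := h.cycDeg
  finiteType n := by
    refine ((((h.finiteType n).image CycGen.base).union
      ((h.finiteType (n + (1, 0))).image CycGen.shift)).insert CycGen.omega).subset ?_
    rintro (_ | i | i) hi
    · exact Set.mem_insert _ _
    · exact Set.mem_insert_of_mem _ (Or.inl ⟨i, hi, rfl⟩)
    · refine Set.mem_insert_of_mem _ (Or.inr ⟨i, ?_, rfl⟩)
      have hi' : h.deg i + (-1, 0) = n := hi
      change h.deg i = n + (1, 0)
      rw [← hi', add_assoc]
      simp
  dgen := h.cycDgen
  dgen_mem := h.cycDgen_mem
  d_dgen j := by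
    change h.cycD (h.cycDgen j) = 0
    rcases j with _ | i | i
    · simp [cycDgen]
    · simp only [cycDgen, map_add, cycD_base]
      simp only [cycD, gradedDer_gen_mul, gradedDer_gen]
      rw [show h.cycDeg .omega = (2, 0) from rfl, koszul_two]
      simp [cycDgen]
    · simp only [cycDgen, map_neg]
      have e := h.shift_cycD (h.cycIncl (h.dgen i))
      rw [cycD_base] at e
      have e' : h.shift (GCAlg.gen h.cycDeg .omega * h.shift (h.cycIncl (h.dgen i))) = 0 := by
        have := h.shift_shift (h.cycIncl (h.dgen i))
        simp only [shift] at this ⊢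
        rw [gradedDer_gen_mul, this]
        simp [shiftGen]
      rw [e', zero_add] at e
      rw [e, neg_zero]

end

/-- `f̃ : g ⟶ cyc h` is the reduction of `f : ĝ ⟶ h` along the central extension `ĝ` of `g`
classified by `c`, equivalently `f` is the oxidation of `f̃`: `f̃` pulls `ω₂` back to `c`, and if
`f` pulls `eⁱ` back to `α_bas + e' p_*α` then `f̃` pulls `eⁱ` back to `α_bas` and `s eⁱ`
to `- p_*α`. -/
def IsReduction {g h : SuperLInf} {c : g.CE} {hc : c ∈ g.homog (2, 0)} {hdc : g.d c = 0}
    (f : Hom (g.centralExt c hc hdc) h) (f' : Hom g h.cyc) : Prop :=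
  f'.pull (h.cyc.gen .omega) = c ∧
  ∀ i : h.Gen, f.pull (h.gen i) =
    g.basicIncl (f'.pull (h.cyc.gen (.base i))) -
      (g.centralExt c hc hdc).gen none * g.basicIncl (f'.pull (h.cyc.gen (.shift i)))

end SuperLInf

open SuperLInf

/-! ### Whitehead `L∞`-algebras of twisted K-theory -/

/-- The line Lie 2-algebra `𝔩 B²U(1)`: one closed generator `ω₃` of bidegree `(3, even)`. -/
abbrev lineB2U1 : SuperLInf where
  Gen := Unit
  deg _ := (3, 0)
  finiteType _ := Set.toFinite _
  dgen _ := 0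
  dgen_mem _ := zero_mem _
  d_dgen _ := map_zero _

/-- Generators of `CE (𝔩 (Σᵐ KU // BU(1)))`; `f k` stands for `f_{2k+m}`. -/
inductive KUGen : Type
  | h3 : KUGen
  | f : ℤ → KUGen

/-- Bidegrees: `h₃` in `(3, even)`, `f_{2k+m}` in `(2k+m, even)`. -/
def kuDeg (m : ℤ) : KUGen → BiDeg
  | .h3 => (3, 0)
  | .f k => (2 * k + m, 0)

/-- `d h₃ = 0` and `d f_{2k+m} = h₃ f_{2(k-1)+m}`. -/
def kuDgen (m : ℤ) : KUGen → GCAlg (kuDeg m)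
  | .h3 => 0
  | .f k => GCAlg.gen (kuDeg m) .h3 * GCAlg.gen (kuDeg m) (.f (k - 1))

theorem kuDgen_mem (m : ℤ) (j : KUGen) :
    kuDgen m j ∈ GCAlg.homog (kuDeg m) (kuDeg m j + (1, 0)) := by
  cases j with
  | h3 => exact zero_mem _
  | f k =>
    have := GCAlg.mul_mem (gen_mem (deg := kuDeg m) .h3) (gen_mem (deg := kuDeg m) (.f (k - 1)))
    have e : kuDeg m .h3 + kuDeg m (.f (k - 1)) = kuDeg m (.f k) + (1, 0) := by
      simp only [kuDeg]
      ext <;> simp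
      ring
    rwa [e] at this

/-- The real Whitehead `L∞`-algebra `𝔩 (Σᵐ KU // BU(1))` of 3-twisted complex K-theory. -/
abbrev twistedKU (m : ℤ) : SuperLInf where
  Gen := KUGen
  deg := kuDeg m
  finiteType n := by
    refine ((Set.finite_singleton (KUGen.f ((n.1 - m) / 2))).insert KUGen.h3).subset ?_
    rintro (_ | k) hk
    · exact Set.mem_insert _ _
    · have hk' : ((2 * k + m, 0) : BiDeg) = n := hk
      refine Set.mem_insert_of_mem _ ?_
      rw [← hk', Set.mem_singleton_iff]
      congr 1
      simp
  dgen := kuDgen m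
  dgen_mem := kuDgen_mem m
  d_dgen j := by
    cases j with
    | h3 => simp [kuDgen]
    | f k =>
      simp only [kuDgen, gradedDer_gen_mul, gradedDer_gen, zero_mul, zero_add]
      have h := gen_mul_gen (deg := kuDeg m) .h3 .h3
      have hk : koszul (kuDeg m .h3) (kuDeg m .h3) = -1 := by norm_num [koszul, kuDeg, zpow_ofNat]
      rw [hk, neg_one_smul] at h
      rw [← mul_assoc, eq_zero_of_eq_neg h, zero_mul, smul_zero]

/-- The fibration of `𝔩 (Σᵐ KU // BU(1))` over `𝔩 B²U(1)`, pulling `ω₃` back to `h₃`. -/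
def kuFib (m : ℤ) : Hom (twistedKU m) lineB2U1 :=
  Hom.ofGens (fun _ => (twistedKU m).gen .h3) (fun _ => gen_mem (deg := kuDeg m) .h3) (by
    intro i
    rw [d_gen, map_zero]
    rfl)

/-- `f : g ⟶ 𝔩 (Σᵐ KU // BU(1))` is the map with components `(H, (F_{2k+m})_k)`. -/
def HasComponents {g : SuperLInf} {m : ℤ} (f : Hom g (twistedKU m)) (H : g.CE) (F : ℤ → g.CE) :
    Prop :=
  f.pull ((twistedKU m).gen .h3) = H ∧ ∀ k, f.pull ((twistedKU m).gen (.f k)) = F k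

/-- Values on generators of the T-duality isomorphism. -/
def tGen : CycGen KUGen → (twistedKU 0).cyc.CE
  | .omega => -(twistedKU 0).cyc.gen (.shift .h3)
  | .base .h3 => (twistedKU 0).cyc.gen (.base .h3)
  | .shift .h3 => -(twistedKU 0).cyc.gen .omega
  | .base (.f k) => (twistedKU 0).cyc.gen (.shift (.f (k + 1)))
  | .shift (.f k) => (twistedKU 0).cyc.gen (.base (.f k))

theorem tGen_mem (j : CycGen KUGen) :
    tGen j ∈ (twistedKU 0).cyc.homog ((twistedKU 1).cyc.deg j) := by
  have hg := fun j => gen_mem (deg := (twistedKU 0).cyc.deg) j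
  rcases j with _ | (_ | k) | (_ | k)
  · exact neg_mem (hg (.shift .h3))
  · exact hg (.base .h3)
  · have := hg (.shift (.f (k + 1)))
    have e : (twistedKU 0).cyc.deg (.shift (.f (k + 1))) =
        (twistedKU 1).cyc.deg (.base (.f k)) := by
      change ((2 * (k + 1) + 0, 0) : BiDeg) + (-1, 0) = (2 * k + 1, 0)
      ext <;> simp
      ring
    rw [e] at this
    exact this
  · exact neg_mem (hg .omega)
  · have := hg (.base (.f k))
    have e : (twistedKU 0).cyc.deg (.base (.f k)) = (twistedKU 1).cyc.deg (.shift (.f k)) := by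
      change ((2 * k + 0, 0) : BiDeg) = (2 * k + 1, 0) + (-1, 0)
      ext <;> simp
    rw [e] at this
    exact this

/-- The T-duality isomorphism `T : cyc 𝔩 (Σ⁰ KU // BU(1)) ⟶ cyc 𝔩 (Σ¹ KU // BU(1))`, which swaps
`ω₂` with `- s h₃` and pulls `f_{2k+1}`, `s f_{2k+1}` back to `s f_{2k+2}`, `f_{2k}`. -/
def tDuality : Hom (twistedKU 0).cyc (twistedKU 1).cyc :=
  Hom.ofGens tGen tGen_mem (by
    have hs : ∀ m k, (twistedKU m).shift ((twistedKU m).cycIncl (kuDgen m (.f k))) =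
        (twistedKU m).cyc.gen (.shift .h3) * (twistedKU m).cyc.gen (.base (.f (k - 1))) -
        (twistedKU m).cyc.gen (.base .h3) * (twistedKU m).cyc.gen (.shift (.f (k - 1))) := by
      intro m k
      have hk : koszul (-1, 0) ((twistedKU m).cycDeg (.base .h3)) = -1 := by
        norm_num [koszul, cycDeg, kuDeg, zpow_neg, zpow_ofNat]
      change (twistedKU m).shift ((twistedKU m).cycIncl
        ((twistedKU m).gen .h3 * (twistedKU m).gen (.f (k - 1)))) = _
      rw [map_mul, cycIncl_gen, cycIncl_gen, shift, gradedDer_gen_mul, gradedDer_gen, hk,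
        neg_one_smul, ← sub_eq_add_neg]
      rfl
    have hs0 : ∀ m, (twistedKU m).shift ((twistedKU m).cycIncl (kuDgen m .h3)) = 0 := by
      intro m; simp [kuDgen]
    have hd := fun j => (twistedKU 0).cyc.d_gen j
    have hL : ∀ j, homogLift tGen tGen_mem (GCAlg.gen (twistedKU 1).cyc.deg j) = tGen j :=
      fun j => homogLift_gen _ _ j
    have comm : ∀ i j, koszul ((twistedKU 0).cycDeg i) ((twistedKU 0).cycDeg j) = 1 →
        (twistedKU 0).cyc.gen i * (twistedKU 0).cyc.gen j =
          (twistedKU 0).cyc.gen j * (twistedKU 0).cyc.gen i := by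
      intro i j hij
      have := gen_mul_gen (deg := (twistedKU 0).cycDeg) i j
      rwa [hij, one_smul] at this
    rintro (_ | (_ | k) | (_ | k))
    · change homogLift tGen tGen_mem 0 = (twistedKU 0).cyc.d (-(twistedKU 0).cyc.gen (.shift .h3))
      rw [map_zero, map_neg, hd]
      change 0 = - -(twistedKU 0).shift ((twistedKU 0).cycIncl (kuDgen 0 .h3))
      rw [hs0, neg_zero, neg_zero]
    · change homogLift tGen tGen_mem ((twistedKU 1).cycIncl 0 + (twistedKU 1).cyc.gen .omega *
          (twistedKU 1).cyc.gen (.shift .h3)) = (twistedKU 0).cyc.d ((twistedKU 0).cyc.gen (.base .h3))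
      rw [map_zero, zero_add, map_mul, hL, hL, hd]
      change -(twistedKU 0).cyc.gen (.shift .h3) * -(twistedKU 0).cyc.gen .omega =
        (twistedKU 0).cycIncl 0 + (twistedKU 0).cyc.gen .omega * (twistedKU 0).cyc.gen (.shift .h3)
      rw [map_zero, zero_add, neg_mul_neg]
      refine comm _ _ ?_
      exact koszul_two _
    · change homogLift tGen tGen_mem ((twistedKU 1).cycIncl
          ((twistedKU 1).gen .h3 * (twistedKU 1).gen (.f (k - 1))) + (twistedKU 1).cyc.gen .omega *
          (twistedKU 1).cyc.gen (.shift (.f k))) =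
          (twistedKU 0).cyc.d ((twistedKU 0).cyc.gen (.shift (.f (k + 1))))
      rw [map_add, map_mul, map_mul, map_mul, cycIncl_gen, cycIncl_gen, hL, hL, hL, hL, hd]
      change (twistedKU 0).cyc.gen (.base .h3) * (twistedKU 0).cyc.gen (.shift (.f (k - 1 + 1))) +
        -(twistedKU 0).cyc.gen (.shift .h3) * (twistedKU 0).cyc.gen (.base (.f k)) =
        -(twistedKU 0).shift ((twistedKU 0).cycIncl (kuDgen 0 (.f (k + 1))))
      rw [hs, sub_add_cancel, add_sub_cancel_right, neg_sub, neg_mul, sub_eq_add_neg]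
    · change homogLift tGen tGen_mem (-(twistedKU 1).shift ((twistedKU 1).cycIncl (kuDgen 1 .h3))) =
        (twistedKU 0).cyc.d (-(twistedKU 0).cyc.gen .omega)
      rw [hs0, neg_zero, map_zero, map_neg, hd]
      change 0 = -(0 : (twistedKU 0).cyc.CE)
      rw [neg_zero]
    · change homogLift tGen tGen_mem
        (-(twistedKU 1).shift ((twistedKU 1).cycIncl (kuDgen 1 (.f k)))) =
        (twistedKU 0).cyc.d ((twistedKU 0).cyc.gen (.base (.f k)))
      rw [hs, map_neg, map_sub, map_mul, map_mul, hL, hL, hL, hL, hd]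
      change -(-(twistedKU 0).cyc.gen .omega * (twistedKU 0).cyc.gen (.shift (.f (k - 1 + 1))) -
        (twistedKU 0).cyc.gen (.base .h3) * (twistedKU 0).cyc.gen (.base (.f (k - 1)))) =
        (twistedKU 0).cycIncl ((twistedKU 0).gen .h3 * (twistedKU 0).gen (.f (k - 1))) +
        (twistedKU 0).cyc.gen .omega * (twistedKU 0).cyc.gen (.shift (.f k))
      rw [map_mul, cycIncl_gen, cycIncl_gen, sub_add_cancel, neg_mul, neg_sub, sub_neg_eq_add])

/-! ### The 11-dimensional Majorana spinors -/

/-- The mostly-plus Minkowski metric. -/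
def eta {n : ℕ} (a b : Fin n) : ℝ := if a = b then (if a.val = 0 then -1 else 1) else 0

/-- The Majorana representation `32` of `Pin⁺(1,10)` in components: real `32 × 32` Clifford
generators for the mostly-plus metric with Clifford volume element `1`, and the matrix `C = (η_{αβ})`
of a non-degenerate skew-symmetric pairing for which the Clifford generators are
skew-self-adjoint. -/
structure Majorana11 (ι : Type) [Fintype ι] [DecidableEq ι] where
  Γ : Fin 11 → Matrix ι ι ℝ
  C : Matrix ι ι ℝ
  card_eq : Fintype.card ι = 32
  clifford : ∀ a b, Γ a * Γ b + Γ b * Γ a = (2 * eta a b) • (1 : Matrix ι ι ℝ)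
  volume : (List.ofFn Γ).prod = 1
  C_skew : C.transpose = -C
  C_nondeg : IsUnit C.det
  skewAdj : ∀ a, (Γ a).transpose * C = -(C * Γ a)

namespace Majorana11

/-! The representation exists: an explicit one by Pauli-type matrices. -/

/-- The signed permutation matrix `e_j ↦ (-1)^(z·j) e_(j+x)`. -/
def pauli (x z : Fin 5 → ZMod 2) : Matrix (Fin 5 → ZMod 2) (Fin 5 → ZMod 2) ℝ :=
  fun i j => if i = j + x then (-1 : ℝ) ^ (∑ k, z k * j k).val else 0

theorem pauli_mul (x z x' z' : Fin 5 → ZMod 2) :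
    pauli x z * pauli x' z' = (-1 : ℝ) ^ (∑ k, z k * x' k).val • pauli (x + x') (z + z') := by
  ext i j
  rw [Matrix.mul_apply, Finset.sum_eq_single (j + x')]
  · simp only [pauli, Matrix.smul_apply, smul_eq_mul, if_true]
    by_cases h : i = j + x' + x
    · rw [if_pos h, if_pos (by rw [h, add_assoc, add_comm x' x]), ← negOne_pow_val_add,
        ← negOne_pow_val_add]
      congr 2
      simp only [Pi.add_apply, ← Finset.sum_add_distrib]
      exact Finset.sum_congr rfl fun k _ => by ring
    · rw [if_neg h, if_neg (by rw [add_comm x x', ← add_assoc]; exact h)]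
      simp
  · intro k _ hk
    simp [pauli, hk]
  · simp

theorem pauli_zero : pauli 0 0 = 1 := by
  ext i j
  simp [pauli, Matrix.one_apply]

theorem pauli_transpose (x z : Fin 5 → ZMod 2) :
    (pauli x z).transpose = (-1 : ℝ) ^ (∑ k, z k * x k).val • pauli x z := by
  ext i j
  simp only [Matrix.transpose_apply, pauli, Matrix.smul_apply, smul_eq_mul]
  have hx : x + x = 0 := by
    funext k
    have : ∀ a : ZMod 2, a + a = 0 := by decide
    exact this (x k)
  by_cases h : i = j + x
  · have h' : j = i + x := by rw [h, add_assoc, hx, add_zero]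
    rw [if_pos h, if_pos h', ← negOne_pow_val_add]
    congr 2
    rw [h]
    simp only [Pi.add_apply, ← Finset.sum_add_distrib]
    exact Finset.sum_congr rfl fun k _ => by ring
  · have h' : ¬ j = i + x := fun h' => h (by rw [h', add_assoc, hx, add_zero])
    rw [if_neg h, if_neg h', mul_zero]

/-- Shift part of the explicit Clifford generators. -/
def exX : Fin 11 → Fin 5 → ZMod 2 :=
  ![![1, 0, 0, 0, 0],
    ![1, 0, 0, 0, 1],
    ![1, 0, 0, 0, 0],
    ![1, 0, 0, 1, 1],
    ![1, 0, 1, 1, 1],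
    ![1, 1, 1, 0, 1],
    ![1, 0, 1, 0, 1],
    ![1, 1, 0, 0, 1],
    ![1, 1, 1, 1, 1],
    ![1, 1, 0, 1, 1],
    ![0, 0, 0, 0, 0]]

/-- Sign part of the explicit Clifford generators. -/
def exZ : Fin 11 → Fin 5 → ZMod 2 :=
  ![![1, 0, 0, 0, 0],
    ![0, 0, 0, 0, 0],
    ![0, 0, 0, 0, 1],
    ![0, 0, 0, 1, 1],
    ![0, 0, 1, 0, 1],
    ![0, 0, 1, 1, 1],
    ![0, 1, 1, 1, 1],
    ![0, 1, 0, 1, 1],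
    ![0, 1, 0, 0, 1],
    ![0, 1, 1, 0, 1],
    ![1, 0, 0, 0, 0]]

/-- The explicit Majorana representation. -/
def explicit : Majorana11 (Fin 5 → ZMod 2) where
  Γ a := pauli (exX a) (exZ a)
  C := pauli (exX 0) (exZ 0)
  card_eq := by simp
  clifford a b := by
    by_cases h : a = b
    · subst h
      have hx : exX a + exX a = 0 := by revert a; decide
      have hz : exZ a + exZ a = 0 := by revert a; decide
      have hs : (∑ k, exZ a k * exX a k).val = if a.val = 0 then 1 else 0 := by revert a; decide
      rw [pauli_mul, hx, hz, pauli_zero, ← two_smul ℝ, smul_smul, hs]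
      congr 2
      rw [eta, if_pos rfl]
      split_ifs <;> norm_num
    · have hs : ∀ a b, a ≠ b →
          (∑ k, exZ b k * exX a k) = (∑ k, exZ a k * exX b k) + 1 := by decide
      rw [pauli_mul, pauli_mul, hs a b h, negOne_pow_val_add, add_comm (exX b), add_comm (exZ b),
        ← add_smul, eta, if_neg h, ZMod.val_one]
      simp
  volume := by
    simp only [List.ofFn_succ, List.ofFn_zero, List.prod_cons, List.prod_nil, mul_one, pauli_mul,
      mul_smul_comm, smul_smul, ← negOne_pow_val_add]
    rw [← pauli_zero]
    refine (congrArg₂ _ ?_ (congrArg₂ pauli ?_ ?_)).trans (one_smul ℝ _)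
    · rw [show ∀ a : ZMod 2, a = 0 → (-1 : ℝ) ^ a.val = 1 from fun a h => by rw [h]; simp]
      decide
    · decide
    · decide
  C_skew := by
    rw [pauli_transpose, show (∑ k, exZ 0 k * exX 0 k).val = 1 by decide]
    simp
  C_nondeg := by
    rw [← Matrix.isUnit_iff_isUnit_det]
    have h : pauli (exX 0) (exZ 0) * -pauli (exX 0) (exZ 0) = 1 := by
      rw [mul_neg, pauli_mul, show (∑ k, exZ 0 k * exX 0 k).val = 1 by decide,
        show exX 0 + exX 0 = 0 by decide, show exZ 0 + exZ 0 = 0 by decide, pauli_zero]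
      simp
    exact IsUnit.of_mul_eq_one _ h
  skewAdj a := by
    have hs : ∀ a, (∑ k, exZ a k * exX a k) + (∑ k, exZ a k * exX 0 k) =
        (∑ k, exZ 0 k * exX a k) + 1 := by decide
    rw [pauli_transpose, smul_mul_assoc, pauli_mul, pauli_mul, smul_smul, ← negOne_pow_val_add,
      hs a, negOne_pow_val_add, add_comm (exX a), add_comm (exZ a), ZMod.val_one]
    simp

end Majorana11

/-! ### Super-Minkowski algebras -/

/-- Bidegrees of the generators `ψ^α` (`(1, odd)`) and `e^a` (`(1, even)`). -/
def minkDeg (ι κ : Type) : ι ⊕ κ → BiDeg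
  | .inl _ => (1, 1)
  | .inr _ => (1, 0)

section

variable {ι κ : Type} [Fintype ι]

/-- The bilinear expression `∑ K_{αβ} ψ^α ψ^β`. -/
def quad (κ : Type) (K : Matrix ι ι ℝ) : GCAlg (minkDeg ι κ) :=
  ∑ α, ∑ β, K α β • (GCAlg.gen (minkDeg ι κ) (.inl α) * GCAlg.gen (minkDeg ι κ) (.inl β))

theorem quad_mem (K : Matrix ι ι ℝ) : quad κ K ∈ GCAlg.homog (minkDeg ι κ) (2, 0) := by
  refine sum_mem fun α _ => sum_mem fun β _ => Submodule.smul_mem _ _ ?_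
  have h := GCAlg.mul_mem (gen_mem (deg := minkDeg ι κ) (.inl α))
    (gen_mem (deg := minkDeg ι κ) (.inl β))
  have e : minkDeg ι κ (.inl α) + minkDeg ι κ (.inl β) = (2, 0) := by
    simp only [minkDeg]
    decide
  rwa [e] at h

/-- `d ψ^α = 0` and `d e^a = ∑ (K a)_{αβ} ψ^α ψ^β`. -/
def minkDgen (K : κ → Matrix ι ι ℝ) : ι ⊕ κ → GCAlg (minkDeg ι κ)
  | .inl _ => 0
  | .inr a => quad κ (K a)

theorem minkDgen_mem (K : κ → Matrix ι ι ℝ) (j : ι ⊕ κ) :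
    minkDgen K j ∈ GCAlg.homog (minkDeg ι κ) (minkDeg ι κ j + (1, 0)) := by
  cases j with
  | inl α => exact zero_mem _
  | inr a =>
    have e : minkDeg ι κ (.inr a) + (1, 0) = (2, 0) := by
      simp only [minkDeg]
      decide
    rw [e]
    exact quad_mem (K a)

theorem gradedDer_quad (K : κ → Matrix ι ι ℝ) (M : Matrix ι ι ℝ) :
    gradedDer (1, 0) (minkDgen K) (minkDgen_mem K) (quad κ M) = 0 := by
  simp [quad, gradedDer_gen_mul, minkDgen]

/-- The super-translation algebra with `d ψ^α = 0`, `d e^a = ∑ (K a)_{αβ} ψ^α ψ^β`. -/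
abbrev superMink [Finite κ] (K : κ → Matrix ι ι ℝ) : SuperLInf where
  Gen := ι ⊕ κ
  deg := minkDeg ι κ
  finiteType _ := Set.toFinite _
  dgen := minkDgen K
  dgen_mem := minkDgen_mem K
  d_dgen j := by
    cases j with
    | inl α => simp [minkDgen]
    | inr a => exact gradedDer_quad K (K a)

/-- The identification of the central extension of `(1+8)`-dimensional super-Minkowski algebra by
`c = ∑ K₉_{αβ} ψ^α ψ^β` with the `(1+9)`-dimensional one having `d e⁹ = c`: the generator `e⁹`
is pulled back to `e'`, the other generators to themselves. -/
def extIdent (K' : Fin 9 → Matrix ι ι ℝ) (K : Fin 10 → Matrix ι ι ℝ) (c : Matrix ι ι ℝ)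
    (hK : ∀ a : Fin 9, K a.castSucc = K' a) (hc : K (Fin.last 9) = c) :
    Hom ((superMink K').centralExt (quad (Fin 9) c) (quad_mem c) (gradedDer_quad K' c))
      (superMink K) :=
  Hom.ofGens
    (fun j => match j with
      | .inl α => ((superMink K').centralExt (quad (Fin 9) c) (quad_mem c)
          (gradedDer_quad K' c)).gen (some (.inl α))
      | .inr a => Fin.lastCases
          (((superMink K').centralExt (quad (Fin 9) c) (quad_mem c) (gradedDer_quad K' c)).gen none)
          (fun a => ((superMink K').centralExt (quad (Fin 9) c) (quad_mem c)
            (gradedDer_quad K' c)).gen (some (.inr a))) a)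
    (by
      rintro (α | a)
      · exact gen_mem (deg := extDeg (superMink K')) (some (.inl α))
      · refine Fin.lastCases ?_ (fun a => ?_) a
        · simp only [Fin.lastCases_last]
          exact gen_mem (deg := extDeg (superMink K')) none
        · simp only [Fin.lastCases_castSucc]
          exact gen_mem (deg := extDeg (superMink K')) (some (.inr a)))
    (by
      have hq : ∀ (φ : ι ⊕ Fin 10 → GCAlg (extDeg (superMink K'))) (hφ) (M : Matrix ι ι ℝ),
          (∀ α, φ (.inl α) = GCAlg.gen (extDeg (superMink K')) (some (.inl α))) →
          homogLift (deg := minkDeg ι (Fin 10)) φ hφ (quad (Fin 10) M) =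
            (superMink K').basicIncl (quad (Fin 9) M) := by
        intro φ hφ M h
        have hb : ∀ j, (superMink K').basicIncl (GCAlg.gen (minkDeg ι (Fin 9)) j) =
          GCAlg.gen (extDeg (superMink K')) (some j) :=
          fun j => basicIncl_gen (superMink K') j
        simp only [quad, map_sum, map_smul, map_mul, homogLift_gen, h, hb]
      rintro (α | a)
      · change homogLift _ _ 0 = _
        rw [map_zero, d_gen]
        exact (map_zero (superMink K').basicIncl).symm
      · change homogLift _ _ (quad (Fin 10) (K a)) = _
        rw [hq _ _ _ (fun α => rfl)]
        refine Fin.lastCases ?_ (fun a => ?_) a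
        · simp only [Fin.lastCases_last]
          rw [d_gen, hc]
          rfl
        · simp only [Fin.lastCases_castSucc]
          rw [d_gen, hK]
          rfl)

end

/-! ### Type II super-spacetimes and their super-flux densities -/

namespace Majorana11

/-- Raising a vector index with the Minkowski metric. -/
def raise {ι : Type} {n : ℕ} (G : Fin n → Matrix ι ι ℝ) (a : Fin n) : Matrix ι ι ℝ := ∑ b, eta a b • G b

theorem raise_eq {ι : Type} {n : ℕ} (G : Fin n → Matrix ι ι ℝ) (a : Fin n) :
    raise G a = (if a.val = 0 then (-1 : ℝ) else 1) • G a := by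
  simp [raise, eta]

variable {ι : Type} [Fintype ι] [DecidableEq ι] (S : Majorana11 ι)

/-- The spinor pairing `(ψ̄ M ψ) = ψ^α η_{αα'} M^{α'}_β ψ^β`. -/
def pair (κ : Type) (M : Matrix ι ι ℝ) : GCAlg (minkDeg ι κ) := quad κ (S.C * M)

/-- `Γ_a` for `a < 9`. -/
def gamma9 (a : Fin 9) : Matrix ι ι ℝ := S.Γ a.castSucc.castSucc

/-- `Γ_a` for `a ≤ 9`. -/
def gammaA (a : Fin 10) : Matrix ι ι ℝ := S.Γ a.castSucc

/-- The type IIB quasi-Clifford generators: `Γᴮ_a = Γ_a` for `a < 9` and `Γᴮ_9 = Γ_9 Γ_10`. -/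
def gammaB (a : Fin 10) : Matrix ι ι ℝ := if a = 9 then S.Γ 9 * S.Γ 10 else S.Γ a.castSucc

/-- The skew-symmetrized product `Γ_{a₁ ⋯ a_p}`. -/
def gammaAs {p : ℕ} (a : Fin p → Fin 10) : Matrix ι ι ℝ :=
  (p.factorial : ℝ)⁻¹ • ∑ σ : Equiv.Perm (Fin p),
    ((Equiv.Perm.sign σ : ℤ) : ℝ) • (List.ofFn fun i => S.gammaA (a (σ i))).prod

/-- `Γᴮ_{a₁ ⋯ a_p}`: the product of the `Γᴮ_{aᵢ}` in increasing order of the indices times the sign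
of the ordering permutation if the indices are distinct, and zero otherwise. -/
def gammaBs {p : ℕ} (a : Fin p → Fin 10) : Matrix ι ι ℝ :=
  open Classical in
  if Function.Injective a then
    ((Equiv.Perm.sign (Tuple.sort a) : ℤ) : ℝ) •
      (List.ofFn fun i => S.gammaB (a (Tuple.sort a i))).prod
  else 0

/-- 9-dimensional type II super-Minkowski algebra. -/
abbrev dim9 : SuperLInf := superMink fun a => S.C * raise S.gamma9 a

/-- 10-dimensional type IIA super-Minkowski algebra: `d e^a = (ψ̄ Γ^a ψ)`. -/
abbrev IIA : SuperLInf := superMink fun a => S.C * raise S.gammaA a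

/-- 10-dimensional type IIB super-Minkowski algebra: `d e^a = (ψ̄ Γ_B^a ψ)`. -/
abbrev IIB : SuperLInf := superMink fun a => S.C * raise S.gammaB a

/-- The form generators `e^a` in ten dimensions. -/
def e (a : Fin 10) : GCAlg (minkDeg ι (Fin 10)) := GCAlg.gen (minkDeg ι (Fin 10)) (.inr a)

/-- `(1/p!) ∑ (ψ̄ G_{a₁ ⋯ a_p} ψ) e^{a₁} ⋯ e^{a_p}`. -/
def form (p : ℕ) (G : (Fin p → Fin 10) → Matrix ι ι ℝ) : GCAlg (minkDeg ι (Fin 10)) :=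
  (p.factorial : ℝ)⁻¹ • ∑ a : Fin p → Fin 10,
    S.pair (Fin 10) (G a) * (List.ofFn fun i => e (a i)).prod

/-- `H₃ᴬ = (ψ̄ Γ_a Γ_10 ψ) e^a`. -/
def H3A : S.IIA.CE := ∑ a, S.pair (Fin 10) (S.gammaA a * S.Γ 10) * e a

/-- The type IIA super-flux densities; `FA k` is `F_{2k}`. -/
def FA (k : ℤ) : S.IIA.CE :=
  if k = 1 then S.pair (Fin 10) (S.Γ 10)
  else if k = 2 then S.form 2 fun a => S.gammaAs a
  else if k = 3 then S.form 4 fun a => S.Γ 10 * S.gammaAs a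
  else if k = 4 then S.form 6 fun a => S.gammaAs a
  else if k = 5 then S.form 8 fun a => S.Γ 10 * S.gammaAs a
  else if k = 6 then S.form 10 fun a => S.gammaAs a
  else 0

/-- `H₃ᴮ = (ψ̄ Γᴮ_a Γ_10 ψ) e^a`. -/
def H3B : S.IIB.CE := ∑ a, S.pair (Fin 10) (S.gammaB a * S.Γ 10) * e a

/-- The type IIB super-flux densities; `FB k` is `F_{2k+1}`. -/
def FB (k : ℤ) : S.IIB.CE :=
  if k = 1 then S.form 1 fun a => S.gammaBs a * S.Γ 9
  else if k = 2 then S.form 3 fun a => S.gammaBs a * (S.Γ 9 * S.Γ 10)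
  else if k = 3 then S.form 5 fun a => S.gammaBs a * S.Γ 9
  else if k = 4 then S.form 7 fun a => S.gammaBs a * (S.Γ 9 * S.Γ 10)
  else if k = 5 then S.form 9 fun a => S.gammaBs a * S.Γ 9
  else 0

/-- The 2-cocycle `c₁ᴬ = (ψ̄ Γ_9 ψ)` on the 9-dimensional algebra. -/
abbrev c1A : S.dim9.CE := S.pair (Fin 9) (S.Γ 9)

/-- The 2-cocycle `c₁ᴮ = (ψ̄ Γ_9 Γ_10 ψ)` on the 9-dimensional algebra. -/
abbrev c1B : S.dim9.CE := S.pair (Fin 9) (S.Γ 9 * S.Γ 10)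

/-- The type IIA algebra as the central extension of the 9-dimensional one by `c₁ᴬ`, with
`e⁹` the new generator. -/
def extA : Hom (S.dim9.centralExt S.c1A (quad_mem _) (gradedDer_quad _ _)) S.IIA := extIdent (fun a => S.C * raise S.gamma9 a) (fun a => S.C * raise S.gammaA a)
  (S.C * S.Γ 9)
  (fun a => by simp only [raise_eq]; rfl)
  (by simp only [raise_eq]; simp [gammaA, Fin.last])

/-- The type IIB algebra as the central extension of the 9-dimensional one by `c₁ᴮ`, with
`e⁹` the new generator. -/
def extB : Hom (S.dim9.centralExt S.c1B (quad_mem _) (gradedDer_quad _ _)) S.IIB := extIdent (fun a => S.C * raise S.gamma9 a) (fun a => S.C * raise S.gammaB a)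
  (S.C * (S.Γ 9 * S.Γ 10))
  (fun a => by
    have h : a.castSucc ≠ (9 : Fin 10) := (Fin.castSucc_lt_last a).ne
    simp only [raise_eq, gammaB, if_neg h]; rfl)
  (by
    have h : Fin.last 9 = (9 : Fin 10) := rfl
    simp [raise_eq, gammaB, h])

end Majorana11

end SuperL

end

open SuperL SuperL.SuperLInf

/-!
Let `V = e^a Γ_a` be the matrix of forms built from the vielbein. As the `e^a` anticommute with
each other, the type IIA fluxes are `F_{2n+2} = (ψ̄ Γ_10^(n+1) V^(2n) ψ) / (2n)!`. The matrix `V`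
satisfies a Clifford relation with `dV` and with the matrix `W` of the bilinears
`(ψ̄ Γ_a Γ_10 ψ)`, and `V W + W V = 2 H₃ᴬ`; hence the type IIA Bianchi identities reduce to the
Fierz identity `(ψ̄ Γ_a Γ_10 ψ) Γ^a ψ = (ψ̄ Γ_a ψ) Γ_10 Γ^a ψ`. The latter holds because its
polarization, a linear map evaluated at a symmetric rank-two matrix, vanishes on each of the
Clifford monomials with at most five factors that span the matrices of the right symmetry.

The type IIB Bianchi identities need no separate computation. Splitting off `e⁹` shows that, along
the two central extensions of the nine-dimensional algebra, T-duality exchanges the components of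
the type IIA fluxes with those of the type IIB fluxes; so the latter are the components of an
oxidation, which is a homomorphism, and the identification of the type IIB algebra with the
central extension is an isomorphism.
-/

noncomputable section

namespace SuperL

open GCAlg

/-! ### Anticommuting and odd elements of a ring -/

section

variable {κ R : Type*} [Ring R]

theorem prod_ofFn_swap_of_anticomm {g : κ → R} (hg : ∀ a b, a ≠ b → g a * g b = -(g b * g a))
    {p : ℕ} (i : Fin p) {a : Fin (p + 1) → κ} (ha : a i.castSucc ≠ a i.succ) :
    (List.ofFn fun j => g (a (Equiv.swap i.castSucc i.succ j))).prod =
      -(List.ofFn fun j => g (a j)).prod := by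
  induction p with
  | zero => exact i.elim0
  | succ p ih =>
    cases i using Fin.cases with
    | zero =>
      have swap_tail (j : Fin p) :
          Equiv.swap (Fin.castSucc 0 : Fin (p + 1 + 1)) (Fin.succ 0) j.succ.succ = j.succ.succ :=
        Equiv.swap_apply_of_ne_of_ne (Fin.succ_ne_zero _)
          fun h => Fin.succ_ne_zero j (Fin.succ_injective _ h)
      have swap_zero : Equiv.swap (Fin.castSucc 0 : Fin (p + 1 + 1)) (Fin.succ 0) 0 = Fin.succ 0 :=
        Equiv.swap_apply_left _ _
      have swap_one : Equiv.swap (Fin.castSucc 0 : Fin (p + 1 + 1)) (Fin.succ 0) (Fin.succ 0) = 0 :=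
        Equiv.swap_apply_right _ _
      have hne : a (Fin.succ 0) ≠ a 0 := Ne.symm ha
      simp only [List.ofFn_succ, List.prod_cons, swap_tail, swap_zero, swap_one, ← mul_assoc]
      rw [hg _ _ hne, neg_mul]
    | succ i =>
      have swap_zero : Equiv.swap i.succ.castSucc i.succ.succ 0 = 0 :=
        Equiv.swap_apply_of_ne_of_ne (fun h => by simpa using h.symm) (Fin.succ_ne_zero _).symm
      have swap_succ (j : Fin (p + 1)) : Equiv.swap i.succ.castSucc i.succ.succ j.succ =
          (Equiv.swap i.castSucc i.succ j).succ := by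
        rw [← Fin.succ_castSucc, (Fin.succ_injective (p + 1)).swap_apply]
      rw [List.ofFn_succ, List.ofFn_succ (f := fun j => g (a j)), List.prod_cons, List.prod_cons,
        swap_zero]
      simp only [swap_succ]
      rw [ih i (a := fun j => a j.succ) ha, mul_neg]

theorem sign_smul_prod_ofFn_perm {g : κ → R} (hg : ∀ a b, a ≠ b → g a * g b = -(g b * g a)) {p : ℕ}
    (σ : Equiv.Perm (Fin p)) {a : Fin p → κ} (ha : Function.Injective a) :
    (Equiv.Perm.sign σ : ℤ) • (List.ofFn fun j => g (a (σ j))).prod =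
      (List.ofFn fun j => g (a j)).prod := by
  cases p with
  | zero => simp [Subsingleton.elim σ 1]
  | succ p =>
    have hσ : σ ∈ Submonoid.closure (Set.range fun i : Fin p => Equiv.swap i.castSucc i.succ) := by
      rw [Equiv.Perm.mclosure_swap_castSucc_succ]
      trivial
    induction hσ using Submonoid.closure_induction generalizing a with
    | mem σ hσ =>
      obtain ⟨i, rfl⟩ := hσ
      have hne : i.castSucc ≠ i.succ := (Fin.castSucc_lt_succ (i := i)).ne
      rw [Equiv.Perm.sign_swap hne, prod_ofFn_swap_of_anticomm hg i fun h => hne (ha h)]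
      simp
    | one => simp
    | mul σ τ _ _ ihσ ihτ =>
      simp only [Equiv.Perm.mul_apply, Equiv.Perm.sign_mul, Units.val_mul, mul_smul]
      rw [ihτ (a := fun j => a (σ j)) (ha.comp σ.injective), ihσ ha]

theorem mul_prod_map_eq_zero_of_mem {e : κ → R} (he : ∀ a b, e a * e b = -(e b * e a))
    (he_sq : ∀ a, e a * e a = 0) {b : κ} {l : List κ} (hb : b ∈ l) : e b * (l.map e).prod = 0 := by
  induction l with
  | nil => simp at hb
  | cons c l ih =>
    rw [List.map_cons, List.prod_cons, ← mul_assoc]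
    rcases List.mem_cons.mp hb with rfl | hb
    · rw [he_sq, zero_mul]
    · rw [he, neg_mul, mul_assoc, ih hb, mul_zero, neg_zero]

theorem prod_map_eq_zero_of_not_nodup {e : κ → R} (he : ∀ a b, e a * e b = -(e b * e a))
    (he_sq : ∀ a, e a * e a = 0) {l : List κ} (hl : ¬l.Nodup) : (l.map e).prod = 0 := by
  induction l with
  | nil => simp at hl
  | cons c l ih =>
    rw [List.map_cons, List.prod_cons]
    by_cases hc : c ∈ l
    · exact mul_prod_map_eq_zero_of_mem he he_sq hc
    · rw [ih fun h => hl (List.nodup_cons.mpr ⟨hc, h⟩), mul_zero]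

theorem prod_ofFn_eq_zero_of_not_injective {e : κ → R} (he : ∀ a b, e a * e b = -(e b * e a))
    (he_sq : ∀ a, e a * e a = 0) {p : ℕ} {a : Fin p → κ} (ha : ¬Function.Injective a) :
    (List.ofFn fun j => e (a j)).prod = 0 := by
  have h := prod_map_eq_zero_of_not_nodup he he_sq (l := List.ofFn a)
    fun h => ha (List.nodup_ofFn.mp h)
  rwa [List.map_ofFn] at h

end

section

variable {R : Type*} [Ring R]

theorem add_pow_of_mul_self_eq_zero {u w : R} (h : Commute u w) (hw : w * w = 0) (n : ℕ) :
    (u + w) ^ (n + 1) = u ^ (n + 1) + (n + 1) • (w * u ^ n) := by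
  induction n with
  | zero => simp
  | succ n ih =>
    have hwuw : w * u ^ n * w = 0 := by rw [mul_assoc, (h.pow_left n).eq, ← mul_assoc, hw, zero_mul]
    rw [pow_succ, ih, add_mul, mul_add, mul_add, ← pow_succ, smul_mul_assoc, smul_mul_assoc, hwuw,
      mul_assoc w, ← pow_succ, (h.pow_left (n + 1)).eq, smul_zero, add_zero, add_assoc,
      succ_nsmul' _ (n + 1)]

theorem mul_odd_pow_of_anticomm {x y : R} (hxy : x * y = -(y * x)) (n : ℕ) :
    x * y ^ (2 * n + 1) = -(y ^ (2 * n + 1) * x) := by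
  have hsemi : SemiconjBy x y (-y) := by rw [SemiconjBy, neg_mul, hxy]
  rw [(hsemi.pow_right _).eq, Odd.neg_pow ⟨n, rfl⟩, neg_mul]

theorem commute_even_pow_of_anticomm {x y : R} (hxy : x * y = -(y * x)) (n : ℕ) :
    Commute x (y ^ (2 * n)) := by
  have hsemi : SemiconjBy x y (-y) := by rw [SemiconjBy, neg_mul, hxy]
  rw [Commute, SemiconjBy, (hsemi.pow_right _).eq, Even.neg_pow (even_two_mul n)]

variable {x y t : R}

theorem pow_succ_mul_of_anticomm (hxy : x * y + y * x = t) (ht : t * x = -(x * t)) (n : ℕ) :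
    x ^ (n + 1) * y = (-1) ^ (n + 1) * (y * x ^ (n + 1) - (n + 1) • (t * x ^ n)) := by
  have hxy' : x * y = t - y * x := eq_sub_of_add_eq hxy
  induction n with
  | zero => simp [hxy']
  | succ n ih =>
    have hxt : x * t = -(t * x) := by rw [ht, neg_neg]
    have hsign : x * (-1) ^ (n + 1) = (-1) ^ (n + 1) * x :=
      ((Commute.neg_one_right x).pow_right (n + 1)).eq
    have hstep : x * (y * x ^ (n + 1) - (n + 1) • (t * x ^ n)) =
        -(y * x ^ (n + 1 + 1) - (n + 1 + 1) • (t * x ^ (n + 1))) := by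
      rw [mul_sub, mul_smul_comm, ← mul_assoc, hxy', ← mul_assoc, hxt, sub_mul, neg_mul,
        mul_assoc y x, mul_assoc t x, ← pow_succ', ← pow_succ']
      module
    rw [pow_succ' x (n + 1), mul_assoc, ih, ← mul_assoc, hsign, mul_assoc, hstep,
      pow_succ (-1 : R) (n + 1), mul_neg_one, mul_neg, neg_mul, ← pow_succ' x]

theorem twistedDerivation_pow (hxy : x * y + y * x = t) (ht : t * x = -(x * t)) {D : R → R}
    (hD_one : D 1 = 0) (hD : ∀ m, D (x * m) = y * m - x * D m) (n : ℕ) :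
    D (x ^ (n + 2)) = (n + 2) • (y * x ^ (n + 1)) - (n + 2).choose 2 • (t * x ^ n) := by
  have hxy' : x * y = t - y * x := eq_sub_of_add_eq hxy
  have hxt : x * t = -(t * x) := by rw [ht, neg_neg]
  induction n with
  | zero =>
    have hDx : D x = y := by simpa [hD_one] using hD 1
    rw [zero_add, pow_two, hD, hDx, hxy']
    simp only [zero_add, pow_one, pow_zero, mul_one, Nat.choose_self, one_smul]
    module
  | succ n ih =>
    rw [pow_succ', hD, ih, mul_sub, mul_smul_comm, mul_smul_comm, ← mul_assoc x y, hxy',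
      ← mul_assoc x t, hxt, sub_mul, neg_mul, mul_assoc y x, mul_assoc t x, ← pow_succ',
      ← pow_succ', Nat.choose_succ_succ' (n + 2) 1, Nat.choose_one_right]
    module

theorem twistedDerivation_even_pow (hxy : x * y + y * x = t) (ht : t * x = -(x * t)) {D : R → R}
    (hD_one : D 1 = 0) (hD : ∀ m, D (x * m) = y * m - x * D m) (n : ℕ) :
    D (x ^ (2 * (n + 1))) = (n + 1) • (y * x ^ (2 * n + 1) - x ^ (2 * n + 1) * y) := by
  have hodd := pow_succ_mul_of_anticomm hxy ht (2 * n)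
  rw [Odd.neg_one_pow ⟨n, rfl⟩, neg_one_mul, neg_sub] at hodd
  have hchoose : (2 * n + 2).choose 2 = (n + 1) * (2 * n + 1) := by
    rw [Nat.choose_two_right, show 2 * n + 2 = 2 * (n + 1) by ring, mul_assoc,
      Nat.mul_div_cancel_left _ two_pos]
    rfl
  rw [show 2 * (n + 1) = 2 * n + 2 by ring, twistedDerivation_pow hxy ht hD_one hD, hodd, hchoose]
  module

end

theorem succ_smul_inv_factorial_smul {V : Type*} [AddCommGroup V] [Module ℝ V] (n : ℕ) (v : V) :
    ((n + 1).factorial : ℝ)⁻¹ • ((n + 1) • v) = (n.factorial : ℝ)⁻¹ • v := by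
  rw [← Nat.cast_smul_eq_nsmul ℝ, smul_smul, Nat.factorial_succ, Nat.cast_mul, mul_inv_rev,
    inv_mul_cancel_right₀ (Nat.cast_ne_zero.mpr n.succ_ne_zero)]

/-! ### Matrices over an algebra -/

section

variable {ι κ : Type*} {A B : Type*} [Ring A]

theorem scalar_mul_apply [Fintype ι] [DecidableEq ι] (a : A) (M : Matrix ι ι A) (i j : ι) :
    (Matrix.scalar ι a * M) i j = a * M i j := by
  rw [Matrix.scalar_apply, Matrix.diagonal_mul]

theorem mul_scalar_apply [Fintype ι] [DecidableEq ι] (a : A) (M : Matrix ι ι A) (i j : ι) :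
    (M * Matrix.scalar ι a) i j = M i j * a := by
  rw [Matrix.scalar_apply, Matrix.mul_diagonal]

variable [Algebra ℝ A] [Ring B] [Algebra ℝ B]

section

variable [Fintype ι] [DecidableEq ι]

/-- Real matrices as matrices over an `ℝ`-algebra. -/
def realMat (A : Type*) [Ring A] [Algebra ℝ A] : Matrix ι ι ℝ →ₐ[ℝ] Matrix ι ι A :=
  (Algebra.ofId ℝ A).mapMatrix

theorem realMat_apply (M : Matrix ι ι ℝ) (i j : ι) :
    realMat A M i j = algebraMap ℝ A (M i j) := rfl

theorem realMat_mul_apply (X : Matrix ι ι ℝ) (M : Matrix ι ι A) (i j : ι) :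
    (realMat A X * M) i j = ∑ k, X i k • M k j := by
  simp only [Matrix.mul_apply, realMat_apply, ← Algebra.smul_def]

theorem scalar_mul_realMat (a : A) (M : Matrix ι ι ℝ) :
    Matrix.scalar ι a * realMat A M = realMat A M * Matrix.scalar ι a := by
  ext i j
  rw [scalar_mul_apply, mul_scalar_apply, realMat_apply, Algebra.commutes]

theorem mapMatrix_realMat (f : A →ₐ[ℝ] B) (M : Matrix ι ι ℝ) :
    f.mapMatrix (realMat A M) = realMat B M := by
  ext i j
  simp [realMat_apply]

theorem mapMatrix_scalar (f : A →ₐ[ℝ] B) (a : A) :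
    f.mapMatrix (Matrix.scalar ι a) = Matrix.scalar ι (f a) := by
  ext i j
  simp [Matrix.scalar_apply, Matrix.diagonal_apply, apply_ite f]

theorem prod_map_scalar_mul_realMat (G : κ → Matrix ι ι ℝ) (e : κ → A) (l : List κ) :
    (l.map fun a => Matrix.scalar ι (e a) * realMat A (G a)).prod =
      Matrix.scalar ι (l.map e).prod * realMat A (l.map G).prod := by
  induction l with
  | nil => simp
  | cons b l ih =>
    simp only [List.map_cons, List.prod_cons, ih, map_mul]
    rw [mul_assoc, ← mul_assoc (realMat A (G b)), ← scalar_mul_realMat]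
    simp only [mul_assoc]

end

section slash

variable [Fintype ι] [DecidableEq ι] [Fintype κ]

/-- The Feynman slash `∑ e^a G_a` of an `A`-valued vector `e`, a matrix over `A`. -/
def slash (G : κ → Matrix ι ι ℝ) (e : κ → A) : Matrix ι ι A :=
  ∑ a, Matrix.scalar ι (e a) * realMat A (G a)

theorem slash_apply (G : κ → Matrix ι ι ℝ) (e : κ → A) (i j : ι) :
    slash G e i j = ∑ a, G a i j • e a := by
  rw [slash, Matrix.sum_apply]
  refine Finset.sum_congr rfl fun a _ => ?_
  rw [scalar_mul_apply, realMat_apply, ← Algebra.commutes, Algebra.smul_def]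

theorem commute_slash_apply (G : κ → Matrix ι ι ℝ) {w : κ → A} (hw : ∀ a z, Commute (w a) z)
    (i j : ι) (z : A) : Commute (slash G w i j) z := by
  rw [slash_apply]
  exact Commute.sum_left _ _ _ fun a _ => (hw a z).smul_left _

theorem mapMatrix_slash (f : A →ₐ[ℝ] B) (G : κ → Matrix ι ι ℝ) (e : κ → A) :
    f.mapMatrix (slash G e) = slash G fun a => f (e a) := by
  simp only [slash, map_sum, map_mul, mapMatrix_realMat, mapMatrix_scalar]

theorem realMat_mul_slash (X : Matrix ι ι ℝ) (G : κ → Matrix ι ι ℝ) (e : κ → A) :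
    realMat A X * slash G e = slash (fun a => X * G a) e := by
  rw [slash, slash, Finset.mul_sum]
  refine Finset.sum_congr rfl fun a _ => ?_
  rw [← mul_assoc, ← scalar_mul_realMat, mul_assoc, ← map_mul]

theorem realMat_mul_slash_of_anticomm {X : Matrix ι ι ℝ} {G : κ → Matrix ι ι ℝ}
    (hX : ∀ a, X * G a = -(G a * X)) (e : κ → A) :
    realMat A X * slash G e = -(slash G e * realMat A X) := by
  rw [realMat_mul_slash, slash, slash, Finset.sum_mul, ← Finset.sum_neg_distrib]
  refine Finset.sum_congr rfl fun a _ => ?_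
  rw [hX, map_neg, mul_neg, mul_assoc, ← map_mul]

theorem scalar_mul_slash_of_anticomm (G : κ → Matrix ι ι ℝ) {θ : A} {e : κ → A}
    (hθ : ∀ a, θ * e a = -(e a * θ)) :
    Matrix.scalar ι θ * slash G e = -(slash G e * Matrix.scalar ι θ) := by
  rw [slash, Finset.mul_sum, Finset.sum_mul, ← Finset.sum_neg_distrib]
  refine Finset.sum_congr rfl fun a _ => ?_
  rw [mul_assoc, ← scalar_mul_realMat, ← mul_assoc, ← mul_assoc, ← map_mul, hθ, ← map_mul, map_neg,
    neg_mul]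

theorem slash_mul_slash (G G' : κ → Matrix ι ι ℝ) (e w : κ → A) :
    slash G e * slash G' w = ∑ a, ∑ b, Matrix.scalar ι (e a * w b) * realMat A (G a * G' b) := by
  simp only [slash, Finset.sum_mul_sum]
  refine Finset.sum_congr rfl fun a _ => Finset.sum_congr rfl fun b _ => ?_
  rw [mul_assoc, ← mul_assoc (realMat A (G a)), ← scalar_mul_realMat, map_mul, map_mul]
  simp only [mul_assoc]

theorem slash_anticommutator {G : κ → Matrix ι ι ℝ} {q : κ → κ → ℝ}
    (hG : ∀ a b, G a * G b + G b * G a = q a b • 1) (e : κ → A) {w : κ → A}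
    (hw : ∀ a z, Commute (w a) z) :
    slash G e * slash G w + slash G w * slash G e =
      Matrix.scalar ι (∑ a, ∑ b, q a b • (w b * e a)) := by
  rw [slash_mul_slash, slash_mul_slash,
    Finset.sum_comm (f := fun a b => Matrix.scalar ι (w a * e b) * realMat A (G a * G b)),
    ← Finset.sum_add_distrib, map_sum]
  refine Finset.sum_congr rfl fun a _ => ?_
  rw [← Finset.sum_add_distrib, map_sum]
  refine Finset.sum_congr rfl fun b _ => ?_
  rw [(hw b (e a)).eq, ← mul_add, ← map_add, hG, map_smul, map_one, mul_smul_comm, mul_one]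
  ext i j
  simp [Matrix.scalar_apply, Matrix.diagonal_apply]

theorem slash_pow (G : κ → Matrix ι ι ℝ) (e : κ → A) (p : ℕ) :
    slash G e ^ p = ∑ a : Fin p → κ,
      Matrix.scalar ι (List.ofFn fun i => e (a i)).prod *
        realMat A (List.ofFn fun i => G (a i)).prod := by
  classical
  rw [← MultilinearMap.mkPiAlgebraFin_apply_const (R := ℝ), slash, MultilinearMap.map_sum]
  refine Finset.sum_congr rfl fun a _ => ?_
  have h := prod_map_scalar_mul_realMat G e (List.ofFn a)
  simp only [List.map_ofFn] at h
  rw [MultilinearMap.mkPiAlgebraFin_apply]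
  exact h

theorem slash_pow_eq_zero {e : κ → A} (he : ∀ a b, e a * e b = -(e b * e a))
    (he_sq : ∀ a, e a * e a = 0) (G : κ → Matrix ι ι ℝ) {p : ℕ} (hp : Fintype.card κ < p) :
    slash G e ^ p = 0 := by
  rw [slash_pow]
  refine Finset.sum_eq_zero fun a _ => ?_
  have ha : ¬Function.Injective a := fun ha =>
    hp.not_ge (by simpa using Fintype.card_le_of_injective a ha)
  rw [prod_ofFn_eq_zero_of_not_injective he he_sq ha, map_zero, zero_mul]

end slash

section bil

variable [Fintype ι]

/-- The spinor bilinear `∑ ψ^α ψ^β M_{αβ}` with matrix `M` over `A`, as a linear map in `M`. -/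
def bil (ψ : ι → A) : Matrix ι ι A →ₗ[ℝ] A where
  toFun M := ∑ α, ∑ β, ψ α * ψ β * M α β
  map_add' M N := by simp [mul_add, Finset.sum_add_distrib]
  map_smul' c M := by simp [Finset.smul_sum]

theorem bil_apply (ψ : ι → A) (M : Matrix ι ι A) :
    bil ψ M = ∑ α, ∑ β, ψ α * ψ β * M α β := rfl

theorem bil_mul_scalar [DecidableEq ι] (ψ : ι → A) (M : Matrix ι ι A) (a : A) :
    bil ψ (M * Matrix.scalar ι a) = bil ψ M * a := by
  simp only [bil_apply, mul_scalar_apply, Finset.sum_mul, mul_assoc]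

theorem bil_scalar_mul [DecidableEq ι] {ψ : ι → A} {a : A}
    (ha : ∀ α β, Commute a (ψ α * ψ β)) (M : Matrix ι ι A) :
    bil ψ (Matrix.scalar ι a * M) = a * bil ψ M := by
  simp only [bil_apply, scalar_mul_apply, Finset.mul_sum, ← mul_assoc _ a, (ha _ _).symm.eq,
    mul_assoc a]

theorem map_bil [DecidableEq ι] (f : A →ₐ[ℝ] B) (ψ : ι → A) (M : Matrix ι ι A) :
    f (bil ψ M) = bil (fun α => f (ψ α)) (f.mapMatrix M) := by
  simp [bil_apply]

theorem bil_mul_eq_sum (ψ : ι → A) (N : Matrix ι ι A) {Z : Matrix ι ι A}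
    (hZ : ∀ i j a, Commute (Z i j) a) :
    bil ψ (N * Z) = ∑ α, ∑ γ, ψ α * (∑ β, Z γ β * ψ β) * N α γ := by
  rw [bil_apply]
  refine Finset.sum_congr rfl fun α _ => ?_
  simp only [Matrix.mul_apply, Finset.mul_sum, Finset.sum_mul]
  rw [Finset.sum_comm]
  refine Finset.sum_congr rfl fun γ _ => Finset.sum_congr rfl fun β _ => ?_
  rw [(hZ γ β _).eq, ← mul_assoc (ψ α), mul_assoc _ (Z γ β), (hZ γ β _).eq]

theorem bil_mul_congr {ψ : ι → A} {Z Z' : Matrix ι ι A} (hZ : ∀ i j a, Commute (Z i j) a)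
    (hZ' : ∀ i j a, Commute (Z' i j) a) (h : ∀ γ, ∑ β, Z γ β * ψ β = ∑ β, Z' γ β * ψ β)
    (N : Matrix ι ι A) : bil ψ (N * Z) = bil ψ (N * Z') := by
  rw [bil_mul_eq_sum ψ N hZ, bil_mul_eq_sum ψ N hZ']
  simp only [h]

theorem bil_mul_eq_sum' {ψ : ι → A} (hψ : ∀ α β, Commute (ψ α) (ψ β)) (Z N : Matrix ι ι A) :
    bil ψ (Z * N) = ∑ β, ∑ γ, ψ β * (∑ α, ψ α * Z α γ) * N γ β := by
  rw [bil_apply, Finset.sum_comm]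
  refine Finset.sum_congr rfl fun β _ => ?_
  simp only [Matrix.mul_apply, Finset.mul_sum, Finset.sum_mul]
  rw [Finset.sum_comm]
  refine Finset.sum_congr rfl fun γ _ => Finset.sum_congr rfl fun α _ => ?_
  rw [(hψ α β).eq]
  simp only [mul_assoc]

theorem bil_congr_mul {ψ : ι → A} (hψ : ∀ α β, Commute (ψ α) (ψ β)) {Z Z' : Matrix ι ι A}
    (h : ∀ γ, ∑ α, ψ α * Z α γ = ∑ α, ψ α * Z' α γ) (N : Matrix ι ι A) :
    bil ψ (Z * N) = bil ψ (Z' * N) := by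
  simp only [bil_mul_eq_sum' hψ, h]

end bil

end

/-! ### Super-`L∞` algebras -/

theorem koszul_neg_one (n : BiDeg) : koszul (-1, 0) n = koszul (1, 0) n := by
  have h : koszul (1, 0) n * koszul (-1, 0) n = 1 := by
    rw [← koszul_add_left, koszul_comm]
    exact koszul_zero_right n
  have hsq := koszul_mul_self (1, 0) n
  exact mul_left_cancel₀ (left_ne_zero_of_mul_eq_one hsq) (h.trans hsq.symm)

theorem koszul_one_one : koszul (1, 0) (1, 0) = -1 := by norm_num [koszul]

theorem koszul_of_odd {m n : ℤ} (hm : Odd m) (hn : Odd n) : koszul (m, 0) (n, 0) = -1 := by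
  simp [koszul, (hm.mul hn).neg_one_zpow]

namespace GCAlg

variable {I : Type*} {deg : I → BiDeg}

theorem commute_of_mem_two {x : GCAlg deg} (hx : x ∈ homog deg (2, 0)) (y : GCAlg deg) :
    Commute x y := by
  have h : LinearMap.mulLeft ℝ x = LinearMap.mulRight ℝ x := by
    apply linearMap_ext
    intro l
    rw [LinearMap.mulLeft_apply, LinearMap.mulRight_apply, homog_mul_homog hx (word_mem l),
      koszul_comm, koszul_two, one_smul]
  exact LinearMap.congr_fun h y

theorem mul_anticomm_of_mem_odd {m n : ℤ} (hm : Odd m) (hn : Odd n) {x y : GCAlg deg}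
    (hx : x ∈ homog deg (m, 0)) (hy : y ∈ homog deg (n, 0)) : x * y = -(y * x) := by
  rw [homog_mul_homog hx hy, koszul_of_odd hm hn, neg_one_smul]

variable {ι : Type*} [Fintype ι] [DecidableEq ι]

theorem realMat_mul_mem {n : BiDeg} (X : Matrix ι ι ℝ) {M : Matrix ι ι (GCAlg deg)}
    (hM : ∀ i j, M i j ∈ homog deg n) (i j : ι) :
    (realMat (GCAlg deg) X * M) i j ∈ homog deg n := by
  rw [realMat_mul_apply]
  exact sum_mem fun k _ => Submodule.smul_mem _ _ (hM k j)

theorem mul_realMat_mem {n : BiDeg} {M : Matrix ι ι (GCAlg deg)}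
    (hM : ∀ i j, M i j ∈ homog deg n) (X : Matrix ι ι ℝ) (i j : ι) :
    (M * realMat (GCAlg deg) X) i j ∈ homog deg n := by
  rw [Matrix.mul_apply]
  refine sum_mem fun k _ => ?_
  rw [realMat_apply, ← Algebra.commutes, ← Algebra.smul_def]
  exact Submodule.smul_mem _ _ (hM i k)

theorem slash_pow_mem {κ : Type*} [Fintype κ] (G : κ → Matrix ι ι ℝ) {e : κ → GCAlg deg}
    (he : ∀ a, e a ∈ homog deg (1, 0)) (p : ℕ) (i j : ι) :
    (slash G e ^ p) i j ∈ homog deg (p, 0) := by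
  induction p generalizing i j with
  | zero =>
    rw [pow_zero, Matrix.one_apply]
    split_ifs
    · exact one_mem
    · exact zero_mem _
  | succ p ih =>
    rw [pow_succ', slash, Finset.sum_mul, Matrix.sum_apply]
    refine sum_mem fun a _ => ?_
    rw [mul_assoc, scalar_mul_apply]
    have h := mul_mem (he a) (realMat_mul_mem (G a) ih i j)
    rwa [Prod.mk_add_mk, add_zero, add_comm, ← Nat.cast_succ] at h

end GCAlg

namespace SuperLInf

variable {g h : SuperLInf}

theorem Hom.ofGens_pull_gen (φ : h.Gen → g.CE) (hφ : ∀ i, φ i ∈ g.homog (h.deg i))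
    (hd : ∀ i, homogLift φ hφ (h.dgen i) = g.d (φ i)) (i : h.Gen) :
    (Hom.ofGens φ hφ hd).pull (h.gen i) = φ i := homogLift_gen φ hφ i

theorem Hom.ext_gens {f f' : Hom g h} (hf : ∀ i, f.pull (h.gen i) = f'.pull (h.gen i)) : f = f' :=
  Hom.ext (algHom_ext hf)

theorem Hom.isIso_of_inverse (f : Hom g h) (ρ : g.CE →ₐ[ℝ] h.CE)
    (left_inv : ∀ i, ρ (f.pull (h.gen i)) = h.gen i)
    (right_inv : ∀ i, f.pull (ρ (g.gen i)) = g.gen i) : f.IsIso := by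
  have hleft : ρ.comp f.pull = AlgHom.id ℝ _ := algHom_ext left_inv
  have hright : f.pull.comp ρ = AlgHom.id ℝ _ := algHom_ext right_inv
  exact Function.bijective_iff_has_inverse.mpr
    ⟨ρ, DFunLike.congr_fun hleft, DFunLike.congr_fun hright⟩

theorem d_mapMatrix_one {ι : Type*} [DecidableEq ι] (g : SuperLInf) :
    g.d.mapMatrix (1 : Matrix ι ι g.CE) = 0 := by
  ext i j
  rw [LinearMap.mapMatrix_apply, Matrix.map_apply, Matrix.one_apply, apply_ite g.d, g.d_one,
    map_zero, ite_self, Matrix.zero_apply]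

section

variable {ι : Type*} [Fintype ι] [DecidableEq ι]

theorem d_mapMatrix_realMat_mul (g : SuperLInf) (X : Matrix ι ι ℝ) (M : Matrix ι ι g.CE) :
    g.d.mapMatrix (realMat g.CE X * M) = realMat g.CE X * g.d.mapMatrix M := by
  ext i j
  simp only [LinearMap.mapMatrix_apply, Matrix.map_apply, realMat_mul_apply, map_sum, map_smul]

theorem d_mapMatrix_slash_mul {κ : Type*} [Fintype κ] (g : SuperLInf) (G : κ → Matrix ι ι ℝ)
    {e : κ → g.CE} (he : ∀ a, e a ∈ g.homog (1, 0)) (M : Matrix ι ι g.CE) :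
    g.d.mapMatrix (slash G e * M) =
      slash G (fun a => g.d (e a)) * M - slash G e * g.d.mapMatrix M := by
  have hscalar (a : κ) (N : Matrix ι ι g.CE) : g.d.mapMatrix (Matrix.scalar ι (e a) * N) =
      Matrix.scalar ι (g.d (e a)) * N - Matrix.scalar ι (e a) * g.d.mapMatrix N := by
    ext i j
    simp only [LinearMap.mapMatrix_apply, Matrix.map_apply, scalar_mul_apply, Matrix.sub_apply]
    rw [g.d_mul (he a), koszul_one_one, neg_one_smul, sub_eq_add_neg]
  simp only [slash, Finset.sum_mul, map_sum, mul_assoc, hscalar, d_mapMatrix_realMat_mul,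
    Finset.sum_sub_distrib]

end

end SuperLInf

/-! ### Maps to twisted K-theory -/

section

variable {g : SuperLInf} {m : ℤ} {H : g.CE} {F : ℤ → g.CE}

/-- The images of the generators of `𝔩(Σ^m KU // BU(1))` under the homomorphism with components
`H`, `F`. -/
def componentGen {A : Type*} (H : A) (F : ℤ → A) : KUGen → A
  | .h3 => H
  | .f k => F k

theorem exists_hasComponents (hH : H ∈ g.homog (3, 0)) (hF : ∀ k, F k ∈ g.homog (2 * k + m, 0))
    (dH : g.d H = 0) (dF : ∀ k, g.d (F k) = H * F (k - 1)) :
    ∃ f : Hom g (twistedKU m), HasComponents f H F := by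
  have hmem : ∀ i, componentGen H F i ∈ g.homog ((twistedKU m).deg i) := by
    rintro (_ | k)
    · exact hH
    · exact hF k
  refine ⟨Hom.ofGens (componentGen H F) hmem ?_, Hom.ofGens_pull_gen _ _ _ _,
    fun k => Hom.ofGens_pull_gen _ _ _ _⟩
  rintro (_ | k)
  · exact (map_zero _).trans dH.symm
  · change homogLift _ _ (GCAlg.gen (kuDeg m) .h3 * GCAlg.gen (kuDeg m) (.f (k - 1))) = _
    have hgen (i : KUGen) : homogLift (componentGen H F) hmem (GCAlg.gen (kuDeg m) i) =
        componentGen H F i := homogLift_gen _ hmem i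
    rw [map_mul, hgen, hgen]
    exact (dF k).symm

theorem HasComponents.unique {f f' : Hom g (twistedKU m)} (hf : HasComponents f H F)
    (hf' : HasComponents f' H F) : f = f' := by
  apply Hom.ext_gens
  rintro (_ | k)
  · exact hf.1.trans hf'.1.symm
  · exact (hf.2 k).trans (hf'.2 k).symm

theorem HasComponents.bianchi {f : Hom g (twistedKU m)} (hf : HasComponents f H F) :
    H ∈ g.homog (3, 0) ∧ (∀ k, F k ∈ g.homog (2 * k + m, 0)) ∧ g.d H = 0 ∧
      ∀ k, g.d (F k) = H * F (k - 1) := by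
  refine ⟨?_, fun k => ?_, ?_, fun k => ?_⟩
  · rw [← hf.1]
    exact f.pull_mem _ _ (gen_mem (deg := kuDeg m) .h3)
  · rw [← hf.2]
    exact f.pull_mem _ _ (gen_mem (deg := kuDeg m) (.f k))
  · rw [← hf.1, ← f.pull_d, d_gen]
    exact map_zero _
  · rw [← hf.1, ← hf.2, ← hf.2, ← f.pull_d, d_gen, ← map_mul]
    rfl

end

/-! ### Reduction and oxidation -/

namespace SuperLInf

section

variable {g : SuperLInf}

theorem new_gen_mul_self : GCAlg.gen g.extDeg none * GCAlg.gen g.extDeg none = 0 :=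
  have hmem : GCAlg.gen g.extDeg none ∈ GCAlg.homog g.extDeg (1, 0) :=
    gen_mem (deg := g.extDeg) none
  eq_zero_of_eq_neg (mul_anticomm_of_mem_odd odd_one odd_one hmem hmem)

theorem new_gen_mul_mul_new_gen {n : BiDeg} {x : GCAlg g.extDeg}
    (hx : x ∈ GCAlg.homog g.extDeg n) :
    GCAlg.gen g.extDeg none * x * GCAlg.gen g.extDeg none = 0 := by
  rw [mul_assoc, homog_mul_gen hx, mul_smul_comm, ← mul_assoc, new_gen_mul_self, zero_mul,
    smul_zero]

/-- The part of a form on a central extension that does not contain the new generator. -/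
def basicPart (g : SuperLInf) : GCAlg g.extDeg →ₐ[ℝ] g.CE :=
  homogLift (fun o : Option g.Gen => o.elim 0 g.gen) (by
    rintro (_ | i)
    · exact zero_mem _
    · exact gen_mem (deg := g.deg) i)

theorem basicPart_basicIncl (x : g.CE) : g.basicPart (g.basicIncl x) = x := by
  have h : g.basicPart.comp g.basicIncl = AlgHom.id ℝ _ := by
    apply algHom_ext
    intro i
    rw [AlgHom.comp_apply, basicIncl_gen, basicPart, homogLift_gen]
    rfl
  exact DFunLike.congr_fun h x

theorem basicPart_new_gen : g.basicPart (GCAlg.gen g.extDeg none) = 0 := homogLift_gen _ _ _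

theorem fiberGen_mem (o : Option g.Gen) :
    o.elim (1 : GCAlg g.extDeg) (fun _ => 0) ∈ GCAlg.homog g.extDeg (g.extDeg o + (-1, 0)) := by
  cases o with
  | none =>
    have h : g.extDeg none + (-1, 0) = 0 := by
      change ((1, 0) : BiDeg) + (-1, 0) = 0
      simp
    rw [h]
    exact GCAlg.one_mem
  | some i => exact zero_mem _

/-- Contraction with the vector dual to the new generator of a central extension. -/
def fiberContr (g : SuperLInf) : GCAlg g.extDeg →ₗ[ℝ] GCAlg g.extDeg :=
  gradedDer (-1, 0) (fun o => o.elim 1 fun _ => 0) fiberGen_mem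

theorem fiberContr_basicIncl (x : g.CE) : g.fiberContr (g.basicIncl x) = 0 := by
  have h : g.fiberContr ∘ₗ g.basicIncl.toLinearMap = 0 := by
    apply leibniz_ext (-1, 0) g.basicIncl
    · simp [fiberContr]
    · intro i x
      simp only [LinearMap.comp_apply, AlgHom.toLinearMap_apply, map_mul, basicIncl_gen]
      simp [fiberContr, gradedDer_gen_mul]
      rfl
    · simp
    · simp [fiberContr]
  exact LinearMap.congr_fun h x

theorem fiberContr_new_gen_mul (x : g.CE) :
    g.fiberContr (GCAlg.gen g.extDeg none * g.basicIncl x) = g.basicIncl x := by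
  have h := g.fiberContr_basicIncl x
  rw [fiberContr] at h ⊢
  rw [gradedDer_gen_mul, h]
  simp

theorem basicIncl_add_new_gen_mul_injective {x y x' y' : g.CE}
    (h : g.basicIncl x + GCAlg.gen g.extDeg none * g.basicIncl y =
      g.basicIncl x' + GCAlg.gen g.extDeg none * g.basicIncl y') : x = x' ∧ y = y' := by
  constructor
  · have := congrArg g.basicPart h
    simpa only [map_add, map_mul, basicPart_new_gen, zero_mul, add_zero, basicPart_basicIncl]
      using this
  · have := congrArg (fun z => g.basicPart (g.fiberContr z)) h
    simpa only [map_add, fiberContr_basicIncl, fiberContr_new_gen_mul, zero_add,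
      basicPart_basicIncl] using this

variable {h : SuperLInf}

theorem shift_cycIncl_gen_mul (i : h.Gen) (x : h.CE) :
    h.shift (h.cycIncl (h.gen i * x)) = GCAlg.gen h.cycDeg (.shift i) * h.cycIncl x +
      koszul (1, 0) (h.deg i) • (GCAlg.gen h.cycDeg (.base i) * h.shift (h.cycIncl x)) := by
  rw [map_mul, cycIncl_gen, shift, gradedDer_gen_mul, koszul_neg_one]
  rfl

/-- The formula `eⁱ ↦ ρ(eⁱ) - e' ρ(s eⁱ)` is multiplicative because `e'` is odd, and so holds on
all of `CE h` once it holds on generators. -/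
theorem pull_eq_of_gen (ρ : GCAlg h.cycDeg →ₐ[ℝ] g.CE)
    (hρ : ∀ j, ρ (GCAlg.gen h.cycDeg j) ∈ g.homog (h.cycDeg j)) (f : h.CE →ₐ[ℝ] GCAlg g.extDeg)
    (hf : ∀ i, f (h.gen i) = g.basicIncl (ρ (GCAlg.gen h.cycDeg (.base i))) -
      GCAlg.gen g.extDeg none * g.basicIncl (ρ (GCAlg.gen h.cycDeg (.shift i)))) (x : h.CE) :
    f x = g.basicIncl (ρ (h.cycIncl x)) -
      GCAlg.gen g.extDeg none * g.basicIncl (ρ (h.shift (h.cycIncl x))) := by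
  have key : f.toLinearMap = g.basicIncl.toLinearMap ∘ₗ ρ.toLinearMap ∘ₗ h.cycIncl.toLinearMap -
      LinearMap.mulLeft ℝ (GCAlg.gen g.extDeg none) ∘ₗ g.basicIncl.toLinearMap ∘ₗ ρ.toLinearMap ∘ₗ
        h.shift ∘ₗ h.cycIncl.toLinearMap := by
    apply linearMap_ext
    intro l
    simp only [LinearMap.sub_apply, LinearMap.comp_apply, AlgHom.toLinearMap_apply,
      LinearMap.mulLeft_apply]
    induction l with
    | nil => simp [shift]
    | cons i l ih =>
      have hbase := g.basicIncl_mem (hρ (.base i))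
      have hcomm : g.basicIncl (ρ (GCAlg.gen h.cycDeg (.base i))) * GCAlg.gen g.extDeg none =
          koszul (1, 0) (h.deg i) •
            (GCAlg.gen g.extDeg none * g.basicIncl (ρ (GCAlg.gen h.cycDeg (.base i)))) := by
        rw [koszul_comm]
        exact homog_mul_gen hbase (none : Option g.Gen)
      have hfiber := new_gen_mul_mul_new_gen (g.basicIncl_mem (hρ (.shift i)))
      rw [List.map_cons, List.prod_cons, map_mul, ih, shift_cycIncl_gen_mul, map_mul, cycIncl_gen,
        hf]
      simp only [map_add, map_mul, map_smul, mul_sub, sub_mul, mul_add]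
      rw [← mul_assoc (GCAlg.gen g.extDeg none * _), hfiber, zero_mul,
        ← mul_assoc _ _ (g.basicIncl (ρ (h.shift _))), hcomm, smul_mul_assoc, mul_smul_comm]
      simp only [mul_assoc]
      abel
  exact LinearMap.congr_fun key x

variable {c : g.CE} {hc : c ∈ g.homog (2, 0)} {hdc : g.d c = 0}

theorem centralExt_d_sub (x y : g.CE) :
    (g.centralExt c hc hdc).d (g.basicIncl x - GCAlg.gen g.extDeg none * g.basicIncl y) =
      g.basicIncl (g.d x - c * y) + GCAlg.gen g.extDeg none * g.basicIncl (g.d y) := by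
  have d_basic (z : g.CE) : (g.centralExt c hc hdc).d (g.basicIncl z) = g.basicIncl (g.d z) :=
    ext_d_basicIncl g c hc z
  have d_new : (g.centralExt c hc hdc).d (GCAlg.gen g.extDeg none) = g.basicIncl c :=
    (g.centralExt c hc hdc).d_gen none
  rw [map_sub, d_basic, (g.centralExt c hc hdc).d_mul (gen_mem (deg := g.extDeg) none), d_basic,
    d_new, show koszul (1, 0) (g.extDeg none) = -1 from koszul_one_one]
  simp only [map_sub, map_mul, neg_one_smul]
  abel

theorem d_reduction_gen {f : Hom (g.centralExt c hc hdc) h} (ρ : GCAlg h.cycDeg →ₐ[ℝ] g.CE)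
    (hρ : ∀ j, ρ (GCAlg.gen h.cycDeg j) ∈ g.homog (h.cycDeg j))
    (hf : ∀ i, f.pull (h.gen i) = g.basicIncl (ρ (GCAlg.gen h.cycDeg (.base i))) -
      GCAlg.gen g.extDeg none * g.basicIncl (ρ (GCAlg.gen h.cycDeg (.shift i)))) (i : h.Gen) :
    g.d (ρ (GCAlg.gen h.cycDeg (.base i))) =
        ρ (h.cycIncl (h.dgen i)) + c * ρ (GCAlg.gen h.cycDeg (.shift i)) ∧
      g.d (ρ (GCAlg.gen h.cycDeg (.shift i))) = -ρ (h.shift (h.cycIncl (h.dgen i))) := by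
  rw [← sub_eq_iff_eq_add]
  apply basicIncl_add_new_gen_mul_injective
  have hd := f.pull_d (h.gen i)
  rw [d_gen, pull_eq_of_gen ρ hρ f.pull hf, hf, centralExt_d_sub] at hd
  rw [← hd, map_neg, mul_neg, sub_eq_add_neg]

theorem exists_reduction (f : Hom (g.centralExt c hc hdc) h) (v : CycGen h.Gen → g.CE)
    (hv : ∀ j, v j ∈ g.homog (h.cycDeg j)) (hv_omega : v .omega = c)
    (hf : ∀ i, f.pull (h.gen i) =
      g.basicIncl (v (.base i)) - GCAlg.gen g.extDeg none * g.basicIncl (v (.shift i))) :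
    ∃ r : Hom g h.cyc, IsReduction f r ∧ ∀ j, r.pull (h.cyc.gen j) = v j := by
  set ρ : GCAlg h.cycDeg →ₐ[ℝ] g.CE := homogLift v hv
  have hgen (j : CycGen h.Gen) : ρ (GCAlg.gen h.cycDeg j) = v j := homogLift_gen _ _ j
  have hd := d_reduction_gen (f := f) ρ (fun j => by rw [hgen]; exact hv j)
    (fun i => by rw [hgen, hgen]; exact hf i)
  refine ⟨Hom.ofGens v hv ?_, ⟨(hgen .omega).trans hv_omega, fun i => ?_⟩, hgen⟩
  · rintro (_ | i | i)
    · exact (map_zero ρ).trans (by rw [hv_omega, hdc])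
    · change ρ (h.cycIncl (h.dgen i) +
        GCAlg.gen h.cycDeg .omega * GCAlg.gen h.cycDeg (.shift i)) = _
      rw [map_add, map_mul, ← hgen (.base i), (hd i).1, hgen .omega, hv_omega]
    · change ρ (-h.shift (h.cycIncl (h.dgen i))) = _
      rw [map_neg, ← hgen (.shift i), (hd i).2]
  · change _ = g.basicIncl (ρ (GCAlg.gen h.cycDeg (.base i))) -
      GCAlg.gen g.extDeg none * g.basicIncl (ρ (GCAlg.gen h.cycDeg (.shift i)))
    rw [hf, hgen, hgen]

theorem exists_oxidation (r : Hom g h.cyc) (hr : r.pull (h.cyc.gen .omega) = c) :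
    ∃ f : Hom (g.centralExt c hc hdc) h, IsReduction f r := by
  set φ : h.Gen → GCAlg g.extDeg := fun i => g.basicIncl (r.pull (h.cyc.gen (.base i))) -
    GCAlg.gen g.extDeg none * g.basicIncl (r.pull (h.cyc.gen (.shift i))) with hφ
  have hr_mem (j : CycGen h.Gen) : r.pull (h.cyc.gen j) ∈ g.homog (h.cycDeg j) :=
    r.pull_mem _ _ (gen_mem (deg := h.cycDeg) j)
  have hmem (i : h.Gen) : φ i ∈ GCAlg.homog g.extDeg (h.deg i) := by
    refine sub_mem (g.basicIncl_mem (hr_mem (.base i))) ?_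
    have hdeg : g.extDeg none + h.cycDeg (.shift i) = h.deg i := by
      change ((1, 0) : BiDeg) + (h.deg i + (-1, 0)) = h.deg i
      rw [add_left_comm]
      simp
    exact hdeg ▸ GCAlg.mul_mem (gen_mem (deg := g.extDeg) none)
      (g.basicIncl_mem (hr_mem (.shift i)))
  have hgen (i : h.Gen) : homogLift φ hmem (h.gen i) = φ i := homogLift_gen _ _ i
  refine ⟨Hom.ofGens φ hmem fun i => ?_, hr, hgen⟩
  rw [pull_eq_of_gen r.pull hr_mem (homogLift φ hmem) hgen, hφ]
  dsimp only
  rw [centralExt_d_sub, ← r.pull_d, ← r.pull_d, d_gen, d_gen]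
  change _ = g.basicIncl (r.pull (h.cycIncl (h.dgen i) + GCAlg.gen h.cycDeg .omega *
    GCAlg.gen h.cycDeg (.shift i)) - _) + _ * g.basicIncl (r.pull (-h.shift (h.cycIncl (h.dgen i))))
  rw [map_add r.pull, map_mul r.pull, map_neg r.pull, map_neg]
  change r.pull (GCAlg.gen h.cycDeg .omega) = c at hr
  rw [hr, add_sub_cancel_right, mul_neg, sub_eq_add_neg]

end

end SuperLInf

theorem tDuality_pull_gen (j : CycGen KUGen) :
    tDuality.pull ((twistedKU 1).cyc.gen j) = tGen j :=
  homogLift_gen tGen tGen_mem j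

/-- Values on generators of the inverse of the T-duality isomorphism. -/
def tInvGen : CycGen KUGen → (twistedKU 1).cyc.CE
  | .omega => -(twistedKU 1).cyc.gen (.shift .h3)
  | .base .h3 => (twistedKU 1).cyc.gen (.base .h3)
  | .shift .h3 => -(twistedKU 1).cyc.gen .omega
  | .base (.f k) => (twistedKU 1).cyc.gen (.shift (.f k))
  | .shift (.f k) => (twistedKU 1).cyc.gen (.base (.f (k - 1)))

theorem tInvGen_mem (j : CycGen KUGen) :
    tInvGen j ∈ (twistedKU 1).cyc.homog ((twistedKU 0).cyc.deg j) := by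
  have hgen (j : CycGen KUGen) : (twistedKU 1).cyc.gen j ∈ _ :=
    gen_mem (deg := (twistedKU 1).cyc.deg) j
  rcases j with _ | (_ | k) | (_ | k)
  · exact neg_mem (hgen (.shift .h3))
  · exact hgen (.base .h3)
  · have hdeg : (twistedKU 1).cyc.deg (.shift (.f k)) = (twistedKU 0).cyc.deg (.base (.f k)) := by
      change ((2 * k + 1, 0) : BiDeg) + (-1, 0) = (2 * k + 0, 0)
      ext <;> simp
    exact hdeg ▸ hgen (.shift (.f k))
  · exact neg_mem (hgen .omega)
  · have hdeg : (twistedKU 1).cyc.deg (.base (.f (k - 1))) =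
        (twistedKU 0).cyc.deg (.shift (.f k)) := by
      change ((2 * (k - 1) + 1, 0) : BiDeg) = (2 * k + 0, 0) + (-1, 0)
      ext <;> simp
      ring
    exact hdeg ▸ hgen (.base (.f (k - 1)))

theorem tDuality_isIso : tDuality.IsIso := by
  have hinv (j : CycGen KUGen) :
      homogLift tInvGen tInvGen_mem ((twistedKU 0).cyc.gen j) = tInvGen j := homogLift_gen _ _ j
  refine tDuality.isIso_of_inverse (homogLift tInvGen tInvGen_mem) ?_ ?_
  · rintro (_ | (_ | k) | (_ | k)) <;> rw [tDuality_pull_gen] <;>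
      simp only [tGen, map_neg, hinv] <;> simp [tInvGen]
  · rintro (_ | (_ | k) | (_ | k)) <;> rw [hinv] <;>
      simp only [tInvGen, map_neg, tDuality_pull_gen] <;> simp [tGen]

/-! ### Super-Minkowski algebras -/

section

variable {ι κ : Type}

/-- The odd generators `ψ^α` of a super-Minkowski algebra with even generators indexed by `κ`. -/
def psi (κ : Type) (α : ι) : GCAlg (minkDeg ι κ) := GCAlg.gen (minkDeg ι κ) (.inl α)

/-- The even generators `e^a` of a super-Minkowski algebra with odd generators indexed by `ι`. -/
def vec (ι : Type) (a : κ) : GCAlg (minkDeg ι κ) := GCAlg.gen (minkDeg ι κ) (.inr a)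

theorem psi_comm (α β : ι) : Commute (psi κ α) (psi κ β) := by
  rw [psi, psi, Commute, SemiconjBy, gen_mul_gen]
  simp [koszul, minkDeg, ZMod.val_one]

theorem psi_mul_psi_mem (α β : ι) : psi κ α * psi κ β ∈ GCAlg.homog (minkDeg ι κ) (2, 0) := by
  have hdeg : minkDeg ι κ (.inl α) + minkDeg ι κ (.inl β) = (2, 0) := by
    simp only [minkDeg]
    decide
  exact hdeg ▸ GCAlg.mul_mem (gen_mem (deg := minkDeg ι κ) (.inl α))
    (gen_mem (deg := minkDeg ι κ) (.inl β))

theorem commute_psi_mul_psi (α β : ι) (x : GCAlg (minkDeg ι κ)) :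
    Commute x (psi κ α * psi κ β) :=
  (commute_of_mem_two (psi_mul_psi_mem α β) x).symm

theorem vec_mem (a : κ) : vec ι a ∈ GCAlg.homog (minkDeg ι κ) (1, 0) :=
  gen_mem (deg := minkDeg ι κ) (.inr a)

theorem vec_anticomm (a b : κ) : vec ι a * vec ι b = -(vec ι b * vec ι a) :=
  mul_anticomm_of_mem_odd odd_one odd_one (vec_mem a) (vec_mem b)

theorem vec_mul_self (a : κ) : vec ι a * vec ι a = 0 := eq_zero_of_eq_neg (vec_anticomm a a)

theorem mul_vec_mem {x : GCAlg (minkDeg ι κ)} (hx : x ∈ GCAlg.homog (minkDeg ι κ) (2, 0)) (a : κ) :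
    x * vec ι a ∈ GCAlg.homog (minkDeg ι κ) (3, 0) := by
  have hmul := GCAlg.mul_mem hx (vec_mem a)
  rwa [show ((2, 0) : BiDeg) + (1, 0) = (3, 0) by decide] at hmul

variable [Fintype ι]

theorem bil_mem (n : ℤ) {M : Matrix ι ι (GCAlg (minkDeg ι κ))}
    (hM : ∀ i j, M i j ∈ GCAlg.homog (minkDeg ι κ) (n, 0)) :
    bil (psi κ) M ∈ GCAlg.homog (minkDeg ι κ) (n + 2, 0) := by
  rw [bil_apply]
  refine sum_mem fun α _ => sum_mem fun β _ => ?_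
  have h := GCAlg.mul_mem (psi_mul_psi_mem (κ := κ) α β) (hM α β)
  rwa [Prod.mk_add_mk, add_comm, add_zero] at h

theorem commute_quad (K : Matrix ι ι ℝ) (x : GCAlg (minkDeg ι κ)) : Commute (quad κ K) x :=
  commute_of_mem_two (quad_mem K) x

theorem d_vec [Finite κ] (K : κ → Matrix ι ι ℝ) (a : κ) :
    (superMink K).d (vec ι a) = quad κ (K a) := (superMink K).d_gen (.inr a)

theorem d_bil [Finite κ] (K : κ → Matrix ι ι ℝ) (M : Matrix ι ι (GCAlg (minkDeg ι κ))) :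
    (superMink K).d (bil (psi κ) M) = bil (psi κ) ((superMink K).d.mapMatrix M) := by
  simp only [bil_apply, map_sum, LinearMap.mapMatrix_apply, Matrix.map_apply]
  refine Finset.sum_congr rfl fun α _ => Finset.sum_congr rfl fun β _ => ?_
  have h : (superMink K).d (psi κ α * psi κ β) = 0 := by
    rw [SuperLInf.d]
    simp only [psi, gradedDer_gen_mul, gradedDer_gen, minkDgen, zero_mul, mul_zero, smul_zero,
      add_zero]
  rw [(superMink K).d_mul (psi_mul_psi_mem α β), h, zero_mul, zero_add, koszul_two, one_smul]

theorem quad_smul (c : ℝ) (K : Matrix ι ι ℝ) : quad κ (c • K) = c • quad κ K := by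
  simp only [quad, Finset.smul_sum, Matrix.smul_apply, smul_assoc]

theorem psi_mul_eq_mul_psi_of_symm {Z : Matrix ι ι (GCAlg (minkDeg ι κ))}
    (hZ : ∀ i j x, Commute (Z i j) x) (hs : Z.IsSymm) (γ : ι) :
    ∑ α, psi κ α * Z α γ = ∑ α, Z γ α * psi κ α :=
  Finset.sum_congr rfl fun α _ => by rw [← (hZ α γ _).eq, hs.apply]

variable [DecidableEq ι]

theorem quad_eq_bil (K : Matrix ι ι ℝ) :
    quad κ K = bil (psi κ) (realMat (GCAlg (minkDeg ι κ)) K) := by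
  rw [quad, bil_apply]
  refine Finset.sum_congr rfl fun α _ => Finset.sum_congr rfl fun β _ => ?_
  rw [realMat_apply, ← Algebra.commutes, Algebra.smul_def]
  rfl

theorem d_mapMatrix_vec_slash_mul [Fintype κ] (K G : κ → Matrix ι ι ℝ)
    (M : Matrix ι ι (GCAlg (minkDeg ι κ))) :
    (superMink K).d.mapMatrix (slash G (vec ι) * M) =
      slash G (fun a => quad κ (K a)) * M - slash G (vec ι) * (superMink K).d.mapMatrix M := by
  simpa only [d_vec] using (superMink K).d_mapMatrix_slash_mul G (e := vec ι) vec_mem M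

theorem bil_slash [Fintype κ] (G : κ → Matrix ι ι ℝ) (w : κ → GCAlg (minkDeg ι κ)) :
    bil (psi κ) (slash G w) = ∑ a, quad κ (G a) * w a := by
  simp only [slash, map_sum, scalar_mul_realMat, bil_mul_scalar, quad_eq_bil]

end

/-! ### Super-Minkowski algebras as central extensions -/

section

variable {ι : Type} [Fintype ι] {K' : Fin 9 → Matrix ι ι ℝ} {K : Fin 10 → Matrix ι ι ℝ}
  {c : Matrix ι ι ℝ} {hK : ∀ a : Fin 9, K a.castSucc = K' a} {hc : K (Fin.last 9) = c}

theorem extIdent_pull_psi (α : ι) : (extIdent K' K c hK hc).pull (psi (Fin 10) α) =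
    GCAlg.gen (superMink K').extDeg (some (.inl α)) := Hom.ofGens_pull_gen _ _ _ _

theorem extIdent_pull_vec_castSucc (a : Fin 9) :
    (extIdent K' K c hK hc).pull (vec ι a.castSucc) =
      GCAlg.gen (superMink K').extDeg (some (.inr a)) :=
  (Hom.ofGens_pull_gen _ _ _ _).trans (Fin.lastCases_castSucc a)

theorem extIdent_pull_vec_last :
    (extIdent K' K c hK hc).pull (vec ι (Fin.last 9)) = GCAlg.gen (superMink K').extDeg none :=
  (Hom.ofGens_pull_gen _ _ _ _).trans Fin.lastCases_last

/-- Values on generators of the inverse of the identification of a super-Minkowski algebra with a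
central extension. -/
def extIdentInvGen : Option (ι ⊕ Fin 9) → GCAlg (minkDeg ι (Fin 10))
  | none => vec ι (Fin.last 9)
  | some (.inl α) => psi (Fin 10) α
  | some (.inr a) => vec ι a.castSucc

theorem extIdentInvGen_mem (o : Option (ι ⊕ Fin 9)) :
    extIdentInvGen o ∈ GCAlg.homog (minkDeg ι (Fin 10)) ((superMink K').extDeg o) := by
  rcases o with _ | α | a
  · exact vec_mem _
  · exact gen_mem (deg := minkDeg ι (Fin 10)) (.inl α)
  · exact vec_mem _

theorem extIdent_isIso : (extIdent K' K c hK hc).IsIso := by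
  have hinv (j : Option (ι ⊕ Fin 9)) : homogLift extIdentInvGen (extIdentInvGen_mem (K' := K'))
      (GCAlg.gen (superMink K').extDeg j) = extIdentInvGen j := homogLift_gen _ _ j
  refine (extIdent K' K c hK hc).isIso_of_inverse
    (homogLift extIdentInvGen (extIdentInvGen_mem (K' := K'))) ?_ ?_
  · rintro (α | a)
    · exact (congrArg _ (extIdent_pull_psi α)).trans (hinv _)
    · induction a using Fin.lastCases with
      | last => exact (congrArg _ extIdent_pull_vec_last).trans (hinv _)
      | cast a => exact (congrArg _ (extIdent_pull_vec_castSucc a)).trans (hinv _)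
  · rintro (_ | α | a) <;> rw [hinv]
    · exact extIdent_pull_vec_last
    · exact extIdent_pull_psi α
    · exact extIdent_pull_vec_castSucc a

end

/-! ### Clifford monomials -/

theorem eta_self_mul_self {n : ℕ} (a : Fin n) : eta a a * eta a a = 1 := by
  simp only [eta, if_true]
  split_ifs <;> norm_num

theorem eta_self_ne_zero {n : ℕ} (a : Fin n) : eta a a ≠ 0 :=
  left_ne_zero_of_mul_eq_one (eta_self_mul_self a)

namespace Majorana11

/-- The sign by which `Γ_a` commutes past the Clifford monomial with index set `J`. -/
def cliffSign (a : Fin 11) (J : Finset (Fin 11)) : ℝ := (-1) ^ (J.erase a).card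

theorem cliffSign_of_mem {a : Fin 11} {J : Finset (Fin 11)} (ha : a ∈ J) :
    cliffSign a J = -(-1) ^ J.card := by
  rw [cliffSign, ← Finset.card_erase_add_one ha, pow_succ]
  ring

theorem cliffSign_of_notMem {a : Fin 11} {J : Finset (Fin 11)} (ha : a ∉ J) :
    cliffSign a J = (-1) ^ J.card := by
  rw [cliffSign, Finset.erase_eq_of_notMem ha]

/-- If the signs for `J` and `K` agree outside `J ∪ K`, they disagree on the symmetric
difference. -/
theorem exists_cliffSign_mul_eq_neg_one {J K : Finset (Fin 11)} (hJK : J ≠ K)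
    (hcard : J.card + K.card ≤ 10) : ∃ b, cliffSign b J * cliffSign b K = -1 := by
  obtain ⟨outside, -, h_outside⟩ := Finset.exists_mem_notMem_of_card_lt_card
    (((Finset.card_union_le J K).trans hcard).trans_lt (by simp) :
      (J ∪ K).card < (Finset.univ : Finset (Fin 11)).card)
  rw [Finset.mem_union, not_or] at h_outside
  have sign_outside : cliffSign outside J * cliffSign outside K = (-1) ^ (J.card + K.card) := by
    rw [cliffSign_of_notMem h_outside.1, cliffSign_of_notMem h_outside.2, pow_add]
  obtain ⟨c, hc⟩ : ∃ c, ¬(c ∈ J ↔ c ∈ K) := by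
    by_contra! h
    exact hJK (Finset.ext h)
  have sign_diff : cliffSign c J * cliffSign c K = -(-1) ^ (J.card + K.card) := by
    by_cases hcJ : c ∈ J
    · have hcK : c ∉ K := fun hcK => hc (iff_of_true hcJ hcK)
      rw [cliffSign_of_mem hcJ, cliffSign_of_notMem hcK, neg_mul, pow_add]
    · have hcK : c ∈ K := by_contra fun hcK => hc (iff_of_false hcJ hcK)
      rw [cliffSign_of_notMem hcJ, cliffSign_of_mem hcK, mul_neg, pow_add]
  rcases neg_one_pow_eq_or ℝ (J.card + K.card) with hpar | hpar
  · exact ⟨c, by rw [sign_diff, hpar]⟩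
  · exact ⟨outside, by rw [sign_outside, hpar]⟩

variable {ι : Type} [Fintype ι] [DecidableEq ι] (S : Majorana11 ι)

theorem trace_one (S : Majorana11 ι) : (1 : Matrix ι ι ℝ).trace = 32 := by
  rw [Matrix.trace_one, S.card_eq]
  norm_num

theorem gamma_sq (a : Fin 11) : S.Γ a * S.Γ a = eta a a • (1 : Matrix ι ι ℝ) := by
  have h := S.clifford a a
  rw [← two_smul ℝ, mul_smul] at h
  exact smul_right_injective _ (two_ne_zero (α := ℝ)) h

theorem gamma_ten_sq : S.Γ 10 * S.Γ 10 = 1 := by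
  rw [gamma_sq]
  simp [eta]

theorem gamma_anticomm {a b : Fin 11} (hab : a ≠ b) : S.Γ a * S.Γ b = -(S.Γ b * S.Γ a) := by
  have h := S.clifford a b
  rw [eta, if_neg hab, mul_zero, zero_smul] at h
  exact eq_neg_of_add_eq_zero_left h

theorem trace_eq_zero_of_anticomm {X : Matrix ι ι ℝ} (b : Fin 11)
    (hX : S.Γ b * X = -(X * S.Γ b)) : X.trace = 0 := by
  have trace_conj : (S.Γ b * X * S.Γ b).trace = eta b b * X.trace := by
    rw [Matrix.trace_mul_comm, ← mul_assoc, S.gamma_sq]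
    simp
  have trace_conj_neg : (S.Γ b * X * S.Γ b).trace = -(eta b b * X.trace) := by
    rw [hX, neg_mul, mul_assoc, S.gamma_sq]
    simp
  have h : eta b b * X.trace = 0 := by linarith
  exact (mul_eq_zero.mp h).resolve_left (eta_self_ne_zero b)

/-- The product of Clifford generators along a list of indices. -/
def mono (l : List (Fin 11)) : Matrix ι ι ℝ := (l.map S.Γ).prod

@[simp]
theorem mono_nil : S.mono [] = 1 := rfl

@[simp]
theorem mono_cons (a : Fin 11) (l : List (Fin 11)) : S.mono (a :: l) = S.Γ a * S.mono l := by
  simp [mono]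

theorem mono_append (l l' : List (Fin 11)) : S.mono (l ++ l') = S.mono l * S.mono l' := by
  simp [mono]

theorem gamma_mul_mono (a : Fin 11) (l : List (Fin 11)) :
    S.Γ a * S.mono l = (-1 : ℝ) ^ l.countP (· ≠ a) • (S.mono l * S.Γ a) := by
  induction l with
  | nil => simp
  | cons b l ih =>
    rw [mono_cons, List.countP_cons]
    by_cases hba : b = a
    · subst hba
      conv_lhs => rw [ih]
      rw [mul_smul_comm, mul_assoc]
      simp
    · rw [← mul_assoc, S.gamma_anticomm (Ne.symm hba), neg_mul, mul_assoc, ih, mul_smul_comm,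
        ← mul_assoc]
      simp [hba, pow_succ]

theorem mono_reverse {l : List (Fin 11)} (hl : l.Nodup) :
    S.mono l.reverse = (-1 : ℝ) ^ l.length.choose 2 • S.mono l := by
  induction l with
  | nil => simp
  | cons b l ih =>
    rw [List.nodup_cons] at hl
    have countP_ne : l.countP (· ≠ b) = l.length :=
      List.countP_eq_length.2 fun a ha => decide_eq_true fun hab => hl.1 (hab ▸ ha)
    have hcomm := S.gamma_mul_mono b l
    rw [countP_ne] at hcomm
    rw [List.reverse_cons, mono_append, ih hl.2, mono_cons, mono_cons, mono_nil, mul_one, hcomm,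
      smul_mul_assoc, smul_smul, List.length_cons, Nat.choose_succ_succ' l.length 1,
      Nat.choose_one_right, pow_add, mul_right_comm, ← mul_pow]
    norm_num

theorem mono_mul_mono_reverse (l : List (Fin 11)) :
    ∃ c : ℝ, c ≠ 0 ∧ S.mono l * S.mono l.reverse = c • 1 := by
  induction l with
  | nil => exact ⟨1, one_ne_zero, by simp⟩
  | cons b l ih =>
    obtain ⟨c, hc, h⟩ := ih
    refine ⟨c * eta b b, mul_ne_zero hc (eta_self_ne_zero b), ?_⟩
    rw [List.reverse_cons, mono_append, mono_cons, mul_assoc, ← mul_assoc (S.mono l), h]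
    simp [S.gamma_sq, smul_smul]

theorem mono_transpose_mul_C (l : List (Fin 11)) :
    (S.mono l).transpose * S.C = (-1 : ℝ) ^ l.length • (S.C * S.mono l.reverse) := by
  induction l with
  | nil => simp
  | cons b l ih =>
    rw [mono_cons, Matrix.transpose_mul, mul_assoc, S.skewAdj, mul_neg, ← mul_assoc, ih,
      List.reverse_cons, mono_append, List.length_cons, pow_succ]
    simp [mul_assoc]

/-- The Clifford monomial with index set `J`: the product of its generators in increasing order. -/
def cliff (J : Finset (Fin 11)) : Matrix ι ι ℝ := S.mono (J.sort (· ≤ ·))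

theorem gamma_mul_cliff (a : Fin 11) (J : Finset (Fin 11)) :
    S.Γ a * S.cliff J = cliffSign a J • (S.cliff J * S.Γ a) := by
  have erase_eq : J.erase a = ((J.sort (· ≤ ·)).filter (· ≠ a)).toFinset := by
    ext x
    simp [and_comm]
  rw [cliff, gamma_mul_mono, cliffSign, erase_eq,
    List.toFinset_card_of_nodup ((J.sort_nodup _).filter _), List.countP_eq_length_filter]

theorem cliff_sq (J : Finset (Fin 11)) : ∃ c : ℝ, c ≠ 0 ∧ S.cliff J * S.cliff J = c • 1 := by
  obtain ⟨c, hc, h⟩ := S.mono_mul_mono_reverse (J.sort (· ≤ ·))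
  rw [S.mono_reverse (J.sort_nodup _), mul_smul_comm] at h
  refine ⟨(-1) ^ (J.sort (· ≤ ·)).length.choose 2 * c,
    mul_ne_zero (pow_ne_zero _ (by norm_num)) hc, ?_⟩
  rw [mul_smul, ← h, smul_smul, ← mul_pow]
  simp [cliff]

theorem cliff_transpose_mul_C (J : Finset (Fin 11)) :
    (S.cliff J).transpose * S.C = (-1 : ℝ) ^ (J.card + 1).choose 2 • (S.C * S.cliff J) := by
  rw [cliff, mono_transpose_mul_C, S.mono_reverse (J.sort_nodup _), mul_smul_comm, smul_smul,
    Finset.length_sort, Nat.choose_succ_succ' J.card 1, Nat.choose_one_right, pow_add]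

theorem trace_cliff_mul_cliff {J K : Finset (Fin 11)} (hJK : J ≠ K)
    (hcard : J.card + K.card ≤ 10) : (S.cliff J * S.cliff K).trace = 0 := by
  obtain ⟨b, hb⟩ := exists_cliffSign_mul_eq_neg_one hJK hcard
  apply S.trace_eq_zero_of_anticomm b
  rw [← mul_assoc, gamma_mul_cliff, smul_mul_assoc, mul_assoc, gamma_mul_cliff, mul_smul_comm,
    smul_smul, hb, neg_one_smul, mul_assoc]

theorem card_finset_card_le_five : Fintype.card {J : Finset (Fin 11) // J.card ≤ 5} = 1024 := by
  have filter_eq : (Finset.univ.filter fun J : Finset (Fin 11) => J.card ≤ 5) =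
      (Finset.range 6).biUnion fun k => Finset.powersetCard k Finset.univ := by
    ext J
    simp [Nat.lt_succ_iff]
  rw [Fintype.card_subtype, filter_eq, Finset.card_biUnion]
  · simp only [Finset.card_powersetCard, Finset.card_univ, Fintype.card_fin]
    exact Nat.sum_range_choose_halfway 5
  · exact fun i _ j _ hij => Finset.pairwise_disjoint_powersetCard _ hij

theorem linearIndependent_cliff :
    LinearIndependent ℝ fun J : {J : Finset (Fin 11) // J.card ≤ 5} => S.cliff J := by
  rw [Fintype.linearIndependent_iff]
  intro g hg K
  have trace_sum : (S.cliff K * ∑ J, g J • S.cliff J).trace = 0 := by rw [hg]; simp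
  rw [Finset.mul_sum, Matrix.trace_sum, Finset.sum_eq_single K] at trace_sum
  · obtain ⟨c, hc, hsq⟩ := S.cliff_sq K
    rw [mul_smul_comm, hsq, Matrix.trace_smul, Matrix.trace_smul, S.trace_one] at trace_sum
    simpa [hc] using trace_sum
  · intro J _ hJ
    have hKJ : (K : Finset (Fin 11)) ≠ J := fun h => hJ (Subtype.ext h.symm)
    rw [mul_smul_comm, Matrix.trace_smul,
      S.trace_cliff_mul_cliff hKJ (add_le_add K.2 J.2), smul_zero]
  · simp

/- `∑_{k ≤ 5} (11 choose k) = 2 ^ 10 = 32 ^ 2`. -/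
theorem span_cliff :
    Submodule.span ℝ (Set.range fun J : {J : Finset (Fin 11) // J.card ≤ 5} => S.cliff J) = ⊤ := by
  have : Nonempty {J : Finset (Fin 11) // J.card ≤ 5} := ⟨⟨∅, by simp⟩⟩
  apply S.linearIndependent_cliff.span_eq_top_of_card_eq_finrank
  rw [card_finset_card_le_five, Module.finrank_matrix, S.card_eq]
  simp

end Majorana11

/-! ### The Fierz identity -/

section

variable {ι : Type*} [Fintype ι]

theorem mul_single_mul_apply [DecidableEq ι] (A B : Matrix ι ι ℝ) (β γ α δ : ι) :
    (A * Matrix.single β γ 1 * B : Matrix ι ι ℝ) α δ = A α β * B γ δ := by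
  rw [mul_assoc, Matrix.mul_apply, Finset.sum_eq_single β]
  · simp [Matrix.single_mul_apply_same]
  · intro x _ hx
    simp [Matrix.single_mul_apply_of_ne _ _ _ _ _ hx]
  · simp

variable {A : Type*} [Ring A] [Algebra ℝ A] {ψ : ι → A}

theorem sum_smul_mul_mul_rotate (hψ : ∀ α β, Commute (ψ α) (ψ β)) (c : ι → ι → ι → ℝ) :
    ∑ β, ∑ γ, ∑ δ, c γ δ β • (ψ β * ψ γ * ψ δ) =
      ∑ β, ∑ γ, ∑ δ, c β γ δ • (ψ β * ψ γ * ψ δ) := by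
  rw [Finset.sum_comm]
  refine Finset.sum_congr rfl fun γ _ => ?_
  rw [Finset.sum_comm]
  refine Finset.sum_congr rfl fun δ _ => Finset.sum_congr rfl fun β _ => ?_
  rw [mul_assoc (ψ β), (((hψ β γ).mul_right (hψ β δ))).eq]

theorem sum_smul_mul_mul_eq_zero_of_cyclic (hψ : ∀ α β, Commute (ψ α) (ψ β)) (c : ι → ι → ι → ℝ)
    (hc : ∀ β γ δ, c β γ δ + c γ δ β + c δ β γ = 0) :
    ∑ β, ∑ γ, ∑ δ, c β γ δ • (ψ β * ψ γ * ψ δ) = 0 := by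
  have rotate_once := sum_smul_mul_mul_rotate hψ c
  have rotate_twice := (sum_smul_mul_mul_rotate hψ fun β γ δ => c γ δ β).trans rotate_once
  have three_smul : (3 : ℝ) • ∑ β, ∑ γ, ∑ δ, c β γ δ • (ψ β * ψ γ * ψ δ) = 0 := by
    calc (3 : ℝ) • ∑ β, ∑ γ, ∑ δ, c β γ δ • (ψ β * ψ γ * ψ δ)
        = ∑ β, ∑ γ, ∑ δ, c β γ δ • (ψ β * ψ γ * ψ δ) +
            ∑ β, ∑ γ, ∑ δ, c γ δ β • (ψ β * ψ γ * ψ δ) +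
            ∑ β, ∑ γ, ∑ δ, c δ β γ • (ψ β * ψ γ * ψ δ) := by
          rw [rotate_once, rotate_twice]
          module
      _ = ∑ β, ∑ γ, ∑ δ, (c β γ δ + c γ δ β + c δ β γ) • (ψ β * ψ γ * ψ δ) := by
          simp only [← Finset.sum_add_distrib, ← add_smul]
      _ = 0 := by simp only [hc, zero_smul, Finset.sum_const_zero]
  exact (smul_eq_zero.mp three_smul).resolve_left (by norm_num)

theorem sum_slash_bil_mul {κ : Type*} [Fintype κ] [DecidableEq ι] (G K : κ → Matrix ι ι ℝ)
    (ψ : ι → A) (α : ι) :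
    ∑ δ, slash G (fun a => bil ψ (realMat A (K a))) α δ * ψ δ =
      ∑ β, ∑ γ, ∑ δ, (∑ a, K a β γ * G a α δ) • (ψ β * ψ γ * ψ δ) := by
  have bil_realMat : ∀ a, bil ψ (realMat A (K a)) = ∑ β, ∑ γ, K a β γ • (ψ β * ψ γ) := by
    intro a
    simp only [bil_apply, realMat_apply, ← Algebra.commutes, Algebra.smul_def]
  have expand : ∀ δ, slash G (fun a => bil ψ (realMat A (K a))) α δ * ψ δ =
      ∑ β, ∑ γ, (∑ a, K a β γ * G a α δ) • (ψ β * ψ γ * ψ δ) := by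
    intro δ
    simp only [slash_apply, bil_realMat, Finset.smul_sum, Finset.sum_mul, smul_smul,
      smul_mul_assoc, Finset.sum_smul]
    rw [Finset.sum_comm]
    refine Finset.sum_congr rfl fun β _ => ?_
    rw [Finset.sum_comm]
    simp only [mul_comm]
  simp only [expand]
  rw [Finset.sum_comm]
  exact Finset.sum_congr rfl fun β _ => Finset.sum_comm

end

namespace Majorana11

theorem raise_eq_eta_smul {ι : Type} {n : ℕ} (G : Fin n → Matrix ι ι ℝ) (a : Fin n) :
    raise G a = eta a a • G a := by
  rw [raise_eq, eta, if_pos rfl]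

variable {ι : Type} [Fintype ι] [DecidableEq ι] (S : Majorana11 ι)

theorem gammaA_sq (a : Fin 10) : S.gammaA a * S.gammaA a = eta a a • (1 : Matrix ι ι ℝ) := by
  rw [gammaA, gamma_sq]
  simp [eta]

theorem gamma_ten_mul_gammaA (a : Fin 10) : S.Γ 10 * S.gammaA a = -(S.gammaA a * S.Γ 10) :=
  S.gamma_anticomm (Fin.castSucc_lt_last a).ne'

theorem gamma_ten_mul_gamma_ten_mul (M : Matrix ι ι ℝ) : S.Γ 10 * (S.Γ 10 * M) = M := by
  rw [← mul_assoc, gamma_ten_sq, one_mul]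

theorem gamma_ten_mul_gammaA_mul (a : Fin 10) (M : Matrix ι ι ℝ) :
    S.Γ 10 * (S.gammaA a * M) = -(S.gammaA a * (S.Γ 10 * M)) := by
  rw [← mul_assoc, gamma_ten_mul_gammaA, neg_mul, mul_assoc]

/-- The linear map whose vanishing on `M = (ψ ⊗ φ + φ ⊗ ψ) C` is the polarization of the cubic
identity `(ψ̄ Γ_a Γ_10 ψ) Γ^a ψ = (ψ̄ Γ_a ψ) Γ_10 Γ^a ψ`. -/
def fierzMap : Matrix ι ι ℝ →ₗ[ℝ] Matrix ι ι ℝ where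
  toFun M := ∑ a : Fin 10, eta a a •
    ((2⁻¹ * (S.gammaA a * S.Γ 10 * M).trace) • S.gammaA a +
      S.gammaA a * M * (S.gammaA a * S.Γ 10) -
      (2⁻¹ * (S.gammaA a * M).trace) • (S.Γ 10 * S.gammaA a) -
      S.Γ 10 * S.gammaA a * M * S.gammaA a)
  map_add' M N := by
    rw [← Finset.sum_add_distrib]
    refine Finset.sum_congr rfl fun a _ => ?_
    simp only [mul_add, add_mul, Matrix.trace_add]
    module
  map_smul' c M := by
    rw [RingHom.id_apply, Finset.smul_sum]
    refine Finset.sum_congr rfl fun a _ => ?_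
    simp only [mul_smul_comm, smul_mul_assoc, Matrix.trace_smul, smul_eq_mul]
    module

theorem fierzMap_apply (M : Matrix ι ι ℝ) : S.fierzMap M = ∑ a : Fin 10, eta a a •
    ((2⁻¹ * (S.gammaA a * S.Γ 10 * M).trace) • S.gammaA a +
      S.gammaA a * M * (S.gammaA a * S.Γ 10) -
      (2⁻¹ * (S.gammaA a * M).trace) • (S.Γ 10 * S.gammaA a) -
      S.Γ 10 * S.gammaA a * M * S.gammaA a) := rfl

theorem fierzMap_mul_gamma_ten (M : Matrix ι ι ℝ) :
    S.fierzMap (M * S.Γ 10) = -(S.fierzMap M * S.Γ 10) := by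
  have trace_left : ∀ a, (S.gammaA a * S.Γ 10 * (M * S.Γ 10)).trace =
      -(S.gammaA a * M).trace := by
    intro a
    rw [← mul_assoc, Matrix.trace_mul_comm, mul_assoc (S.gammaA a), gamma_ten_mul_gammaA_mul,
      gamma_ten_mul_gamma_ten_mul, Matrix.trace_neg]
  have trace_right : ∀ a, (S.gammaA a * (M * S.Γ 10)).trace =
      -(S.gammaA a * S.Γ 10 * M).trace := by
    intro a
    rw [← mul_assoc, Matrix.trace_mul_comm, gamma_ten_mul_gammaA_mul, Matrix.trace_neg, mul_assoc]
  rw [fierzMap_apply, fierzMap_apply, Finset.sum_mul, ← Finset.sum_neg_distrib]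
  refine Finset.sum_congr rfl fun a _ => ?_
  rw [trace_left, trace_right]
  simp only [smul_mul_assoc, add_mul, sub_mul, mul_assoc, gamma_ten_mul_gammaA_mul,
    gamma_ten_mul_gammaA, S.gamma_ten_sq, mul_one, mul_neg, neg_mul, neg_neg]
  module

theorem fierzMap_of_comm {M : Matrix ι ι ℝ} (hM : S.Γ 10 * M = M * S.Γ 10) :
    S.fierzMap M = 0 := by
  have hM' : ∀ X, S.Γ 10 * (M * X) = M * (S.Γ 10 * X) := fun X => by
    rw [← mul_assoc, hM, mul_assoc]
  rw [fierzMap_apply]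
  refine Finset.sum_eq_zero fun a _ => ?_
  have trace_gamma_mul : (S.gammaA a * M).trace = 0 := by
    apply S.trace_eq_zero_of_anticomm 10
    rw [gamma_ten_mul_gammaA_mul, hM, mul_assoc]
  have trace_gamma_gamma_mul : (S.gammaA a * S.Γ 10 * M).trace = 0 := by
    apply S.trace_eq_zero_of_anticomm 10
    simp only [mul_assoc, gamma_ten_mul_gammaA_mul, hM, hM']
  have conj_eq : S.gammaA a * M * (S.gammaA a * S.Γ 10) =
      S.Γ 10 * S.gammaA a * M * S.gammaA a := by
    simp only [mul_assoc, hM', gamma_ten_mul_gammaA, neg_mul, mul_neg, neg_neg]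
  rw [trace_gamma_mul, trace_gamma_gamma_mul, conj_eq]
  simp

theorem fierzMap_of_anticomm {M : Matrix ι ι ℝ} (hM : S.Γ 10 * M = -(M * S.Γ 10)) :
    S.fierzMap M = (∑ a : Fin 10, eta a a •
      ((2⁻¹ * (S.gammaA a * S.Γ 10 * M).trace) • S.gammaA a -
        (2⁻¹ * (S.gammaA a * M).trace) • (S.Γ 10 * S.gammaA a))) +
      (2 : ℝ) • ((∑ a : Fin 10, eta a a • (S.gammaA a * M * S.gammaA a)) * S.Γ 10) := by
  have hM' : ∀ X, S.Γ 10 * (M * X) = -(M * (S.Γ 10 * X)) := fun X => by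
    rw [← mul_assoc, hM, neg_mul, mul_assoc]
  rw [fierzMap_apply, Finset.sum_mul, Finset.smul_sum, ← Finset.sum_add_distrib]
  refine Finset.sum_congr rfl fun a _ => ?_
  have conj_eq : S.Γ 10 * S.gammaA a * M * S.gammaA a =
      -(S.gammaA a * M * S.gammaA a * S.Γ 10) := by
    simp only [mul_assoc, hM', gamma_ten_mul_gammaA, neg_mul, mul_neg, neg_neg]
  rw [conj_eq, smul_mul_assoc, ← mul_assoc (S.gammaA a * M)]
  module

theorem sum_conj_cliff (J : Finset (Fin 11)) :
    ∑ a : Fin 10, eta a a • (S.gammaA a * S.cliff J * S.gammaA a) =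
      (∑ a : Fin 10, cliffSign a.castSucc J) • S.cliff J := by
  rw [Finset.sum_smul]
  refine Finset.sum_congr rfl fun a _ => ?_
  have hcomm : S.gammaA a * S.cliff J = cliffSign a.castSucc J • (S.cliff J * S.gammaA a) :=
    S.gamma_mul_cliff a.castSucc J
  rw [hcomm, smul_mul_assoc, mul_assoc, gammaA_sq, mul_smul_comm, mul_one, smul_smul, smul_smul,
    mul_comm (eta a a), mul_assoc, eta_self_mul_self, mul_one]

theorem sum_cliffSign {J : Finset (Fin 11)} (h10 : (10 : Fin 11) ∉ J) :
    ∑ a : Fin 10, cliffSign a.castSucc J = (-1) ^ J.card * (10 - 2 * J.card) := by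
  have sign_eq : ∀ a, cliffSign a J = (-1) ^ J.card * (1 - 2 * if a ∈ J then 1 else 0) := by
    intro a
    by_cases ha : a ∈ J
    · rw [cliffSign_of_mem ha, if_pos ha]; ring
    · rw [cliffSign_of_notMem ha, if_neg ha]; ring
  have sum_eleven : ∑ a : Fin 11, cliffSign a J = (-1) ^ J.card * (11 - 2 * J.card) := by
    simp only [sign_eq]
    rw [← Finset.mul_sum, Finset.sum_sub_distrib, ← Finset.mul_sum]
    simp
  rw [Fin.sum_univ_castSucc, show cliffSign (Fin.last 10) J = (-1) ^ J.card from
    cliffSign_of_notMem h10] at sum_eleven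
  linarith

theorem cliff_singleton (c : Fin 11) : S.cliff {c} = S.Γ c := by
  simp [cliff]

theorem cliff_pair_ten (c : Fin 10) : S.cliff {c.castSucc, 10} = S.gammaA c * S.Γ 10 := by
  have hlt : c.castSucc < (10 : Fin 11) := Fin.castSucc_lt_last c
  have sort_eq : ({c.castSucc, 10} : Finset (Fin 11)).sort (· ≤ ·) = [c.castSucc, 10] := by
    apply List.Perm.eq_of_pairwise' (r := (· ≤ ·)) (Finset.pairwise_sort _ _)
    · simp [hlt.le]
    · rw [List.perm_ext_iff_of_nodup (Finset.sort_nodup _ _) (by simp [hlt.ne])]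
      simp
  rw [cliff, sort_eq]
  simp [gammaA]

theorem trace_gammaA_mul_cliff (a : Fin 10) {J : Finset (Fin 11)} (hJ : J.card ≤ 9) :
    (S.gammaA a * S.cliff J).trace = if J = {a.castSucc} then 32 * eta a a else 0 := by
  split_ifs with hJa
  · rw [hJa, cliff_singleton]
    change (S.gammaA a * S.gammaA a).trace = _
    rw [gammaA_sq, Matrix.trace_smul, S.trace_one, smul_eq_mul, mul_comm]
  · have h := S.trace_cliff_mul_cliff (Ne.symm hJa) (by rw [Finset.card_singleton]; omega)
    rwa [cliff_singleton] at h

theorem trace_gammaA_mul_gamma_ten_mul_cliff (a : Fin 10) {J : Finset (Fin 11)}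
    (h10 : (10 : Fin 11) ∉ J) (hJ : J.card ≤ 8) :
    (S.gammaA a * S.Γ 10 * S.cliff J).trace = 0 := by
  rw [← cliff_pair_ten]
  refine S.trace_cliff_mul_cliff (fun h => h10 (h ▸ ?_)) ?_
  · exact Finset.mem_insert_of_mem (Finset.mem_singleton_self _)
  · have := Finset.card_le_two (a := a.castSucc) (b := (10 : Fin 11))
    omega

theorem fierzMap_cliff_of_notMem {J : Finset (Fin 11)} (h10 : (10 : Fin 11) ∉ J)
    (hodd : Odd J.card) (hJ : J.card ≤ 8) :
    S.fierzMap (S.cliff J) =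
      (∑ a : Fin 10, if J = {a.castSucc} then (16 : ℝ) • (S.gammaA a * S.Γ 10) else 0) +
        (2 * (2 * J.card - 10) : ℝ) • (S.cliff J * S.Γ 10) := by
  have hanti : S.Γ 10 * S.cliff J = -(S.cliff J * S.Γ 10) := by
    rw [gamma_mul_cliff, cliffSign_of_notMem h10, hodd.neg_one_pow, neg_one_smul]
  rw [S.fierzMap_of_anticomm hanti, sum_conj_cliff, sum_cliffSign h10, hodd.neg_one_pow]
  congr 1
  · refine Finset.sum_congr rfl fun a _ => ?_
    rw [S.trace_gammaA_mul_gamma_ten_mul_cliff a h10 hJ, S.trace_gammaA_mul_cliff a (by omega),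
      gamma_ten_mul_gammaA]
    split_ifs
    · calc eta a a • ((2⁻¹ * 0 : ℝ) • S.gammaA a -
            (2⁻¹ * (32 * eta a a)) • -(S.gammaA a * S.Γ 10))
          = (16 * (eta a a * eta a a)) • (S.gammaA a * S.Γ 10) := by module
        _ = (16 : ℝ) • (S.gammaA a * S.Γ 10) := by rw [eta_self_mul_self, mul_one]
    · simp
  · rw [smul_mul_assoc, smul_smul]
    congr 1
    ring

theorem fierzMap_gammaA (c : Fin 10) : S.fierzMap (S.gammaA c) = 0 := by
  have cliff_eq : S.cliff {c.castSucc} = S.gammaA c := S.cliff_singleton c.castSucc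
  rw [← cliff_eq, S.fierzMap_cliff_of_notMem (by simpa using (Fin.castSucc_lt_last c).ne')
    (by simp) (by simp), cliff_eq]
  simp only [Finset.singleton_inj, Fin.castSucc_inj, Finset.sum_ite_eq, Finset.mem_univ, if_true,
    Finset.card_singleton, ← add_smul]
  norm_num

theorem fierzMap_cliff_of_card_eq_one {J : Finset (Fin 11)} (hJ : J.card = 1) :
    S.fierzMap (S.cliff J) = 0 := by
  obtain ⟨c, rfl⟩ := Finset.card_eq_one.mp hJ
  rw [cliff_singleton]
  cases c using Fin.lastCases with
  | last => exact S.fierzMap_of_comm rfl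
  | cast c => exact S.fierzMap_gammaA c

theorem fierzMap_cliff_of_card_eq_two {J : Finset (Fin 11)} (hJ : J.card = 2) :
    S.fierzMap (S.cliff J) = 0 := by
  by_cases h10 : (10 : Fin 11) ∈ J
  · obtain ⟨c, hc⟩ : ∃ c, J.erase 10 = {c} :=
      Finset.card_eq_one.mp (by rw [Finset.card_erase_of_mem h10, hJ])
    have hcJ : c ∈ J.erase 10 := hc ▸ Finset.mem_singleton_self c
    obtain ⟨c, rfl⟩ := Fin.exists_castSucc_eq.mpr (Finset.mem_erase.mp hcJ).1
    have hJ_eq : J = {c.castSucc, 10} := by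
      rw [← Finset.insert_erase h10, hc, Finset.pair_comm]
    rw [hJ_eq, cliff_pair_ten, fierzMap_mul_gamma_ten, fierzMap_gammaA, zero_mul, neg_zero]
  · apply S.fierzMap_of_comm
    rw [gamma_mul_cliff, cliffSign_of_notMem h10, hJ]
    norm_num

theorem fierzMap_cliff_of_card_eq_five {J : Finset (Fin 11)} (hJ : J.card = 5) :
    S.fierzMap (S.cliff J) = 0 := by
  by_cases h10 : (10 : Fin 11) ∈ J
  · apply S.fierzMap_of_comm
    rw [gamma_mul_cliff, cliffSign_of_mem h10, hJ]
    norm_num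
  · have hne : ∀ a : Fin 10, J ≠ {a.castSucc} := by
      rintro a rfl
      simp at hJ
    rw [S.fierzMap_cliff_of_notMem h10 (by rw [hJ]; decide) (by omega), hJ]
    simp only [hne, if_false, Finset.sum_const_zero]
    norm_num

theorem C_inv_mul_C : S.C⁻¹ * S.C = 1 := Matrix.nonsing_inv_mul _ S.C_nondeg

/- A monomial with at most five factors is skew-self-adjoint or self-adjoint according to the
number of its factors, and the former happens exactly for `1`, `2` and `5` factors. -/
theorem fierzMap_eq_zero {M : Matrix ι ι ℝ} (hM : M.transpose * S.C = -(S.C * M)) :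
    S.fierzMap M = 0 := by
  let skewPart : Matrix ι ι ℝ →ₗ[ℝ] Matrix ι ι ℝ := LinearMap.id -
    LinearMap.mulLeft ℝ S.C⁻¹ ∘ₗ LinearMap.mulRight ℝ S.C ∘ₗ
      (Matrix.transposeLinearEquiv ι ι ℝ ℝ).toLinearMap
  have skewPart_apply : ∀ X, skewPart X = X - S.C⁻¹ * (X.transpose * S.C) := fun _ => rfl
  have fierzMap_skewPart : S.fierzMap ∘ₗ skewPart = 0 := by
    apply LinearMap.ext_on_range S.span_cliff
    rintro ⟨J, hJ : J.card ≤ 5⟩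
    change S.fierzMap (skewPart (S.cliff J)) = 0
    rw [skewPart_apply, cliff_transpose_mul_C, mul_smul_comm, ← mul_assoc, C_inv_mul_C, one_mul,
      map_sub, map_smul]
    interval_cases h : J.card
    · norm_num
    · rw [S.fierzMap_cliff_of_card_eq_one h, smul_zero, sub_zero]
    · rw [S.fierzMap_cliff_of_card_eq_two h, smul_zero, sub_zero]
    · norm_num [Nat.choose]
    · norm_num [Nat.choose]
    · rw [S.fierzMap_cliff_of_card_eq_five h, smul_zero, sub_zero]
  have h := LinearMap.congr_fun fierzMap_skewPart M
  rw [LinearMap.comp_apply, LinearMap.zero_apply, skewPart_apply, hM, mul_neg, ← mul_assoc,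
    C_inv_mul_C, one_mul, sub_neg_eq_add, ← two_smul ℝ, map_smul] at h
  exact (smul_eq_zero.mp h).resolve_left two_ne_zero

theorem isSymm_C_mul_gamma (a : Fin 11) : (S.C * S.Γ a).IsSymm := by
  rw [Matrix.IsSymm, Matrix.transpose_mul, S.C_skew, mul_neg, S.skewAdj, neg_neg]

theorem isSymm_C_mul_gamma_mul_gamma {a b : Fin 11} (hab : a ≠ b) :
    (S.C * (S.Γ a * S.Γ b)).IsSymm := by
  rw [Matrix.IsSymm, Matrix.transpose_mul, Matrix.transpose_mul, S.C_skew, mul_neg, mul_assoc,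
    S.skewAdj, mul_neg, neg_neg, ← mul_assoc, S.skewAdj, neg_mul, mul_assoc,
    S.gamma_anticomm hab, mul_neg]

/-- The coefficient of `ψ^β ψ^γ ψ^δ` in the component `α` of the cubic spinor expression
`(ψ̄ Γ_a Γ_10 ψ) Γ^a ψ - (ψ̄ Γ_a ψ) Γ_10 Γ^a ψ`. -/
def cubicCoeff (α β γ δ : ι) : ℝ := ∑ a : Fin 10, eta a a *
  ((S.C * (S.gammaA a * S.Γ 10)) β γ * S.gammaA a α δ -
    (S.C * S.gammaA a) β γ * (S.Γ 10 * S.gammaA a) α δ)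

theorem trace_mul_single_add_single_mul_C {X : Matrix ι ι ℝ} (hX : (S.C * X).IsSymm) (β γ : ι) :
    (X * ((Matrix.single β γ 1 + Matrix.single γ β 1) * S.C)).trace = 2 * (S.C * X) β γ := by
  rw [← mul_assoc, Matrix.trace_mul_comm, ← mul_assoc, mul_add, Matrix.trace_add,
    Matrix.trace_mul_single, Matrix.trace_mul_single, hX.apply]
  simp [two_mul]

theorem mul_single_add_single_mul_C_mul_apply (X Y : Matrix ι ι ℝ) (α β γ δ : ι) :
    (X * ((Matrix.single β γ 1 + Matrix.single γ β 1) * S.C) * Y : Matrix ι ι ℝ) α δ =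
      X α β * (S.C * Y) γ δ + X α γ * (S.C * Y) β δ := by
  rw [← mul_assoc X, mul_assoc _ S.C, mul_add, add_mul, Matrix.add_apply, mul_single_mul_apply,
    mul_single_mul_apply]

theorem cubicCoeff_cyclic (α β γ δ : ι) :
    S.cubicCoeff α β γ δ + S.cubicCoeff α γ δ β + S.cubicCoeff α δ β γ = 0 := by
  set N : Matrix ι ι ℝ := Matrix.single β γ 1 + Matrix.single γ β 1 with hN
  have N_symm : N.transpose = N := by
    rw [hN, Matrix.transpose_add, Matrix.transpose_single, Matrix.transpose_single, add_comm]
  have fierz : S.fierzMap (N * S.C) = 0 := S.fierzMap_eq_zero (by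
    rw [Matrix.transpose_mul, S.C_skew, N_symm, neg_mul, neg_mul, mul_assoc])
  have fierz_apply := congrFun (congrFun fierz α) δ
  rw [fierzMap_apply, Matrix.sum_apply] at fierz_apply
  rw [cubicCoeff, cubicCoeff, cubicCoeff, ← Finset.sum_add_distrib, ← Finset.sum_add_distrib]
  refine (Finset.sum_congr rfl fun a _ => ?_).trans fierz_apply
  have symmA : (S.C * S.gammaA a).IsSymm := S.isSymm_C_mul_gamma _
  have symmH : (S.C * (S.gammaA a * S.Γ 10)).IsSymm :=
    S.isSymm_C_mul_gamma_mul_gamma (Fin.castSucc_lt_last a).ne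
  simp only [hN, Matrix.smul_apply, Matrix.sub_apply, Matrix.add_apply, smul_eq_mul,
    mul_single_add_single_mul_C_mul_apply, S.trace_mul_single_add_single_mul_C symmA,
    S.trace_mul_single_add_single_mul_C symmH]
  rw [symmA.apply β δ, symmH.apply β δ]
  ring

/-- The spinor bilinear `(ψ̄ Γ^a ψ)`. -/
def vecA {A : Type*} [Ring A] [Algebra ℝ A] (ψ : ι → A) (a : Fin 10) : A :=
  bil ψ (realMat A (S.C * raise S.gammaA a))

/-- The spinor bilinear `(ψ̄ Γ^a Γ_10 ψ)`. -/
def vecH {A : Type*} [Ring A] [Algebra ℝ A] (ψ : ι → A) (a : Fin 10) : A :=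
  bil ψ (realMat A (S.C * raise (fun b => S.gammaA b * S.Γ 10) a))

theorem slash_vecH_mul_eq {A : Type*} [Ring A] [Algebra ℝ A] {ψ : ι → A}
    (hψ : ∀ α β, Commute (ψ α) (ψ β)) (α : ι) :
    ∑ δ, slash S.gammaA (S.vecH ψ) α δ * ψ δ =
      ∑ δ, (realMat A (S.Γ 10) * slash S.gammaA (S.vecA ψ)) α δ * ψ δ := by
  rw [realMat_mul_slash, ← sub_eq_zero]
  unfold vecH vecA
  rw [sum_slash_bil_mul, sum_slash_bil_mul]
  simp only [raise_eq_eta_smul, mul_smul_comm, Matrix.smul_apply, smul_eq_mul, mul_assoc (eta _ _),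
    ← Finset.sum_sub_distrib, ← sub_smul, ← mul_sub]
  exact sum_smul_mul_mul_eq_zero_of_cyclic hψ (S.cubicCoeff α) (S.cubicCoeff_cyclic α)

local notation "𝒜" => GCAlg (minkDeg ι (Fin 10))

/-! ### The type IIA fluxes as powers of the vielbein matrix -/

theorem gammaA_anticomm {a b : Fin 10} (hab : a ≠ b) :
    S.gammaA a * S.gammaA b = -(S.gammaA b * S.gammaA a) :=
  S.gamma_anticomm fun h => hab (Fin.castSucc_injective _ h)

theorem gammaAs_eq_prod {p : ℕ} {a : Fin p → Fin 10} (ha : Function.Injective a) :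
    S.gammaAs a = (List.ofFn fun i => S.gammaA (a i)).prod := by
  have hsign := fun σ => sign_smul_prod_ofFn_perm (fun _ _ hab => S.gammaA_anticomm hab) σ ha
  simp only [gammaAs, Int.cast_smul_eq_zsmul, hsign]
  rw [Finset.sum_const, Finset.card_univ, Fintype.card_perm, Fintype.card_fin,
    ← Nat.cast_smul_eq_nsmul ℝ, smul_smul, inv_mul_cancel₀ (Nat.cast_ne_zero.mpr
    p.factorial_ne_zero), one_smul]

theorem form_eq_bil (p : ℕ) (G : (Fin p → Fin 10) → Matrix ι ι ℝ) :
    S.form p G = (p.factorial : ℝ)⁻¹ • bil (psi (Fin 10)) (∑ a : Fin p → Fin 10,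
      realMat 𝒜 (S.C * G a) * Matrix.scalar ι (List.ofFn fun i => vec ι (a i)).prod) := by
  simp only [map_sum, bil_mul_scalar, ← quad_eq_bil]
  rfl

theorem form_congr (p : ℕ) {G G' : (Fin p → Fin 10) → Matrix ι ι ℝ}
    (hG : ∀ a, Function.Injective a → G a = G' a) : S.form p G = S.form p G' := by
  rw [form_eq_bil, form_eq_bil]
  congr 2
  refine Finset.sum_congr rfl fun a _ => ?_
  by_cases ha : Function.Injective a
  · rw [hG a ha]
  · rw [prod_ofFn_eq_zero_of_not_injective vec_anticomm vec_mul_self ha, map_zero, mul_zero,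
      mul_zero]

theorem form_gammaAs (p : ℕ) (X : Matrix ι ι ℝ) :
    S.form p (fun a => X * S.gammaAs a) = (p.factorial : ℝ)⁻¹ •
      bil (psi (Fin 10)) (realMat 𝒜 (S.C * X) * slash S.gammaA (vec ι) ^ p) := by
  rw [S.form_congr p fun a ha => congrArg (X * ·) (S.gammaAs_eq_prod ha), form_eq_bil, slash_pow,
    Finset.mul_sum]
  congr 2
  refine Finset.sum_congr rfl fun a _ => ?_
  rw [scalar_mul_realMat, ← mul_assoc, ← mul_assoc, map_mul (realMat 𝒜) (S.C * X)]

theorem gamma_ten_pow_add_two (n : ℕ) : S.Γ 10 ^ (n + 2) = S.Γ 10 ^ n := by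
  rw [pow_add, pow_two, gamma_ten_sq, mul_one]

/-- The flux `F_{2n+2} = (1/(2n)!) (ψ̄ Γ_10^(n+1) Γ_{a₁ ⋯ a_{2n}} ψ) e^{a₁} ⋯ e^{a_{2n}}`, expressed
through the vielbein matrix `e^a Γ_a`. -/
def fluxA (n : ℕ) : 𝒜 := ((2 * n).factorial : ℝ)⁻¹ •
    bil (psi (Fin 10)) (realMat 𝒜 (S.C * S.Γ 10 ^ (n + 1)) * slash S.gammaA (vec ι) ^ (2 * n))

theorem fluxA_of_lt {n : ℕ} (hn : 5 < n) : S.fluxA n = 0 := by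
  rw [fluxA, slash_pow_eq_zero vec_anticomm vec_mul_self _ (by rw [Fintype.card_fin]; omega),
    mul_zero, map_zero, smul_zero]

theorem form_even_gammaAs (n : ℕ) :
    S.form (2 * n) (fun a => S.Γ 10 ^ (n + 1) * S.gammaAs a) = S.fluxA n :=
  S.form_gammaAs _ _

theorem FA_succ (n : ℕ) : S.FA (n + 1) = S.fluxA n := by
  rcases Nat.lt_or_ge n 6 with hn | hn
  · have hform := S.form_even_gammaAs n
    interval_cases n
    · simp [FA, fluxA, pair, quad_eq_bil]
    all_goals simpa [FA, gamma_ten_pow_add_two] using hform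
  · have hne : ∀ k : ℤ, k ≤ 6 → (n : ℤ) + 1 ≠ k := fun k hk => by omega
    rw [S.fluxA_of_lt (by omega), FA]
    simp only [hne 1 (by norm_num), hne 2 (by norm_num), hne 3 (by norm_num), hne 4 (by norm_num),
      hne 5 (by norm_num), hne 6 (by norm_num), if_false]

theorem FA_of_nonpos {k : ℤ} (hk : k ≤ 0) : S.FA k = 0 := by
  have hne : ∀ j : ℤ, 1 ≤ j → k ≠ j := fun j hj => by omega
  simp only [FA, hne 1 (by norm_num), hne 2 (by norm_num), hne 3 (by norm_num),
    hne 4 (by norm_num), hne 5 (by norm_num), hne 6 (by norm_num), if_false]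

theorem FA_mem (k : ℤ) : S.FA k ∈ S.IIA.homog (2 * k, 0) := by
  rcases le_or_gt k 0 with hk | hk
  · rw [S.FA_of_nonpos hk]
    exact zero_mem _
  · obtain ⟨n, rfl⟩ : ∃ n : ℕ, k = n + 1 := ⟨(k - 1).toNat, by omega⟩
    have hbil := bil_mem _ (realMat_mul_mem (S.C * S.Γ 10 ^ (n + 1))
      (slash_pow_mem S.gammaA (vec_mem (ι := ι)) (2 * n)))
    rw [FA_succ, fluxA, show 2 * ((n : ℤ) + 1) = ((2 * n : ℕ) : ℤ) + 2 by push_cast; ring]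
    exact Submodule.smul_mem _ _ hbil

theorem H3A_mem : S.H3A ∈ S.IIA.homog (3, 0) :=
  sum_mem fun a _ => mul_vec_mem (quad_mem _) a

/-! ### The type IIA Bianchi identities -/

theorem vecA_psi (a : Fin 10) :
    S.vecA (psi (Fin 10)) a = quad (Fin 10) (S.C * raise S.gammaA a) := (quad_eq_bil _).symm

theorem vecH_psi (a : Fin 10) : S.vecH (psi (Fin 10)) a =
    quad (Fin 10) (S.C * raise (fun b => S.gammaA b * S.Γ 10) a) := (quad_eq_bil _).symm

theorem commute_vecA (a : Fin 10) (x : 𝒜) : Commute (S.vecA (psi (Fin 10)) a) x :=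
  S.vecA_psi a ▸ commute_quad _ x

theorem commute_vecH (a : Fin 10) (x : 𝒜) : Commute (S.vecH (psi (Fin 10)) a) x :=
  S.vecH_psi a ▸ commute_quad _ x

theorem realMat_gamma_ten_mul_slash {A : Type*} [Ring A] [Algebra ℝ A] (w : Fin 10 → A) :
    realMat A (S.Γ 10) * slash S.gammaA w = -(slash S.gammaA w * realMat A (S.Γ 10)) :=
  realMat_mul_slash_of_anticomm S.gamma_ten_mul_gammaA w

theorem bil_mul_slash_vecH (N : Matrix ι ι 𝒜) :
    bil (psi (Fin 10)) (N * slash S.gammaA (S.vecH (psi (Fin 10)))) = bil (psi (Fin 10))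
      (N * (realMat 𝒜 (S.Γ 10) * slash S.gammaA (S.vecA (psi (Fin 10))))) := by
  refine bil_mul_congr (commute_slash_apply _ S.commute_vecH) ?_ (S.slash_vecH_mul_eq psi_comm) N
  rw [realMat_mul_slash]
  exact commute_slash_apply _ S.commute_vecA

theorem isSymm_realMat_mul_slash {κ : Type*} [Fintype κ] {X : Matrix ι ι ℝ}
    {G : κ → Matrix ι ι ℝ} (hXG : ∀ a, (X * G a).IsSymm) {A : Type*} [Ring A] [Algebra ℝ A]
    (w : κ → A) : (realMat A X * slash G w).IsSymm := by
  rw [realMat_mul_slash]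
  exact Matrix.IsSymm.ext fun i j => by simp only [slash_apply, (hXG _).apply i j]

theorem psi_mul_slash_vecH (γ : ι) :
    ∑ α, psi (Fin 10) α * (realMat 𝒜 S.C * slash S.gammaA (S.vecH (psi (Fin 10)))) α γ =
      ∑ α, psi (Fin 10) α *
        (realMat 𝒜 (S.C * S.Γ 10) * slash S.gammaA (S.vecA (psi (Fin 10)))) α γ := by
  have symmH : ∀ a, (S.C * S.gammaA a).IsSymm := fun a => S.isSymm_C_mul_gamma a.castSucc
  have symmA : ∀ a, (S.C * S.Γ 10 * S.gammaA a).IsSymm := fun a =>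
    (mul_assoc S.C _ _).symm ▸ S.isSymm_C_mul_gamma_mul_gamma (Fin.castSucc_lt_last a).ne'
  have commH : ∀ i j x,
      Commute ((realMat 𝒜 S.C * slash S.gammaA (S.vecH (psi (Fin 10)))) i j) x := by
    rw [realMat_mul_slash]
    exact commute_slash_apply _ S.commute_vecH
  have commA : ∀ i j x,
      Commute ((realMat 𝒜 (S.C * S.Γ 10) * slash S.gammaA (S.vecA (psi (Fin 10)))) i j) x := by
    rw [realMat_mul_slash]
    exact commute_slash_apply _ S.commute_vecA
  have factor_C (Y : Matrix ι ι 𝒜) : ∑ α, (realMat 𝒜 S.C * Y) γ α * psi (Fin 10) α =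
      ∑ β, realMat 𝒜 S.C γ β * ∑ α, Y β α * psi (Fin 10) α := by
    simp only [Matrix.mul_apply, Finset.sum_mul, Finset.mul_sum, mul_assoc]
    exact Finset.sum_comm
  rw [psi_mul_eq_mul_psi_of_symm commH (isSymm_realMat_mul_slash symmH _),
    psi_mul_eq_mul_psi_of_symm commA (isSymm_realMat_mul_slash symmA _), map_mul, mul_assoc,
    factor_C, factor_C]
  simp only [S.slash_vecH_mul_eq psi_comm]

theorem bil_C_mul_slash_vecH_mul (N : Matrix ι ι 𝒜) :
    bil (psi (Fin 10)) (realMat 𝒜 S.C * slash S.gammaA (S.vecH (psi (Fin 10))) * N) =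
      bil (psi (Fin 10))
        (realMat 𝒜 (S.C * S.Γ 10) * slash S.gammaA (S.vecA (psi (Fin 10))) * N) :=
  bil_congr_mul psi_comm S.psi_mul_slash_vecH N

theorem bil_anticommutator_vecH {x : Matrix ι ι 𝒜}
    (hx : realMat 𝒜 (S.Γ 10) * x = -(x * realMat 𝒜 (S.Γ 10))) (n : ℕ) :
    bil (psi (Fin 10)) (realMat 𝒜 (S.C * S.Γ 10 ^ n) *
      (x * slash S.gammaA (S.vecH (psi (Fin 10))) +
        slash S.gammaA (S.vecH (psi (Fin 10))) * x)) =
    bil (psi (Fin 10)) (realMat 𝒜 (S.C * S.Γ 10 ^ (n + 1)) *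
      (slash S.gammaA (S.vecA (psi (Fin 10))) * x -
        x * slash S.gammaA (S.vecA (psi (Fin 10))))) := by
  have bil_mul_z := S.bil_mul_slash_vecH
  have bil_mul_z_mul := S.bil_C_mul_slash_vecH_mul
  have hy := S.realMat_gamma_ten_mul_slash (S.vecA (psi (Fin 10)))
  have hz := S.realMat_gamma_ten_mul_slash (S.vecH (psi (Fin 10)))
  simp only [map_mul, map_pow] at bil_mul_z_mul ⊢
  generalize realMat 𝒜 (S.Γ 10) = g at *
  generalize realMat 𝒜 S.C = c at *
  generalize slash S.gammaA (S.vecA (psi (Fin 10))) = y at *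
  generalize slash S.gammaA (S.vecH (psi (Fin 10))) = z at *
  have pow_mul_of_anticomm : ∀ w : Matrix ι ι 𝒜, g * w = -(w * g) → g ^ n * w = w * (-g) ^ n :=
    fun w hw => ((show SemiconjBy w (-g) g by rw [SemiconjBy, mul_neg, hw]).pow_right n).eq.symm
  have left_term : bil (psi (Fin 10)) (c * g ^ n * (x * z)) =
      -bil (psi (Fin 10)) (c * g ^ (n + 1) * (x * y)) := by
    rw [← mul_assoc, bil_mul_z, ← map_neg]
    congr 1
    rw [mul_assoc _ x, ← mul_assoc x, ← neg_neg (x * g), ← hx, neg_mul, mul_neg, pow_succ]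
    simp only [mul_assoc]
  have right_term : bil (psi (Fin 10)) (c * g ^ n * (z * x)) =
      bil (psi (Fin 10)) (c * g ^ (n + 1) * (y * x)) := by
    calc bil (psi (Fin 10)) (c * g ^ n * (z * x))
        = bil (psi (Fin 10)) (c * z * ((-g) ^ n * x)) := by
          rw [mul_assoc c, ← mul_assoc (g ^ n), pow_mul_of_anticomm z hz, mul_assoc z, mul_assoc c]
      _ = bil (psi (Fin 10)) (c * g * y * ((-g) ^ n * x)) := bil_mul_z_mul _
      _ = bil (psi (Fin 10)) (c * g ^ (n + 1) * (y * x)) := by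
          rw [← mul_assoc (c * g * y), mul_assoc (c * g) y, ← pow_mul_of_anticomm y hy, pow_succ']
          simp only [mul_assoc]
  rw [mul_add, map_add, left_term, right_term, mul_sub, map_sub, neg_add_eq_sub]

theorem gammaA_clifford (a b : Fin 10) :
    S.gammaA a * S.gammaA b + S.gammaA b * S.gammaA a = (2 * eta a b) • (1 : Matrix ι ι ℝ) := by
  rw [gammaA, gammaA, S.clifford]
  congr 2
  simp [eta]

theorem scalar_mul_slash_vec {θ : 𝒜} (hθ : θ ∈ GCAlg.homog (minkDeg ι (Fin 10)) (3, 0))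
    (G : Fin 10 → Matrix ι ι ℝ) :
    Matrix.scalar ι θ * slash G (vec ι) = -(slash G (vec ι) * Matrix.scalar ι θ) :=
  scalar_mul_slash_of_anticomm G fun a =>
    mul_anticomm_of_mem_odd (by decide) odd_one hθ (vec_mem a)

theorem two_smul_H3A :
    ∑ a, ∑ b, (2 * eta a b) • (S.vecH (psi (Fin 10)) b * vec ι a) = (2 : ℝ) • S.H3A := by
  rw [H3A, Finset.smul_sum]
  refine Finset.sum_congr rfl fun a _ => ?_
  rw [Finset.sum_eq_single a (fun b _ hb => by rw [eta, if_neg hb.symm, mul_zero, zero_smul])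
    (by simp), vecH_psi, raise_eq_eta_smul, mul_smul_comm, quad_smul, smul_mul_assoc, smul_smul,
    mul_assoc, eta_self_mul_self, mul_one]
  rfl

theorem slash_vec_anticommutator_vecH :
    slash S.gammaA (vec ι) * slash S.gammaA (S.vecH (psi (Fin 10))) +
      slash S.gammaA (S.vecH (psi (Fin 10))) * slash S.gammaA (vec ι) =
    Matrix.scalar ι ((2 : ℝ) • S.H3A) := by
  rw [slash_anticommutator S.gammaA_clifford _ S.commute_vecH, two_smul_H3A]

theorem d_slash_pow (n : ℕ) : S.IIA.d.mapMatrix (slash S.gammaA (vec ι) ^ (2 * (n + 1))) =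
    (n + 1) • (slash S.gammaA (S.vecA (psi (Fin 10))) * slash S.gammaA (vec ι) ^ (2 * n + 1) -
      slash S.gammaA (vec ι) ^ (2 * n + 1) * slash S.gammaA (S.vecA (psi (Fin 10)))) := by
  refine twistedDerivation_even_pow
    (slash_anticommutator S.gammaA_clifford _ S.commute_vecA)
    (scalar_mul_slash_vec (sum_mem fun a _ => sum_mem fun b _ =>
      Submodule.smul_mem _ _ (mul_vec_mem (S.vecA_psi b ▸ quad_mem _) a)) _)
    (S.IIA.d_mapMatrix_one) (fun M => ?_) n
  rw [funext S.vecA_psi]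
  exact d_mapMatrix_vec_slash_mul _ _ M

theorem d_fluxA_succ_eq_smul (n : ℕ) :
    S.IIA.d (S.fluxA (n + 1)) = ((2 * (n + 1)).factorial : ℝ)⁻¹ • (n + 1) •
      bil (psi (Fin 10)) (realMat 𝒜 (S.C * S.Γ 10 ^ (n + 2)) *
        (slash S.gammaA (S.vecA (psi (Fin 10))) * slash S.gammaA (vec ι) ^ (2 * n + 1) -
          slash S.gammaA (vec ι) ^ (2 * n + 1) * slash S.gammaA (S.vecA (psi (Fin 10))))) := by
  rw [fluxA, map_smul, d_bil, d_mapMatrix_realMat_mul, d_slash_pow, mul_smul_comm, map_nsmul]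

theorem smul_H3A_mul_fluxA (n : ℕ) :
    (2 * (2 * n + 1) : ℝ) • (S.H3A * S.fluxA n) = ((2 * n).factorial : ℝ)⁻¹ •
      bil (psi (Fin 10)) (realMat 𝒜 (S.C * S.Γ 10 ^ (n + 1)) *
        (slash S.gammaA (vec ι) ^ (2 * n + 1) * slash S.gammaA (S.vecH (psi (Fin 10))) +
          slash S.gammaA (S.vecH (psi (Fin 10))) * slash S.gammaA (vec ι) ^ (2 * n + 1))) := by
  have hpow := pow_succ_mul_of_anticomm S.slash_vec_anticommutator_vecH
    (scalar_mul_slash_vec (Submodule.smul_mem _ _ S.H3A_mem) _) (2 * n)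
  rw [Odd.neg_one_pow ⟨n, rfl⟩, neg_one_mul, neg_sub] at hpow
  rw [hpow, sub_add_cancel, mul_smul_comm, map_nsmul, ← mul_assoc, ← scalar_mul_realMat, mul_assoc,
    bil_scalar_mul fun α β => commute_psi_mul_psi α β _, fluxA, smul_mul_assoc, mul_smul_comm,
    ← Nat.cast_smul_eq_nsmul ℝ, smul_smul, smul_smul, smul_smul]
  congr 1
  push_cast
  ring

theorem d_fluxA_succ (n : ℕ) : S.IIA.d (S.fluxA (n + 1)) = S.H3A * S.fluxA n := by
  have hd := S.d_fluxA_succ_eq_smul n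
  have hmul := S.smul_H3A_mul_fluxA n
  rw [S.bil_anticommutator_vecH
    (mul_odd_pow_of_anticomm (S.realMat_gamma_ten_mul_slash _) n)] at hmul
  have hn : (2 * (2 * n + 1) : ℝ) ≠ 0 := by positivity
  have hfact : ((2 * (n + 1)).factorial : ℝ)⁻¹ * (n + 1) =
      (2 * (2 * n + 1) : ℝ)⁻¹ * ((2 * n).factorial : ℝ)⁻¹ := by
    rw [show 2 * (n + 1) = 2 * n + 1 + 1 by ring, Nat.factorial_succ, Nat.factorial_succ]
    push_cast
    field_simp
    ring
  rw [hd, ← inv_smul_smul₀ hn (S.H3A * S.fluxA n), hmul, smul_smul, ← hfact, mul_smul]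
  congr 1
  rw [← Nat.cast_smul_eq_nsmul ℝ, Nat.cast_succ]

theorem d_fluxA_zero : S.IIA.d (S.fluxA 0) = 0 := by
  rw [fluxA, map_smul, d_bil, d_mapMatrix_realMat_mul, mul_zero, pow_zero, d_mapMatrix_one,
    mul_zero, map_zero, smul_zero]

theorem d_FA (k : ℤ) : S.IIA.d (S.FA k) = S.H3A * S.FA (k - 1) := by
  rcases le_or_gt k 0 with hk | hk
  · rw [S.FA_of_nonpos hk, S.FA_of_nonpos (by omega), map_zero, mul_zero]
  · obtain ⟨n, rfl⟩ : ∃ n : ℕ, k = n + 1 := ⟨(k - 1).toNat, by omega⟩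
    rw [add_sub_cancel_right, FA_succ]
    cases n with
    | zero => rw [d_fluxA_zero, S.FA_of_nonpos (by simp), mul_zero]
    | succ n => rw [d_fluxA_succ, Nat.cast_succ, FA_succ]

theorem d_H3A_eq_sum :
    S.IIA.d S.H3A = ∑ a, quad (Fin 10) (S.C * (S.gammaA a * S.Γ 10)) * S.vecA (psi (Fin 10)) a := by
  rw [H3A, map_sum]
  refine Finset.sum_congr rfl fun a _ => ?_
  have hd : S.IIA.d (quad (Fin 10) (S.C * (S.gammaA a * S.Γ 10))) = 0 := gradedDer_quad _ _
  change S.IIA.d (quad (Fin 10) (S.C * (S.gammaA a * S.Γ 10)) * vec ι a) = _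
  rw [S.IIA.d_mul (quad_mem _), hd, d_vec, vecA_psi, koszul_two, one_smul, zero_mul, zero_add]

theorem d_H3A : S.IIA.d S.H3A = 0 := by
  have hswap := S.bil_C_mul_slash_vecH_mul 1
  rw [mul_one, mul_one, realMat_mul_slash, realMat_mul_slash, bil_slash, bil_slash] at hswap
  apply eq_zero_of_eq_neg
  calc S.IIA.d S.H3A
      = ∑ a, quad (Fin 10) (S.C * (S.gammaA a * S.Γ 10)) * S.vecA (psi (Fin 10)) a :=
        S.d_H3A_eq_sum
    _ = ∑ a, quad (Fin 10) (S.C * S.gammaA a) * S.vecH (psi (Fin 10)) a := by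
        refine Finset.sum_congr rfl fun a _ => ?_
        rw [vecA_psi, vecH_psi, raise_eq_eta_smul, raise_eq_eta_smul, mul_smul_comm, mul_smul_comm,
          quad_smul, quad_smul, mul_smul_comm, mul_smul_comm, (commute_quad _ _).eq]
    _ = ∑ a, quad (Fin 10) (S.C * S.Γ 10 * S.gammaA a) * S.vecA (psi (Fin 10)) a := hswap
    _ = -S.IIA.d S.H3A := by
        rw [d_H3A_eq_sum, ← Finset.sum_neg_distrib]
        refine Finset.sum_congr rfl fun a _ => ?_
        rw [mul_assoc, gamma_ten_mul_gammaA, mul_neg, ← neg_one_smul ℝ, quad_smul, neg_one_smul,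
          neg_mul]

end Majorana11

/-! ### The type IIB fluxes as powers of the vielbein matrix -/

section

variable {ι : Type}

local notation "𝒜" => GCAlg (minkDeg ι (Fin 10))

/-- The form generators `e^a` with `e⁹` replaced by zero. -/
def eBasic (a : Fin 10) : 𝒜 := if a = 9 then 0 else vec ι a

theorem eBasic_mem (a : Fin 10) : eBasic a ∈ GCAlg.homog (minkDeg ι (Fin 10)) (1, 0) := by
  rw [eBasic]
  split_ifs
  · exact zero_mem _
  · exact vec_mem a

theorem eBasic_anticomm (a b : Fin 10) : (eBasic a : 𝒜) * eBasic b = -(eBasic b * eBasic a) :=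
  mul_anticomm_of_mem_odd odd_one odd_one (eBasic_mem a) (eBasic_mem b)

theorem eBasic_mul_self (a : Fin 10) : (eBasic a : 𝒜) * eBasic a = 0 :=
  eq_zero_of_eq_neg (eBasic_anticomm a a)

theorem prod_map_eBasic (l : List (Fin 10)) :
    (l.map (eBasic (ι := ι))).prod = if (9 : Fin 10) ∈ l then 0 else (l.map (vec ι)).prod := by
  induction l with
  | nil => simp
  | cons b l ih =>
    rw [List.map_cons, List.prod_cons, ih]
    by_cases hb : b = 9
    · simp [hb, eBasic]
    · by_cases hl : (9 : Fin 10) ∈ l <;> simp [hb, hl, eBasic, Ne.symm hb]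

end

namespace Majorana11

variable {ι : Type} [Fintype ι] [DecidableEq ι] (S : Majorana11 ι)

local notation "𝒜" => GCAlg (minkDeg ι (Fin 10))

theorem gammaB_castSucc (a : Fin 9) : S.gammaB a.castSucc = S.gamma9 a :=
  if_neg (Fin.castSucc_lt_last a).ne

theorem gammaB_of_ne {a : Fin 10} (ha : a ≠ 9) : S.gammaB a = S.gammaA a := if_neg ha

theorem gammaB_nine : S.gammaB 9 = S.gammaA 9 * S.Γ 10 := rfl

/- Only `Γᴮ₉` differs from `Γ₉`, by a factor `Γ₁₀` on the right, and it comes last in an increasing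
product. -/
theorem prod_map_gammaB {l : List (Fin 10)} (hl : l.Pairwise (· < ·)) :
    (l.map S.gammaB).prod = (l.map S.gammaA).prod * if (9 : Fin 10) ∈ l then S.Γ 10 else 1 := by
  induction l with
  | nil => simp
  | cons b l ih =>
    obtain ⟨hbl, hl⟩ := List.pairwise_cons.mp hl
    rw [List.map_cons, List.map_cons, List.prod_cons, List.prod_cons]
    rcases eq_or_ne b 9 with rfl | hb
    · obtain rfl : l = [] := List.eq_nil_iff_forall_not_mem.mpr fun c hc =>
        (hbl c hc).not_ge (Fin.le_last c)
      simp [gammaB_nine]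
    · simp only [ih hl, gammaB_of_ne S hb, mul_assoc, List.mem_cons, hb.symm, false_or]

open Classical in
theorem gammaBs_eq {p : ℕ} {a : Fin p → Fin 10} (ha : Function.Injective a) :
    S.gammaBs a = (List.ofFn fun i => S.gammaA (a i)).prod *
      if ∃ i, a i = 9 then S.Γ 10 else 1 := by
  have hmono : StrictMono (a ∘ Tuple.sort a) :=
    (Tuple.monotone_sort a).strictMono_of_injective (ha.comp (Tuple.sort a).injective)
  have hprod := S.prod_map_gammaB (l := List.ofFn (a ∘ Tuple.sort a))
    (List.pairwise_ofFn.mpr fun i j hij => hmono hij)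
  have hmem : (9 : Fin 10) ∈ List.ofFn (a ∘ Tuple.sort a) ↔ ∃ i, a i = 9 := by
    rw [List.mem_ofFn]
    exact (Tuple.sort a).exists_congr_left.trans (by simp)
  rw [List.map_ofFn, List.map_ofFn] at hprod
  simp only [hmem] at hprod
  rw [gammaBs, if_pos ha, Int.cast_smul_eq_zsmul,
    ← sign_smul_prod_ofFn_perm (fun _ _ hab => S.gammaA_anticomm hab) (Tuple.sort a) ha,
    smul_mul_assoc]
  exact congrArg _ hprod

/-- The matrix `∑ Γᴮ_{a₁ ⋯ a_p} e^{a₁} ⋯ e^{a_p}`: the summands of the `p`-th power of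
`e^a Γ_a` that contain `e⁹` are multiplied by `Γ_10`. -/
def vielBPow (p : ℕ) : Matrix ι ι 𝒜 := slash S.gammaA eBasic ^ p +
  (slash S.gammaA (vec ι) ^ p - slash S.gammaA eBasic ^ p) * realMat 𝒜 (S.Γ 10)

open Classical in
theorem vielBPow_eq_sum (p : ℕ) : S.vielBPow p = ∑ a : Fin p → Fin 10,
    Matrix.scalar ι (List.ofFn fun i => vec ι (a i)).prod *
      realMat 𝒜 ((List.ofFn fun i => S.gammaA (a i)).prod *
        if ∃ i, a i = 9 then S.Γ 10 else 1) := by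
  rw [vielBPow, slash_pow, slash_pow, ← Finset.sum_sub_distrib, Finset.sum_mul,
    ← Finset.sum_add_distrib]
  refine Finset.sum_congr rfl fun a _ => ?_
  have hbasic := prod_map_eBasic (ι := ι) (List.ofFn a)
  rw [List.map_ofFn, List.map_ofFn] at hbasic
  simp only [List.mem_ofFn] at hbasic
  simp only [Function.comp_def] at hbasic ⊢
  rw [hbasic, map_mul]
  split_ifs
  · simp only [map_zero, zero_mul, zero_add, sub_zero, mul_assoc]
  · simp only [sub_self, zero_mul, add_zero, map_one, mul_one]

theorem form_gammaBs (p : ℕ) (X : Matrix ι ι ℝ) :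
    S.form p (fun a => S.gammaBs a * X) = (p.factorial : ℝ)⁻¹ •
      bil (psi (Fin 10)) (realMat 𝒜 S.C * S.vielBPow p * realMat 𝒜 X) := by
  rw [S.form_congr p fun a ha => congrArg (· * X) (S.gammaBs_eq ha), form_eq_bil,
    vielBPow_eq_sum, Finset.mul_sum, Finset.sum_mul]
  congr 2
  refine Finset.sum_congr rfl fun a _ => ?_
  rw [← scalar_mul_realMat, ← mul_assoc (realMat 𝒜 S.C), ← scalar_mul_realMat]
  simp only [map_mul, mul_assoc]

/-- The flux `F_{2n+3} = (1/(2n+1)!) (ψ̄ Γᴮ_{a₁ ⋯ a_{2n+1}} Γ_9 Γ_10^n ψ) e^{a₁} ⋯ e^{a_{2n+1}}`,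
expressed through powers of vielbein matrices. -/
def fluxB (n : ℕ) : 𝒜 := ((2 * n + 1).factorial : ℝ)⁻¹ • bil (psi (Fin 10))
  (realMat 𝒜 S.C * S.vielBPow (2 * n + 1) * realMat 𝒜 (S.Γ 9 * S.Γ 10 ^ n))

theorem fluxB_of_lt {n : ℕ} (hn : 4 < n) : S.fluxB n = 0 := by
  have hp : Fintype.card (Fin 10) < 2 * n + 1 := by rw [Fintype.card_fin]; omega
  rw [fluxB, vielBPow, slash_pow_eq_zero vec_anticomm vec_mul_self _ hp,
    slash_pow_eq_zero eBasic_anticomm eBasic_mul_self _ hp]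
  simp only [sub_self, zero_mul, add_zero, mul_zero, map_zero, smul_zero]

theorem form_odd_gammaBs (n : ℕ) :
    S.form (2 * n + 1) (fun a => S.gammaBs a * (S.Γ 9 * S.Γ 10 ^ n)) = S.fluxB n :=
  S.form_gammaBs _ _

theorem FB_succ (n : ℕ) : S.FB (n + 1) = S.fluxB n := by
  rcases Nat.lt_or_ge n 5 with hn | hn
  · have hform := S.form_odd_gammaBs n
    interval_cases n
    all_goals simpa [FB, gamma_ten_pow_add_two] using hform
  · have hne : ∀ k : ℤ, k ≤ 5 → (n : ℤ) + 1 ≠ k := fun k hk => by omega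
    rw [S.fluxB_of_lt (by omega), FB]
    simp only [hne 1 (by norm_num), hne 2 (by norm_num), hne 3 (by norm_num), hne 4 (by norm_num),
      hne 5 (by norm_num), if_false]

theorem FB_of_nonpos {k : ℤ} (hk : k ≤ 0) : S.FB k = 0 := by
  have hne : ∀ j : ℤ, 1 ≤ j → k ≠ j := fun j hj => by omega
  simp only [FB, hne 1 (by norm_num), hne 2 (by norm_num), hne 3 (by norm_num),
    hne 4 (by norm_num), hne 5 (by norm_num), if_false]

theorem vielBPow_mem (p : ℕ) (i j : ι) :
    S.vielBPow p i j ∈ GCAlg.homog (minkDeg ι (Fin 10)) (p, 0) :=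
  have hbasic := slash_pow_mem S.gammaA (eBasic_mem (ι := ι)) p
  add_mem (hbasic i j) (mul_realMat_mem (fun k l =>
    sub_mem (slash_pow_mem S.gammaA (vec_mem (ι := ι)) p k l) (hbasic k l)) _ i j)

theorem FB_mem (k : ℤ) : S.FB k ∈ S.IIB.homog (2 * k + 1, 0) := by
  rcases le_or_gt k 0 with hk | hk
  · rw [S.FB_of_nonpos hk]
    exact zero_mem _
  · obtain ⟨n, rfl⟩ : ∃ n : ℕ, k = n + 1 := ⟨(k - 1).toNat, by omega⟩
    have hbil := bil_mem _ (mul_realMat_mem (realMat_mul_mem S.C (S.vielBPow_mem (2 * n + 1)))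
      (S.Γ 9 * S.Γ 10 ^ n))
    rw [FB_succ, fluxB,
      show 2 * ((n : ℤ) + 1) + 1 = ((2 * n + 1 : ℕ) : ℤ) + 2 by push_cast; ring]
    exact Submodule.smul_mem _ _ hbil

theorem H3B_mem : S.H3B ∈ S.IIB.homog (3, 0) :=
  sum_mem fun a _ => mul_vec_mem (quad_mem _) a

end Majorana11

/-! ### Splitting off the tenth dimension -/

/-- An algebra of forms `basic + fiber · basic`, for an odd element `fiber`, receiving the forms in
ten dimensions such that `e⁹` goes to `fiber`. For the types IIA and IIB it is given by a central
extension of the nine-dimensional algebra. -/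
structure FiberSplit (ι : Type) (R : Type*) [Ring R] [Algebra ℝ R] where
  total : GCAlg (minkDeg ι (Fin 10)) →ₐ[ℝ] R
  basic : GCAlg (minkDeg ι (Fin 9)) →ₐ[ℝ] R
  fiber : R
  total_psi (α : ι) : total (psi (Fin 10) α) = basic (psi (Fin 9) α)
  total_vec_castSucc (a : Fin 9) : total (vec ι a.castSucc) = basic (vec ι a)
  total_vec_last : total (vec ι (Fin.last 9)) = fiber
  fiber_mul_self : fiber * fiber = 0
  fiber_mul_basic_vec (a : Fin 9) : fiber * basic (vec ι a) = -(basic (vec ι a) * fiber)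
  commute_fiber (α β : ι) : Commute fiber (basic (psi (Fin 9) α * psi (Fin 9) β))

/-- The splitting given by a map to a central extension that sends `e⁹` to the new generator. -/
def extSplit {ι : Type} [Fintype ι] {K' : Fin 9 → Matrix ι ι ℝ}
    (φ : GCAlg (minkDeg ι (Fin 10)) →ₐ[ℝ] GCAlg (superMink K').extDeg)
    (hpsi : ∀ α, φ (psi (Fin 10) α) = GCAlg.gen (superMink K').extDeg (some (.inl α)))
    (hcast : ∀ a : Fin 9,
      φ (vec ι a.castSucc) = GCAlg.gen (superMink K').extDeg (some (.inr a)))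
    (hlast : φ (vec ι (Fin.last 9)) = GCAlg.gen (superMink K').extDeg none) :
    FiberSplit ι (GCAlg (superMink K').extDeg) where
  total := φ
  basic := (superMink K').basicIncl
  fiber := GCAlg.gen (superMink K').extDeg none
  total_psi α := (hpsi α).trans (basicIncl_gen (g := superMink K') (.inl α)).symm
  total_vec_castSucc a := (hcast a).trans (basicIncl_gen (g := superMink K') (.inr a)).symm
  total_vec_last := hlast
  fiber_mul_self := new_gen_mul_self
  fiber_mul_basic_vec a := mul_anticomm_of_mem_odd odd_one odd_one
    (gen_mem (deg := (superMink K').extDeg) none) ((superMink K').basicIncl_mem (vec_mem a))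
  commute_fiber α β :=
    (commute_of_mem_two ((superMink K').basicIncl_mem (psi_mul_psi_mem α β)) _).symm

namespace FiberSplit

variable {ι : Type} [Fintype ι] [DecidableEq ι] {R : Type*} [Ring R] [Algebra ℝ R]
  (P : FiberSplit ι R)

local notation "𝒜" => GCAlg (minkDeg ι (Fin 10))
local notation "ℬ" => GCAlg (minkDeg ι (Fin 9))

/-- `M = A + e⁹ B` with `A` and `B` not containing `e⁹`, for matrices of forms. -/
def HasParts (M : Matrix ι ι 𝒜) (A B : Matrix ι ι ℬ) : Prop :=
  P.total.mapMatrix M =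
    P.basic.mapMatrix A + Matrix.scalar ι P.fiber * P.basic.mapMatrix B

section

variable {P} {M M' : Matrix ι ι (GCAlg (minkDeg ι (Fin 10)))}
  {A A' B B' : Matrix ι ι (GCAlg (minkDeg ι (Fin 9)))}

theorem HasParts.add (hM : P.HasParts M A B) (hM' : P.HasParts M' A' B') :
    P.HasParts (M + M') (A + A') (B + B') := by
  rw [HasParts, map_add, map_add, map_add, hM, hM', mul_add]
  abel

theorem HasParts.sub (hM : P.HasParts M A B) (hM' : P.HasParts M' A' B') :
    P.HasParts (M - M') (A - A') (B - B') := by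
  rw [HasParts, map_sub, map_sub, map_sub, hM, hM', mul_sub]
  abel

theorem HasParts.realMat_mul (X : Matrix ι ι ℝ) (hM : P.HasParts M A B) :
    P.HasParts (realMat 𝒜 X * M) (realMat ℬ X * A) (realMat ℬ X * B) := by
  rw [HasParts, map_mul, map_mul, map_mul, hM, mapMatrix_realMat, mapMatrix_realMat, mul_add,
    ← mul_assoc, ← mul_assoc, scalar_mul_realMat]

theorem HasParts.mul_realMat (hM : P.HasParts M A B) (X : Matrix ι ι ℝ) :
    P.HasParts (M * realMat 𝒜 X) (A * realMat ℬ X) (B * realMat ℬ X) := by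
  rw [HasParts, map_mul, map_mul, map_mul, hM, mapMatrix_realMat, mapMatrix_realMat, add_mul,
    mul_assoc]

theorem HasParts.total_bil (hM : P.HasParts M A B) :
    P.total (bil (psi (Fin 10)) M) =
      P.basic (bil (psi (Fin 9)) A) + P.fiber * P.basic (bil (psi (Fin 9)) B) := by
  have hcomm (α β : ι) : Commute P.fiber (P.basic (psi (Fin 9) α) * P.basic (psi (Fin 9) β)) := by
    simpa only [map_mul] using P.commute_fiber α β
  simp only [map_bil, P.total_psi]
  rw [hM, map_add, bil_scalar_mul hcomm]

end

theorem hasParts_one : P.HasParts 1 1 0 := by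
  rw [HasParts, map_one, map_one, map_zero, mul_zero, add_zero]

variable (G : Fin 10 → Matrix ι ι ℝ)

theorem hasParts_slash :
    P.HasParts (slash G (vec ι)) (slash (fun a : Fin 9 => G a.castSucc) (vec ι))
      (realMat ℬ (G (Fin.last 9))) := by
  rw [HasParts, mapMatrix_slash, mapMatrix_slash, mapMatrix_realMat, slash, slash,
    Fin.sum_univ_castSucc, P.total_vec_last]
  simp only [P.total_vec_castSucc]

theorem hasParts_slash_eBasic_pow (n : ℕ) :
    P.HasParts (slash G eBasic ^ n) (slash (fun a : Fin 9 => G a.castSucc) (vec ι) ^ n) 0 := by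
  have hcast (a : Fin 9) : eBasic a.castSucc = vec ι a.castSucc :=
    if_neg (Fin.castSucc_lt_last a).ne
  have hlast : eBasic (ι := ι) (Fin.last 9) = 0 := if_pos rfl
  rw [HasParts, map_pow, map_pow, mapMatrix_slash, mapMatrix_slash, slash, slash,
    Fin.sum_univ_castSucc, hlast]
  simp only [hcast, P.total_vec_castSucc, map_zero, zero_mul, mul_zero, add_zero]

variable {G}

/-- The two summands of `e^a G_a = basic + e⁹ G_9` commute, and the second squares to zero. -/
theorem hasParts_slash_pow_succ
    (hG : ∀ a : Fin 9, G (Fin.last 9) * G a.castSucc = -(G a.castSucc * G (Fin.last 9))) (n : ℕ) :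
    P.HasParts (slash G (vec ι) ^ (n + 1)) (slash (fun a : Fin 9 => G a.castSucc) (vec ι) ^ (n + 1))
      ((n + 1) • (realMat ℬ (G (Fin.last 9)) *
        slash (fun a : Fin 9 => G a.castSucc) (vec ι) ^ n)) := by
  have hsplit := P.hasParts_slash G
  rw [HasParts, mapMatrix_realMat] at hsplit
  set θ := Matrix.scalar ι P.fiber with hθ
  set g := realMat R (G (Fin.last 9))
  set y := P.basic.mapMatrix (slash (fun a : Fin 9 => G a.castSucc) (vec ι)) with hy
  have hθg : θ * g = g * θ := scalar_mul_realMat _ _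
  have hθy : θ * y = -(y * θ) := by
    rw [hy, mapMatrix_slash]
    exact scalar_mul_slash_of_anticomm _ P.fiber_mul_basic_vec
  have hgy : g * y = -(y * g) := by
    rw [hy, mapMatrix_slash]
    exact realMat_mul_slash_of_anticomm hG _
  have hcomm : Commute y (θ * g) := by
    rw [Commute, SemiconjBy, mul_assoc, hgy, mul_neg, ← mul_assoc θ, hθy, neg_mul, neg_neg,
      mul_assoc]
  have hsq : θ * g * (θ * g) = 0 := by
    rw [← mul_assoc, mul_assoc θ, ← hθg, ← mul_assoc, hθ, ← map_mul, P.fiber_mul_self, map_zero,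
      zero_mul, zero_mul]
  rw [HasParts, map_pow, hsplit, add_pow_of_mul_self_eq_zero hcomm hsq, map_pow, map_nsmul,
    map_mul, map_pow, mapMatrix_realMat, mul_smul_comm, mul_assoc]

end FiberSplit

theorem FiberSplit.total_sum_quad_mul_vec {ι : Type} [Fintype ι] {R : Type*} [Ring R] [Algebra ℝ R]
    (P : FiberSplit ι R) (G : Fin 10 → Matrix ι ι ℝ) :
    P.total (∑ a, quad (Fin 10) (G a) * vec ι a) =
      P.basic (∑ a : Fin 9, quad (Fin 9) (G a.castSucc) * vec ι a) +
        P.fiber * P.basic (quad (Fin 9) (G (Fin.last 9))) := by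
  classical
  simpa only [bil_slash, ← quad_eq_bil] using (P.hasParts_slash G).total_bil

namespace Majorana11

variable {ι : Type} [Fintype ι] [DecidableEq ι] (S : Majorana11 ι)

local notation "ℬ" => GCAlg (minkDeg ι (Fin 9))

/-! ### Reduction of the fluxes to nine dimensions -/

/-- The matrix `∑ Γ_a e^a` in nine dimensions. -/
abbrev vielbein9 : Matrix ι ι ℬ := slash S.gamma9 (vec ι)

/-- The part of `H₃ᴬ` and of `H₃ᴮ` that does not contain `e⁹`. -/
def basicH : S.dim9.CE := ∑ a, S.pair (Fin 9) (S.gamma9 a * S.Γ 10) * vec ι a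

/-- The part of the type IIA flux `F_{2n+2}` that does not contain `e⁹`. -/
def basicA (n : ℕ) : S.dim9.CE := ((2 * n).factorial : ℝ)⁻¹ •
  bil (psi (Fin 9)) (realMat ℬ (S.C * S.Γ 10 ^ (n + 1)) * S.vielbein9 ^ (2 * n))

/-- The coefficient of `e⁹` in the type IIA flux `F_{2n+4}`. -/
def fiberA (n : ℕ) : S.dim9.CE := ((2 * n + 1).factorial : ℝ)⁻¹ •
  bil (psi (Fin 9)) (realMat ℬ (S.C * (S.Γ 10 ^ n * S.Γ 9)) * S.vielbein9 ^ (2 * n + 1))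

theorem basicH_mem : S.basicH ∈ S.dim9.homog (3, 0) :=
  sum_mem fun a _ => mul_vec_mem (quad_mem _) a

theorem basicA_mem (n : ℕ) : S.basicA n ∈ S.dim9.homog (2 * (n + 1), 0) := by
  rw [basicA, show 2 * ((n : ℤ) + 1) = ((2 * n : ℕ) : ℤ) + 2 by push_cast; ring]
  exact Submodule.smul_mem _ _ (bil_mem _ (realMat_mul_mem _ (slash_pow_mem _ vec_mem _)))

theorem fiberA_mem (n : ℕ) : S.fiberA n ∈ S.dim9.homog (2 * (n + 1) + 1, 0) := by
  rw [fiberA, show 2 * ((n : ℤ) + 1) + 1 = ((2 * n + 1 : ℕ) : ℤ) + 2 by push_cast; ring]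
  exact Submodule.smul_mem _ _ (bil_mem _ (realMat_mul_mem _ (slash_pow_mem _ vec_mem _)))

theorem gamma_nine_sq : S.Γ 9 * S.Γ 9 = 1 := by
  rw [gamma_sq, show eta (9 : Fin 11) 9 = 1 from by simp [eta], one_smul]

theorem gamma_nine_mul_gamma9 (a : Fin 9) : S.Γ 9 * S.gamma9 a = -(S.gamma9 a * S.Γ 9) :=
  S.gammaA_anticomm (Fin.castSucc_lt_last a).ne'

theorem gamma_ten_mul_gamma9 (a : Fin 9) : S.Γ 10 * S.gamma9 a = -(S.gamma9 a * S.Γ 10) :=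
  S.gamma_ten_mul_gammaA a.castSucc

theorem gamma_ten_mul_gamma_nine : S.Γ 10 * S.Γ 9 = -(S.Γ 9 * S.Γ 10) :=
  S.gamma_ten_mul_gammaA (Fin.last 9)

theorem realMat_gamma_nine_mul_vielbein9 :
    realMat ℬ (S.Γ 9) * S.vielbein9 = -(S.vielbein9 * realMat ℬ (S.Γ 9)) :=
  realMat_mul_slash_of_anticomm S.gamma_nine_mul_gamma9 _

theorem realMat_gamma_ten_mul_vielbein9 :
    realMat ℬ (S.Γ 10) * S.vielbein9 = -(S.vielbein9 * realMat ℬ (S.Γ 10)) :=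
  realMat_mul_slash_of_anticomm S.gamma_ten_mul_gamma9 _

theorem realMat_gamma_ten_mul_gamma_nine :
    realMat ℬ (S.Γ 10) * realMat ℬ (S.Γ 9) = -(realMat ℬ (S.Γ 9) * realMat ℬ (S.Γ 10)) := by
  rw [← map_mul, ← map_mul, ← map_neg, gamma_ten_mul_gamma_nine]

theorem vielbein9_odd_pow_mul (n : ℕ) :
    S.vielbein9 ^ (2 * n + 1) * realMat ℬ (S.Γ 9 * S.Γ 10 ^ n) =
      -(realMat ℬ (S.Γ 10 ^ n * S.Γ 9) * S.vielbein9 ^ (2 * n + 1)) := by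
  have hg := mul_odd_pow_of_anticomm S.realMat_gamma_nine_mul_vielbein9 n
  have hh := mul_odd_pow_of_anticomm S.realMat_gamma_ten_mul_vielbein9 n
  have hgh := S.realMat_gamma_ten_mul_gamma_nine
  simp only [map_mul, map_pow]
  generalize S.vielbein9 ^ (2 * n + 1) = y at *
  generalize realMat ℬ (S.Γ 9) = g at *
  generalize realMat ℬ (S.Γ 10) = h at *
  have hyh : SemiconjBy y h (-h) := by rw [SemiconjBy, neg_mul, hh, neg_neg]
  have hg_neg : SemiconjBy g (-h) h := by rw [SemiconjBy, mul_neg, hgh]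
  rw [← mul_assoc, ← neg_neg (y * g), ← hg, neg_mul, mul_assoc, (hyh.pow_right n).eq, ← mul_assoc,
    (hg_neg.pow_right n).eq]

theorem gamma_nine_mul_vielbein9_even_pow_mul (n : ℕ) :
    realMat ℬ (S.Γ 9) * S.vielbein9 ^ (2 * n) * realMat ℬ (S.Γ 10) *
        realMat ℬ (S.Γ 9 * S.Γ 10 ^ n) =
      -(realMat ℬ (S.Γ 10 ^ (n + 1)) * S.vielbein9 ^ (2 * n)) := by
  have hg := commute_even_pow_of_anticomm S.realMat_gamma_nine_mul_vielbein9 n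
  have hh := (commute_even_pow_of_anticomm S.realMat_gamma_ten_mul_vielbein9 n).pow_left (n + 1)
  have hghg : realMat ℬ (S.Γ 9) * realMat ℬ (S.Γ 10) * realMat ℬ (S.Γ 9) = -realMat ℬ (S.Γ 10) := by
    rw [mul_assoc, realMat_gamma_ten_mul_gamma_nine, mul_neg, ← mul_assoc, ← map_mul (realMat ℬ),
      gamma_nine_sq, map_one, one_mul]
  rw [hg.eq, map_mul, map_pow, map_pow, hh.eq, ← mul_assoc, mul_assoc (S.vielbein9 ^ (2 * n)),
    mul_assoc (S.vielbein9 ^ (2 * n)), hghg, mul_neg, neg_mul, mul_assoc, pow_succ']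

section

variable {R : Type*} [Ring R] [Algebra ℝ R] (P : FiberSplit ι R)

theorem total_fluxA_zero : P.total (S.fluxA 0) = P.basic (S.basicA 0) := by
  have hparts := (P.hasParts_one.realMat_mul (S.C * S.Γ 10 ^ (0 + 1))).total_bil
  rw [fluxA, basicA, mul_zero, pow_zero, pow_zero, map_smul, map_smul, hparts, mul_zero, map_zero,
    map_zero, mul_zero, add_zero]

theorem total_fluxA_succ (n : ℕ) : P.total (S.fluxA (n + 1)) =
    P.basic (S.basicA (n + 1)) + P.fiber * P.basic (S.fiberA n) := by
  have hparts := ((P.hasParts_slash_pow_succ (G := S.gammaA) S.gamma_nine_mul_gamma9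
    (2 * n + 1)).realMat_mul (S.C * S.Γ 10 ^ (n + 1 + 1))).total_bil
  rw [mul_smul_comm, map_nsmul, map_nsmul, mul_smul_comm, ← mul_assoc, ← map_mul,
    mul_assoc S.C, gamma_ten_pow_add_two] at hparts
  rw [fluxA, basicA, fiberA, map_smul, map_smul, map_smul, mul_smul_comm, gamma_ten_pow_add_two,
    show 2 * (n + 1) = 2 * n + 1 + 1 from rfl, hparts, smul_add, succ_smul_inv_factorial_smul]
  rfl

theorem hasParts_vielBPow_succ (n : ℕ) :
    P.HasParts (S.vielBPow (n + 1)) (S.vielbein9 ^ (n + 1))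
      ((n + 1) • (realMat ℬ (S.Γ 9) * S.vielbein9 ^ n * realMat ℬ (S.Γ 10))) := by
  have hbasic := P.hasParts_slash_eBasic_pow S.gammaA (n + 1)
  have hdiff := (P.hasParts_slash_pow_succ (G := S.gammaA) S.gamma_nine_mul_gamma9 n).sub hbasic
  have hparts := hbasic.add (hdiff.mul_realMat (S.Γ 10))
  rwa [sub_self, zero_mul, add_zero, sub_zero, zero_add, smul_mul_assoc] at hparts

theorem total_fluxB (n : ℕ) : P.total (S.fluxB n) =
    -P.basic (S.fiberA n) - P.fiber * P.basic (S.basicA n) := by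
  have hparts := (((S.hasParts_vielBPow_succ P (2 * n)).realMat_mul S.C).mul_realMat
    (S.Γ 9 * S.Γ 10 ^ n)).total_bil
  rw [mul_assoc _ (S.vielbein9 ^ _), vielbein9_odd_pow_mul, mul_smul_comm, smul_mul_assoc,
    mul_assoc (realMat ℬ S.C), gamma_nine_mul_vielbein9_even_pow_mul, mul_neg, mul_neg,
    ← mul_assoc, ← mul_assoc, ← map_mul, ← map_mul, smul_neg] at hparts
  rw [fluxB, basicA, fiberA, map_smul, hparts, map_neg, map_neg, map_neg, map_neg, map_nsmul,
    map_nsmul, mul_neg, mul_smul_comm, smul_add, smul_neg, smul_neg, succ_smul_inv_factorial_smul,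
    map_smul, map_smul, mul_smul_comm, sub_eq_add_neg]

end

/-- The splitting of the type IIA forms by the extension along `c₁ᴬ`. -/
def splitA : FiberSplit ι (GCAlg S.dim9.extDeg) :=
  extSplit S.extA.pull extIdent_pull_psi extIdent_pull_vec_castSucc extIdent_pull_vec_last

/-- The splitting of the type IIB forms by the extension along `c₁ᴮ`. -/
def splitB : FiberSplit ι (GCAlg S.dim9.extDeg) :=
  extSplit S.extB.pull extIdent_pull_psi extIdent_pull_vec_castSucc extIdent_pull_vec_last

theorem extA_pull_H3A : S.extA.pull S.H3A = S.dim9.basicIncl S.basicH +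
    GCAlg.gen S.dim9.extDeg none * S.dim9.basicIncl S.c1B :=
  S.splitA.total_sum_quad_mul_vec fun a => S.C * (S.gammaA a * S.Γ 10)

theorem extB_pull_H3B : S.extB.pull S.H3B = S.dim9.basicIncl S.basicH +
    GCAlg.gen S.dim9.extDeg none * S.dim9.basicIncl S.c1A := by
  have hsplit := S.splitB.total_sum_quad_mul_vec fun a => S.C * (S.gammaB a * S.Γ 10)
  have hlast : S.gammaB (Fin.last 9) * S.Γ 10 = S.Γ 9 := by
    rw [show Fin.last 9 = 9 from rfl, gammaB_nine, mul_assoc, gamma_ten_sq, mul_one]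
    rfl
  simp only [hlast, gammaB_castSucc] at hsplit
  exact hsplit

/-- The nine-dimensional components of the type IIA fluxes, as images of the generators of the
cyclification. -/
def reducedGen : CycGen KUGen → S.dim9.CE
  | .omega => S.c1A
  | .base .h3 => S.basicH
  | .base (.f k) => if k ≤ 0 then 0 else S.basicA (k - 1).toNat
  | .shift .h3 => -S.c1B
  | .shift (.f k) => if k ≤ 1 then 0 else -S.fiberA (k - 2).toNat

theorem reducedGen_mem (j : CycGen KUGen) :
    S.reducedGen j ∈ S.dim9.homog ((twistedKU 0).cycDeg j) := by
  rcases j with _ | (_ | k) | (_ | k)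
  · exact quad_mem _
  · exact S.basicH_mem
  · change (if k ≤ 0 then 0 else _) ∈ S.dim9.homog (2 * k + 0, 0)
    split_ifs with hk
    · exact zero_mem _
    · have hmem := S.basicA_mem (k - 1).toNat
      rwa [show 2 * (((k - 1).toNat : ℤ) + 1) = 2 * k + 0 by omega] at hmem
  · rw [show (twistedKU 0).cycDeg (.shift .h3) = (2, 0) by
      change ((3, 0) : BiDeg) + (-1, 0) = (2, 0)
      decide]
    exact neg_mem (quad_mem _)
  · rw [show (twistedKU 0).cycDeg (.shift (.f k)) = (2 * k - 1, 0) by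
      change ((2 * k + 0, 0) : BiDeg) + (-1, 0) = (2 * k - 1, 0)
      simp [sub_eq_add_neg]]
    change (if k ≤ 1 then 0 else _) ∈ _
    split_ifs with hk
    · exact zero_mem _
    · have hmem := S.fiberA_mem (k - 2).toNat
      rw [show 2 * (((k - 2).toNat : ℤ) + 1) + 1 = 2 * k - 1 by omega] at hmem
      exact neg_mem hmem

theorem extA_pull_FA (k : ℤ) :
    S.extA.pull (S.FA k) = S.dim9.basicIncl (S.reducedGen (.base (.f k))) -
      GCAlg.gen S.dim9.extDeg none * S.dim9.basicIncl (S.reducedGen (.shift (.f k))) := by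
  rcases le_or_gt k 0 with hk | hk
  · rw [S.FA_of_nonpos hk, reducedGen, reducedGen, if_pos hk, if_pos (by omega)]
    simp only [map_zero, mul_zero, sub_zero]
  · obtain ⟨n, rfl⟩ : ∃ n : ℕ, k = n + 1 := ⟨(k - 1).toNat, by omega⟩
    rw [FA_succ, reducedGen, reducedGen, if_neg (by omega),
      show ((n : ℤ) + 1 - 1).toNat = n by omega]
    cases n with
    | zero =>
      rw [if_pos (by simp), map_zero, mul_zero, sub_zero]
      exact S.total_fluxA_zero S.splitA
    | succ n =>
      rw [if_neg (by omega), show (((n + 1 : ℕ) : ℤ) + 1 - 2).toNat = n by omega, map_neg, mul_neg,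
        sub_neg_eq_add]
      exact S.total_fluxA_succ S.splitA n

theorem extB_pull_FB (k : ℤ) :
    S.extB.pull (S.FB k) = S.dim9.basicIncl (S.reducedGen (.shift (.f (k + 1)))) -
      GCAlg.gen S.dim9.extDeg none * S.dim9.basicIncl (S.reducedGen (.base (.f k))) := by
  rcases le_or_gt k 0 with hk | hk
  · rw [S.FB_of_nonpos hk, reducedGen, reducedGen, if_pos hk, if_pos (by omega)]
    simp only [map_zero, mul_zero, sub_zero]
  · obtain ⟨n, rfl⟩ : ∃ n : ℕ, k = n + 1 := ⟨(k - 1).toNat, by omega⟩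
    rw [FB_succ, reducedGen, reducedGen, if_neg (by omega), if_neg (by omega),
      show ((n : ℤ) + 1 - 1).toNat = n by omega, show ((n : ℤ) + 1 + 1 - 2).toNat = n by omega,
      map_neg]
    exact S.total_fluxB S.splitB n

theorem exists_IIA_hom : ∃ f : Hom S.IIA (twistedKU 0), HasComponents f S.H3A S.FA :=
  exists_hasComponents S.H3A_mem (fun k => by rw [add_zero]; exact S.FA_mem k) S.d_H3A S.d_FA

theorem exists_IIA_reduction {fA : Hom S.IIA (twistedKU 0)} (hA : HasComponents fA S.H3A S.FA) :
    ∃ r : Hom S.dim9 (twistedKU 0).cyc, IsReduction (S.extA.comp fA) r ∧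
      ∀ j, r.pull ((twistedKU 0).cyc.gen j) = S.reducedGen j := by
  refine exists_reduction (S.extA.comp fA) S.reducedGen S.reducedGen_mem rfl ?_
  rintro (_ | k)
  · change S.extA.pull (fA.pull _) = _
    rw [hA.1, extA_pull_H3A, reducedGen, reducedGen, map_neg, mul_neg, sub_neg_eq_add]
  · change S.extA.pull (fA.pull _) = _
    rw [hA.2]
    exact S.extA_pull_FA k

theorem oxidation_hasComponents {r : Hom S.dim9 (twistedKU 0).cyc}
    (hr : ∀ j, r.pull ((twistedKU 0).cyc.gen j) = S.reducedGen j) :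
    ∃ f : Hom (S.dim9.centralExt S.c1B (quad_mem _) (gradedDer_quad _ _)) (twistedKU 1),
      IsReduction f (r.comp tDuality) ∧
      HasComponents f (S.extB.pull S.H3B) fun k => S.extB.pull (S.FB k) := by
  have hT : ∀ j, (r.comp tDuality).pull ((twistedKU 1).cyc.gen j) = r.pull (tGen j) :=
    fun j => congrArg r.pull (tDuality_pull_gen j)
  obtain ⟨f, hf⟩ := exists_oxidation (hc := quad_mem _) (hdc := gradedDer_quad _ _) (c := S.c1B)
    (r.comp tDuality) (by rw [hT, tGen, map_neg, hr, reducedGen, neg_neg])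
  refine ⟨f, hf, ?_, fun k => ?_⟩
  · rw [hf.2, hT, hT, tGen, tGen, map_neg, hr, hr, reducedGen, reducedGen, map_neg, mul_neg,
      sub_neg_eq_add]
    exact S.extB_pull_H3B.symm
  · rw [hf.2, hT, hT, tGen, tGen, hr, hr]
    exact (S.extB_pull_FB k).symm

theorem extA_isIso : S.extA.IsIso := extIdent_isIso

theorem extB_isIso : S.extB.IsIso := extIdent_isIso

end Majorana11

end SuperL

end

theorem mainTheorem6 {ι : Type} [Fintype ι] [DecidableEq ι] (S : Majorana11 ι) :
    -- the invariants have the right bidegrees and satisfy the Bianchi identities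
    S.H3B ∈ S.IIB.homog (3, 0) ∧
    (∀ k : ℤ, S.FB k ∈ S.IIB.homog (2 * k + 1, 0)) ∧
    S.IIB.d S.H3B = 0 ∧
    (∀ k : ℤ, S.IIB.d (S.FB k) = S.H3B * S.FB (k - 1)) ∧
    -- such systems of elements are equivalently homomorphisms to `𝔩 (Σ¹ KU // BU(1))`
    (∀ (H : S.IIB.CE) (F : ℤ → S.IIB.CE),
      (H ∈ S.IIB.homog (3, 0) ∧ (∀ k : ℤ, F k ∈ S.IIB.homog (2 * k + 1, 0)) ∧
        S.IIB.d H = 0 ∧ ∀ k : ℤ, S.IIB.d (F k) = H * F (k - 1)) ↔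
      ∃! f : Hom S.IIB (twistedKU 1), HasComponents f H F) ∧
    -- in particular, the invariants are the components of a homomorphism
    ∃ fB : Hom S.IIB (twistedKU 1),
      HasComponents fB S.H3B S.FB ∧
      -- over `𝔩 B²U(1)`
      (∃ hB : Hom S.IIB lineB2U1, hB.pull (lineB2U1.gen ()) = S.H3B ∧ fB.comp (kuFib 1) = hB) ∧
      -- which is obtained from the type IIA cocycles by reduction to 9 dimensions, the T-duality
      -- isomorphism of coefficients, and re-oxidation
      S.extA.IsIso ∧ S.extB.IsIso ∧ tDuality.IsIso ∧
      ∃ fA : Hom S.IIA (twistedKU 0), HasComponents fA S.H3A S.FA ∧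
        ∃ r : Hom S.dim9 (twistedKU 0).cyc,
          IsReduction (S.extA.comp fA) r ∧ IsReduction (S.extB.comp fB) (r.comp tDuality) := by
  obtain ⟨fA, hA⟩ := S.exists_IIA_hom
  obtain ⟨r, hr, hgen⟩ := S.exists_IIA_reduction hA
  obtain ⟨f, hf, hfB⟩ := S.oxidation_hasComponents hgen
  obtain ⟨-, -, hdH, hdF⟩ := hfB.bianchi
  have dH : S.IIB.d S.H3B = 0 := S.extB_isIso.1 (by rw [S.extB.pull_d, hdH, map_zero])
  have dF : ∀ k, S.IIB.d (S.FB k) = S.H3B * S.FB (k - 1) := fun k =>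
    S.extB_isIso.1 (by rw [S.extB.pull_d, hdF, map_mul])
  obtain ⟨fB, hB⟩ := exists_hasComponents (m := 1) S.H3B_mem S.FB_mem dH dF
  have hcomp : S.extB.comp fB = f :=
    HasComponents.unique ⟨congrArg S.extB.pull hB.1, fun k => congrArg S.extB.pull (hB.2 k)⟩ hfB
  have hfib : (fB.comp (kuFib 1)).pull (lineB2U1.gen ()) = S.H3B :=
    (congrArg fB.pull (Hom.ofGens_pull_gen _ _ _ _)).trans hB.1
  refine ⟨S.H3B_mem, S.FB_mem, dH, dF, fun H F => ⟨fun h => ?_, fun ⟨_, h, _⟩ => h.bianchi⟩, fB, hB,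
    ⟨fB.comp (kuFib 1), hfib, rfl⟩, S.extA_isIso, S.extB_isIso, tDuality_isIso, fA, hA, r, hr,
    hcomp ▸ hf⟩
  obtain ⟨g, hg⟩ := exists_hasComponents (m := 1) h.1 h.2.1 h.2.2.1 h.2.2.2
  exact ⟨g, hg, fun g' hg' => hg'.unique hg⟩
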